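/- **Setting.** Let $M$ be a (connected) Riemann surface and $n,r\in\mathbb N$. A bar denotes complex conjugation on $\mathbb C^n$ and on $n\times n$ matrices; $\pi_V,\pi_V^\perp$ are the orthogonal projections of $\mathbb C^n$ onto $V$, $V^\perp$. $\Omega U(n)$ is the group of smooth loops $\gamma:S^1\to U(n)$ with $\gamma(1)=I$; $\Omega_rU(n)$ is the set of those of the form $\sum_{k=0}^r\lambda^kT_k$; and $$\Omega_rU(n)^{\mathbb R}=\{\gamma\in\Omega_rU(n):\overline{\gamma(\lambda)}=\lambda^{-r}\gamma(\lambda)\},\qquad \Omega_rU(n)^{\nu}=\{\gamma\in\Omega_rU(n):\gamma(-\lambda)\gamma(-1)^{-1}=\gamma(\lambda)\}.$$ An *extended solution* is a smooth map $\Phi:M\to\Omega U(n)$ such that, in every local holomorphic coordinate $z$, $\Phi^{-1}\Phi_z=(1-\lambda^{-1})A$ with $A$ independent of $\lambda$. A *uniton* for $\Phi$ is a smooth subbundle $\alpha$ of $M\times\mathbb C^n$ whose smooth sections are preserved by $\partial_{\bar z}+\frac12\varphi^{-1}\varphi_{\bar z}$ and by $\frac12\varphi^{-1}\varphi_z$,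 where $\varphi=\Phi_{-1}$. A *uniton factorization* of $\Phi$ is a product $\Phi=\eta_0\eta_1\cdots\eta_{r-1}$, $\eta_i=\pi_{\alpha_{i+1}}+\lambda\pi_{\alpha_{i+1}}^\perp$, in which each $\alpha_{i+1}$ is a uniton for the extended solution $\Phi_i=\eta_0\cdots\eta_{i-1}$ (with $\Phi_0=I$). Let $H=L^2(S^1,\mathbb C^n)$, write $f=\sum_i\lambda^if_i$ and $P_if=f_i$, let $H_+=\{f: f_i=0 \text{ for } i<0\}$, and put $W=\Phi H_+$. For $1\le i\le r$ let $u_i=\lfloor (r-i+1)/2\rfloor$ ("Uhlenbeck step first") or $u_i=\lfloor (r-i)/2\rfloor$ ("Segal step first"), and $W_i=(\lambda^{-u_i}W\cap H_+)+\lambda^iH_+$ (the alternating filtration). Write $\Phi_i^{-1}=\sum_{s=0}^i\lambda^{-s}S^i_s$. For a meromorphic section $L=\sum_{i<r}\lambda^iL_i$ of the trivial bundle with fibre $H_+/\lambda^rH_+$ (with $L_i=0$ for $i<0$ and $i\geq r$) let $o(L)$ be the least $i$ with $L_i\not\equiv0$ ($o(0)=0$), let $\widehat L=\lambda^{-o(L)}L$,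 and let $L^{(k)}$ be the $k$-th derivative with respect to a local holomorphic coordinate. Call a finite family $\{L^j\}$ of such sections *adapted to $W$* if, off a discrete set, for each $0\le u\le r$ the space $W\cap\lambda^uH_+$ is spanned modulo $\lambda^rH_+$ by the $\lambda^\ell(L^j)^{(k)}$ with $k\le \ell$ and $u\le o(L^j)+\ell$. (The case $u=0$ says that the span $X$ of the $L^j$ generates $W$, that is, $W=X+\lambda X_{(1)}+\dots+\lambda^{r-1}X_{(r-1)}+\lambda^rH_+$, where $X_{(i)}$ is the $i$-th osculating bundle of $X$.) **Theorem.** Let $\Phi:M\to\Omega_rU(n)^{\mathbb R}$ be an extended solution with $r=2s+1$ odd. Then $n=2m$ for some $m\in\mathbb N$, and there are finite families of meromorphic sections adapted to $W=\Phi H_+$. Moreover, for each of the two choices of first step, $\Phi$ has a uniton factorization $\Phi=\eta_0\eta_1\cdots\eta_{r-1}$, $\eta_i=\pi_{\alpha_{i+1}}+\lambda\pi_{\alpha_{i+1}}^\perp$, such that: 1. $\alpha_1$ is maximal isotropic in $\mathbb C^{2m}$ at each point, and is the $(0,1)$-space ($(-\mathrm i)$-eigenspace) of a holomorphic map $M\to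 O(2m)/U(m)$ into the space of orthogonal complex structures on $\mathbb R^{2m}$; 2. each quadratic factor $\eta_{2\ell-1}\eta_{2\ell}$ has values in $\Omega_2U(n)^{\mathbb R}$ $(\ell=1,\dots,s)$; 3. each even partial product $\eta_1\cdots\eta_{2j}$ has values in $\Omega_{2j}U(n)^{\mathbb R}$ $(j=1,\dots,s)$; 4. for $i=1,\dots,r$, off a discrete set (and hence, by continuity, determining $\alpha_i$), $$\alpha_i=P_0\Phi_{i-1}^{-1}W_i=\Bigl(\sum_{s=0}^{i-1}S^{i-1}_sP_s\Bigr)W_i,$$ and, for every finite family $\{L^j\}$ adapted to $W$, off a discrete set, with $u=u_i$, $$\alpha_i=\operatorname{span}\Bigl\{\sum_{s=0}^{i-1}S^{i-1}_s(L^j_{s-k+u})^{(k)}:0\le o(L^j)+k-u\le i-1\Bigr\}+\operatorname{span}\Bigl\{\sum_{s=0}^{i-1}S^{i-1}_s(\widehat L^j_s)^{(k)}:o(L^j)+k-u<0\Bigr\};$$ 5. if in addition $\Phi$ has values in $\Omega_rU(n)^{\nu}$, then each partial product $\eta_0\cdots\eta_i$ has values in $\Omega_{i+1}U(n)^{\nu}$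 $(i=0,\dots,r-1)$. -/

import Mathlib

open Set Filter Topology
open scoped Manifold ContDiff ComplexConjugate

namespace UnitonTheory

noncomputable section

/-! ### Linear algebra in `ℂⁿ` -/

/-- `ℂⁿ` with its standard Hermitian inner product. -/
abbrev E (n : ℕ) := EuclideanSpace ℂ (Fin n)

/-- Linear endomorphisms of `ℂⁿ`, that is, complex `n × n` matrices. -/
abbrev End (n : ℕ) := E n →L[ℂ] E n

/-- Complex conjugation of vectors of `ℂⁿ`. -/
def conjV {n : ℕ} (v : E n) : E n := WithLp.toLp 2 (fun i => conj (v i))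

/-- The complex conjugate of an endomorphism (entrywise conjugation of its matrix):
`v ↦ conj (A (conj v))`. -/
def conjOp {n : ℕ} (A : End n) : End n :=
  LinearMap.toContinuousLinearMap
    { toFun := fun v => conjV (A (conjV v))
      map_add' := by
        intro v w
        have h : conjV (v + w) = conjV v + conjV w := by
          ext i; simp [conjV]
        rw [h, map_add]
        ext i; simp [conjV]
      map_smul' := by
        intro c v
        have h : conjV (c • v) = (conj c : ℂ) • conjV v := by
          ext i; simp [conjV]
        rw [h, map_smul]
        ext i; simp [conjV] }

/-- `V` is isotropic for the standard complex symmetric bilinear form on `ℂⁿ`. -/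
def IsIsotropic {n : ℕ} (V : Submodule ℂ (E n)) : Prop :=
  ∀ v ∈ V, ∀ w ∈ V, ∑ i, v i * w i = 0

/-- Orthogonal projection onto `V`. -/
abbrev proj {n : ℕ} (V : Submodule ℂ (E n)) : End n := V.starProjection

/-- The linear factor `π_V + λ π_V^⊥`. -/
def linFactor {n : ℕ} (V : Submodule ℂ (E n)) (z : Circle) : End n :=
  proj V + (z : ℂ) • proj Vᗮ

/-! ### Loops -/

/-- The based loop group `Ω U(n)`: smooth maps from the circle to `U(n)` with value `I` at `1`. -/
def basedLoops (n : ℕ) : Set (Circle → End n) :=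
  {γ | ContMDiff (𝓡 1) 𝓘(ℝ, End n) ∞ γ ∧ (∀ z, γ z ∈ unitary (End n)) ∧ γ 1 = 1}

/-- `Ω_r U(n)`: based loops that are polynomials of degree at most `r` in `λ`. -/
def polyLoops (n r : ℕ) : Set (Circle → End n) :=
  {γ | γ ∈ basedLoops n ∧
    ∃ T : ℕ → End n, ∀ z : Circle, γ z = ∑ k ∈ Finset.range (r + 1), (z : ℂ) ^ k • T k}

/-- `Ω_r U(n)^ℝ`: elements of `Ω_r U(n)` with `conj Φ = λ^{-r} Φ`. -/
def realLoops (n r : ℕ) : Set (Circle → End n) :=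
  {γ | γ ∈ polyLoops n r ∧ ∀ z : Circle, conjOp (γ z) = ((z : ℂ) ^ r)⁻¹ • γ z}

/-- The involution `ν(η)(λ) = η(-λ) η(-1)⁻¹` (on unitary-valued loops, where the inverse is the
adjoint). -/
def nuInv {n : ℕ} (γ : Circle → End n) : Circle → End n :=
  fun z => γ (-z) * star (γ (-1))

/-- `Ω_r U(n)^ν`. -/
def nuLoops (n r : ℕ) : Set (Circle → End n) :=
  {γ | γ ∈ polyLoops n r ∧ nuInv γ = γ}

/-! ### The Grassmannian model -/

/-- The Hilbert space `L²(S¹, ℂⁿ)`, in terms of Fourier coefficients: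
`f` stands for `∑ λ^i f_i`. -/
abbrev H (n : ℕ) := lp (fun _ : ℤ => E n) 2

/-- The subspace `λ^k H_+`, of elements with `f_i = 0` for `i < k`. -/
def hPlus (n : ℕ) (k : ℤ) : Submodule ℂ (H n) where
  carrier := {f | ∀ i : ℤ, i < k → f i = 0}
  add_mem' := by
    intro f g hf hg i hi
    simp [hf i hi, hg i hi]
  zero_mem' := by intro i _; simp
  smul_mem' := by
    intro c f hf i hi
    simp [hf i hi]

/-- The subspace `λ^k W`. -/
def lamMul {n : ℕ} (k : ℤ) (W : Submodule ℂ (H n)) : Submodule ℂ (H n) where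
  carrier := {f | ∃ g ∈ W, ∀ i : ℤ, f i = g (i - k)}
  add_mem' := by
    rintro f f' ⟨g, hg, h⟩ ⟨g', hg', h'⟩
    exact ⟨g + g', W.add_mem hg hg', fun i => by simp [h i, h' i]⟩
  zero_mem' := ⟨0, W.zero_mem, fun i => by simp⟩
  smul_mem' := by
    rintro c f ⟨g, hg, h⟩
    exact ⟨c • g, W.smul_mem c hg, fun i => by simp [h i]⟩

/-- The `k`-th Fourier coefficient of a loop, so that `γ = ∑ λ^k T_k`. -/
def loopCoeff {n : ℕ} (γ : Circle → End n) (k : ℤ) : End n :=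
  fourierCoeff (T := 1) (fun t => γ (AddCircle.toCircle t)) k

/-- The Grassmannian model `W = γ H_+` of a loop `γ`, where `γ` acts on `H` by multiplication
(that is, on Fourier coefficients, by convolution). -/
def grassModel {n : ℕ} (γ : Circle → End n) : Submodule ℂ (H n) where
  carrier := {f | ∃ g ∈ hPlus n 0, ∀ i : ℤ, HasSum (fun k : ℤ => loopCoeff γ k (g (i - k))) (f i)}
  add_mem' := by
    rintro f f' ⟨g, hg, h⟩ ⟨g', hg', h'⟩
    exact ⟨g + g', (hPlus n 0).add_mem hg hg', fun i => by simpa using (h i).add (h' i)⟩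
  zero_mem' := ⟨0, (hPlus n 0).zero_mem, fun i => by simp⟩
  smul_mem' := by
    rintro c f ⟨g, hg, h⟩
    exact ⟨c • g, (hPlus n 0).smul_mem c hg, fun i => by simpa using (h i).const_smul c⟩

/-! ### Calculus on a Riemann surface -/

section RiemannSurface

variable {M : Type*} [TopologicalSpace M] [ChartedSpace ℂ M]

/-- Smooth (in the real sense) maps from a Riemann surface to a normed space. -/
def SmoothMap {F : Type*} [NormedAddCommGroup F] [NormedSpace ℝ F] (f : M → F) : Prop :=
  ContMDiff 𝓘(ℝ, ℂ) 𝓘(ℝ, F) ∞ f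

variable {F : Type*} [NormedAddCommGroup F] [NormedSpace ℂ F]

/-- `∂f/∂z` at `p`, where `z` is the coordinate given by the chart `e`. -/
def dz (e : OpenPartialHomeomorph M ℂ) (f : M → F) (p : M) : F :=
  (1 / 2 : ℂ) • (fderiv ℝ (f ∘ e.symm) (e p) 1 - Complex.I • fderiv ℝ (f ∘ e.symm) (e p) Complex.I)

/-- `∂f/∂z̄` at `p`, where `z` is the coordinate given by the chart `e`. -/
def dzbar (e : OpenPartialHomeomorph M ℂ) (f : M → F) (p : M) : F :=
  (1 / 2 : ℂ) • (fderiv ℝ (f ∘ e.symm) (e p) 1 + Complex.I • fderiv ℝ (f ∘ e.symm) (e p) Complex.I)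

/-- A smooth subbundle of the trivial bundle `M × ℂⁿ`. -/
def IsSmoothSubbundle {n : ℕ} (α : M → Submodule ℂ (E n)) : Prop :=
  SmoothMap fun p => proj (α p)

/-- A holomorphic subbundle of the trivial bundle `M × ℂⁿ` (equivalently, a holomorphic map into
the Grassmannian): there are local holomorphic frames. -/
def IsHolomorphicSubbundle {n : ℕ} (α : M → Submodule ℂ (E n)) : Prop :=
  ∀ p : M, ∃ U : Set M, IsOpen U ∧ p ∈ U ∧ ∃ (k : ℕ) (v : Fin k → M → E n),
    (∀ a, MDifferentiableOn 𝓘(ℂ, ℂ) 𝓘(ℂ, E n) (v a) U) ∧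
    ∀ q ∈ U, LinearIndependent ℂ (fun a => v a q) ∧
      Submodule.span ℂ (Set.range fun a => v a q) = α q

/-- The space `O(n)/U(n/2)` of orthogonal complex structures on `ℝⁿ`. -/
abbrev OrthCplxStr (n : ℕ) :=
  {J : Matrix (Fin n) (Fin n) ℝ // J ∈ Matrix.orthogonalGroup (Fin n) ℝ ∧ J * J = -1}

/-- The `(0,1)`-space of `J`: the `(-i)`-eigenspace of `J` in `ℂⁿ`. -/
def zeroOneSpace {n : ℕ} (J : OrthCplxStr n) : Submodule ℂ (E n) :=
  Module.End.eigenspace (Matrix.toEuclideanLin (J.1.map (fun x : ℝ => (x : ℂ)))) (-Complex.I)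

/-- Holomorphic maps into the space of orthogonal complex structures. Its complex structure is the
one for which `J ↦ zeroOneSpace J` is a holomorphic embedding in the Grassmannian. -/
def IsHolomorphicOCS {n : ℕ} (J : M → OrthCplxStr n) : Prop :=
  IsHolomorphicSubbundle fun p => zeroOneSpace (J p)

/-! ### Extended solutions and unitons -/

/-- Extended solutions `Φ : M → Ω U(n)`: smooth maps such that, in each local holomorphic
coordinate, `Φ⁻¹ Φ_z = (1 - λ⁻¹) A` with `A` independent of `λ`. -/
def IsExtendedSolution {n : ℕ} [IsManifold 𝓘(ℂ, ℂ) ω M] (Φ : M → Circle → End n) : Prop :=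
  (∀ p, Φ p ∈ basedLoops n) ∧
  ContMDiff (𝓘(ℝ, ℂ).prod (𝓡 1)) 𝓘(ℝ, End n) ∞ (fun q : M × Circle => Φ q.1 q.2) ∧
  ∀ e ∈ IsManifold.maximalAtlas 𝓘(ℂ, ℂ) ω M, ∃ A : M → End n, ∀ p ∈ e.source, ∀ z : Circle,
    star (Φ p z) * dz e (fun q => Φ q z) p = (1 - (z : ℂ)⁻¹) • A p

/-- `A^φ_z = ½ φ⁻¹ φ_z` for `φ : M → U(n)`. -/
def connZ {n : ℕ} (e : OpenPartialHomeomorph M ℂ) (φ : M → End n) (p : M) : End n :=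
  (1 / 2 : ℂ) • (star (φ p) * dz e φ p)

/-- `A^φ_z̄ = ½ φ⁻¹ φ_z̄` for `φ : M → U(n)`. -/
def connZbar {n : ℕ} (e : OpenPartialHomeomorph M ℂ) (φ : M → End n) (p : M) : End n :=
  (1 / 2 : ℂ) • (star (φ p) * dzbar e φ p)

/-- `α` is a uniton for the extended solution `Φ`: with `φ = Φ_{-1}`, it is a smooth subbundle
that is holomorphic for `D^φ_z̄ = ∂_z̄ + A^φ_z̄` and closed under `A^φ_z`. -/
def IsUniton {n : ℕ} [IsManifold 𝓘(ℂ, ℂ) ω M] (Φ : M → Circle → End n)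
    (α : M → Submodule ℂ (E n)) : Prop :=
  IsExtendedSolution Φ ∧ IsSmoothSubbundle α ∧
  ∀ e ∈ IsManifold.maximalAtlas 𝓘(ℂ, ℂ) ω M, ∀ σ : M → E n, SmoothMap σ → (∀ p, σ p ∈ α p) →
    ∀ p ∈ e.source,
      dzbar e σ p + connZbar e (fun q => Φ q (-1)) p (σ p) ∈ α p ∧
      connZ e (fun q => Φ q (-1)) p (σ p) ∈ α p

/-- With `η_i = π_{α_{i+1}} + λ π_{α_{i+1}}^⊥`, the product `η_a η_{a+1} ⋯ η_{a+k-1}` of `k`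
consecutive factors, at the point `p`. -/
def etaProd {n : ℕ} (α : ℕ → M → Submodule ℂ (E n)) (a : ℕ) : ℕ → M → Circle → End n
  | 0, _, _ => 1
  | k + 1, p, z => etaProd α a k p z * linFactor (α (a + k + 1) p) z

/-- `Φ = η_0 η_1 ⋯ η_{r-1}` is a uniton factorization with unitons `α_1, …, α_r`: each `α_i` is a
uniton for the preceding partial product. -/
def IsUnitonFactorization {n : ℕ} [IsManifold 𝓘(ℂ, ℂ) ω M] (r : ℕ) (Φ : M → Circle → End n)
    (α : ℕ → M → Submodule ℂ (E n)) : Prop :=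
  (∀ p z, Φ p z = etaProd α 0 r p z) ∧
  ∀ i < r, IsUniton (etaProd α 0 i) (α (i + 1))

/-! ### The alternating filtration and the explicit formula -/

/-- The kind of the first step of an alternating filtration. -/
inductive FirstStep
  | uhlenbeck
  | segal

/-- The number of Uhlenbeck steps among the first `r - i` steps of the alternating filtration. -/
def numUhl : FirstStep → ℕ → ℕ → ℕ
  | .uhlenbeck, r, i => (r - i + 1) / 2
  | .segal, r, i => (r - i) / 2

/-- The result `(λ^{-u} W ∩ H_+) + λ^i H_+` of applying to `W` the first `r - i` alternating steps
(`u` of which are Uhlenbeck steps `W_j ↦ λ⁻¹ W_j ∩ H_+`, the others being Segal steps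
`W_j ↦ W_j + λ^{j-1} H_+`). -/
def altStep {n : ℕ} (a : FirstStep) (r i : ℕ) (W : Submodule ℂ (H n)) : Submodule ℂ (H n) :=
  (lamMul (-(numUhl a r i : ℤ)) W ⊓ hPlus n 0) ⊔ hPlus n i

/-- The coefficients `S^i_s` of
`((π_{V_1} + λ π_{V_1}^⊥) ⋯ (π_{V_i} + λ π_{V_i}^⊥))⁻¹ = ∑_s λ^{-s} S^i_s`: the sum of all products
`Π_i ⋯ Π_1` in which exactly `s` of the `Π_j` are `π_{V_j}^⊥` and the others are `π_{V_j}`. -/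
def invCoeff {n : ℕ} (V : ℕ → Submodule ℂ (E n)) : ℕ → ℕ → End n
  | 0, 0 => 1
  | 0, _ + 1 => 0
  | i + 1, 0 => proj (V (i + 1)) * invCoeff V i 0
  | i + 1, s + 1 => proj (V (i + 1)) * invCoeff V i (s + 1) + proj (V (i + 1))ᗮ * invCoeff V i s

/-- The space `H_+ / λ^r H_+` of polynomials `∑_{i<r} λ^i x_i`. -/
abbrev Jet (r n : ℕ) := Fin r → E n

/-- The coefficient `x_i` of `x`, for any integer `i` (zero unless `0 ≤ i < r`). -/
def Jet.coeff {r n : ℕ} (x : Jet r n) (i : ℤ) : E n :=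
  if h : 0 ≤ i ∧ i < r then x ⟨i.toNat, by omega⟩ else 0

/-- The element `λ^l x` of `H`. -/
def Jet.toH {r n : ℕ} (l : ℕ) (x : Jet r n) : H n :=
  ∑ i : Fin r, lp.single 2 ((i : ℤ) + (l : ℤ)) (x i)

/-- Meromorphic sections of the trivial bundle with fibre `H_+ / λ^r H_+`. -/
def IsMeromorphicSection {r n : ℕ} [IsManifold 𝓘(ℂ, ℂ) ω M] (L : M → Jet r n) : Prop :=
  ∀ e ∈ IsManifold.maximalAtlas 𝓘(ℂ, ℂ) ω M, ∀ p ∈ e.source, MeromorphicAt (L ∘ e.symm) (e p)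

/-- The order of a meromorphic section: the least `i` such that `L_i` is not identically zero
(away from a discrete set). -/
def order {r n : ℕ} (L : M → Jet r n) : ℕ :=
  sInf {i : ℕ | ¬ ∀ᶠ p in codiscrete M, (L p).coeff i = 0}

/-- The `k`-th derivative `L^{(k)}` at `p` with respect to the coordinate given by `e`. -/
def derivK {r n : ℕ} (e : OpenPartialHomeomorph M ℂ) (k : ℕ) (L : M → Jet r n) (p : M) : Jet r n :=
  iteratedDeriv k (L ∘ e.symm) (e p)

/-- The meromorphic sections `L^1, …, L^N` form an adapted spanning set for `W`: away from a
discrete set, for `0 ≤ u ≤ r`, the space `W ∩ λ^u H_+` is spanned modulo `λ^r H_+` by the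
`λ^l (L^j)^{(k)}` with `k ≤ l` and `u ≤ o(L^j) + l`. For `u = 0` this says that the span `X` of the
`L^j` generates `W`, that is, `W = X + λ X_(1) + ⋯ + λ^{r-1} X_(r-1) + λ^r H_+`. -/
def IsAdapted {r n N : ℕ} [IsManifold 𝓘(ℂ, ℂ) ω M] (W : M → Submodule ℂ (H n))
    (L : Fin N → M → Jet r n) : Prop :=
  (∀ j, IsMeromorphicSection (L j)) ∧
  ∀ u ≤ r, ∀ᶠ p in codiscrete M, ∀ e ∈ IsManifold.maximalAtlas 𝓘(ℂ, ℂ) ω M, p ∈ e.source →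
    W p ⊓ hPlus n u =
      Submodule.span ℂ {f | ∃ (j : Fin N) (k l : ℕ), k ≤ l ∧ u ≤ order (L j) + l ∧
        f = Jet.toH l (derivK e k (L j) p)} ⊔ hPlus n r

/-- The first set of spanning vectors for `α_i`:
`∑_{s<i} S^{i-1}_s (L^j_{s-k+u})^{(k)}` with `0 ≤ o(L^j) + k - u ≤ i - 1`. -/
def spanSetA {r n N : ℕ} (e : OpenPartialHomeomorph M ℂ) (L : Fin N → M → Jet r n)
    (S : ℕ → End n) (i u : ℕ) (p : M) : Set (E n) :=
  {x | ∃ (j : Fin N) (k : ℕ),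
    0 ≤ (order (L j) : ℤ) + k - u ∧ (order (L j) : ℤ) + k - u ≤ (i : ℤ) - 1 ∧
    x = ∑ s ∈ Finset.range i, S s ((derivK e k (L j) p).coeff ((s : ℤ) - k + u))}

/-- The second set of spanning vectors for `α_i`, where `L̂^j = λ^{-o(L^j)} L^j`:
`∑_{s<i} S^{i-1}_s (L̂^j_s)^{(k)}` with `o(L^j) + k - u < 0`. -/
def spanSetB {r n N : ℕ} (e : OpenPartialHomeomorph M ℂ) (L : Fin N → M → Jet r n)
    (S : ℕ → End n) (i u : ℕ) (p : M) : Set (E n) :=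
  {x | ∃ (j : Fin N) (k : ℕ),
    (order (L j) : ℤ) + k - u < 0 ∧
    x = ∑ s ∈ Finset.range i, S s ((derivK e k (L j) p).coeff ((s : ℤ) + order (L j)))}

/-- The unitons `α_1, …, α_r` are given (away from a discrete set, which determines them) by the
alternating filtration: `α_i = P_0 Φ_{i-1}⁻¹ W_i = (∑_{s<i} S^{i-1}_s P_s) W_i`. -/
def GivenByFiltration {n : ℕ} (a : FirstStep) (r : ℕ) (W : M → Submodule ℂ (H n))
    (α : ℕ → M → Submodule ℂ (E n)) : Prop :=
  ∀ i ∈ Finset.Icc 1 r, ∀ᶠ p in codiscrete M,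
    (α i p : Set (E n)) = {x | ∃ w ∈ altStep a r i (W p),
      x = ∑ s ∈ Finset.range i, invCoeff (fun j => α j p) (i - 1) s (w (s : ℤ))}

/-- The unitons `α_1, …, α_r` are given explicitly in terms of the sections `L^1, …, L^N`. -/
def GivenBySections {r n N : ℕ} [IsManifold 𝓘(ℂ, ℂ) ω M] (a : FirstStep)
    (L : Fin N → M → Jet r n) (α : ℕ → M → Submodule ℂ (E n)) : Prop :=
  ∀ i ∈ Finset.Icc 1 r, ∀ᶠ p in codiscrete M,
    ∀ e ∈ IsManifold.maximalAtlas 𝓘(ℂ, ℂ) ω M, p ∈ e.source →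
      α i p =
        Submodule.span ℂ
          (spanSetA e L (invCoeff (fun j => α j p) (i - 1)) i (numUhl a r i) p) ⊔
        Submodule.span ℂ
          (spanSetB e L (invCoeff (fun j => α j p) (i - 1)) i (numUhl a r i) p)

end RiemannSurface

end

end UnitonTheory

open UnitonTheory

namespace UnitonTheory

noncomputable section

/-! The Grassmannian model `W = Φ H_+` of a polynomial loop of degree `r` satisfies `λ^r H_+ ⊆ W ⊆
H_+`, so it amounts to a subspace of the finite-dimensional space of jets `H_+ / λ^r H_+`. A based
unitary loop is determined by its model (`polyLoop_eq_of_WS_eq_of_one`), and the properties in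
question are read off from `W`. For an extended solution, `W` is holomorphic and closed under `λ
∂_z` (`holAt_comap_WS`, `dcAt_comap_WS`). The condition `conj Φ = λ^{-r} Φ` says that `W` is its own
annihilator for the symmetric pairing that takes `f`, `g` to the coefficient of `λ^{r-1}` in `f ⬝ g`
(`isLagr_of_real`, `real_of_isLagr`). Invariance under `ν` says that `W` is invariant under `λ ↦ -λ`
(`isTau_of_nu`, `nu_of_isTau`).

Every chain `H_+ = W_0 ⊇ W_1 ⊇ ⋯ ⊇ W_r = W` with `λ W_i ⊆ W_{i+1}` comes from linear factors: with
`α_{i+1} = P_0 Φ_i⁻¹ W_{i+1}` one has `Φ_i H_+ = W_i` for all `i` (`IsFiltr.comap_ext_WS`). If the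
`W_i` are holomorphic and closed under `λ ∂_z`, each `α_{i+1}` is a uniton and each partial product
is an extended solution (`FiltrBundle.isUniton`, `FiltrBundle.extCoeffs`). The alternating
filtration is such a chain because `u_{i+1} ≤ u_i ≤ u_{i+1} + 1`. Its terms are holomorphic bundles
only off a discrete set, but suitable projections onto them continue analytically across it
(`exists_fill`), and the inclusions and the differential conditions persist by continuity
(`exists_filtrBundle`).

If `r - i` is even, then `r = i + 2u_i` for both choices of first step, and `W_i` is the reduction
of the Lagrangian space `W` with respect to `λ^{u_i} H_+`; hence it is Lagrangian for the pairing of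
degree `i` (`IsLagr.altS`). So `Φ_1, Φ_3, …` are real, and so are their quotients. In degree one,
reality says `conj π = 1 - π` for the projection `π` onto `α_1`; this makes `α_1` maximal isotropic
and the `(0,1)`-space of the orthogonal complex structure `2 Im π`, which forces `n` to be even.

The explicit formula (`span_formula`) holds because `P_0 Φ_{i-1}⁻¹` annihilates `λ W_{i-1}` and `λ^i
H_+`. Of the vectors `λ^{l-u} (L^j)^{(k)}` that span `λ^{-u} W ∩ H_+`, only those with `l = k` or
`o(L^j) + l = u` survive. Adapted families exist because on a connected surface a meromorphic bundle
has a constant complement off a discrete set, and projecting constant vectors along it gives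
meromorphic spanning sections (`MeroBundle.exists_sections`). -/

/-! ### Coefficients of trigonometric polynomials -/

/-- The character `z ↦ z ^ m` of the circle, with values in `ℂ`. -/
def circleChar (m : ℤ) : Circle →* ℂ :=
  Circle.coeHom.comp (zpowGroupHom m)

lemma circleChar_apply (m : ℤ) (z : Circle) : circleChar m z = (z : ℂ) ^ m := by
  change ((z ^ m : Circle) : ℂ) = _
  exact Circle.coe_zpow z m

/-- If two characters agree at `e^i`, the difference of their exponents is an integer multiple of
`2π`, which contradicts the irrationality of `π` unless it is zero. -/
lemma circleChar_injective : Function.Injective circleChar := by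
  intro m k h
  by_contra hne
  have hj : m - k ≠ 0 := sub_ne_zero.mpr hne
  have h1 := DFunLike.congr_fun h (Circle.exp 1)
  have h2 : Circle.exp (m - k : ℝ) = 1 := by
    apply Circle.ext
    have : (Circle.exp (1 : ℝ) : ℂ) ^ m = (Circle.exp (1 : ℝ) : ℂ) ^ k := by
      simpa [circleChar_apply] using h1
    rw [Circle.coe_exp, ← Complex.exp_int_mul, ← Complex.exp_int_mul] at this
    rw [Circle.coe_exp]
    push_cast
    have e : ((m : ℂ) - k) * Complex.I = m * ((1 : ℝ) * Complex.I) - k * ((1 : ℝ) * Complex.I) := by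
      push_cast; ring
    rw [e, Complex.exp_sub, this, div_self (Complex.exp_ne_zero _)]
  obtain ⟨j, hj'⟩ := Circle.exp_eq_one.mp h2
  have hpi : Irrational Real.pi := irrational_pi
  have hj0 : j ≠ 0 := by
    rintro rfl
    simp at hj'
    exact hj (by exact_mod_cast hj')
  apply hpi.ne_rat ((m - k : ℚ) / (2 * j))
  push_cast
  have : (j : ℝ) ≠ 0 := by exact_mod_cast hj0
  field_simp
  linarith

/-- The coefficients of a trigonometric polynomial that vanishes on the circle are zero. -/
lemma circle_coeff_eq_zero {ι F : Type*} [AddCommGroup F] [Module ℂ F] (s : Finset ι) (e : ι → ℤ)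
    (c : ι → F) (h : ∀ z : Circle, ∑ i ∈ s, (z : ℂ) ^ e i • c i = 0) (m : ℤ) :
    ∑ i ∈ s with e i = m, c i = 0 := by
  classical
  rw [← Module.forall_dual_apply_eq_zero_iff ℂ]
  intro φ
  have hli : LinearIndependent ℂ (fun m : ℤ => (circleChar m : Circle → ℂ)) :=
    (linearIndependent_monoidHom Circle ℂ).comp _ circleChar_injective
  rw [linearIndependent_iff'] at hli
  by_cases hm : m ∈ s.image e
  · have := hli (s.image e) (fun m => φ (∑ i ∈ s with e i = m, c i)) ?_ m hm
    · exact this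
    · ext z
      have h1 := congrArg φ (h z)
      rw [map_sum, map_zero] at h1
      rw [Finset.sum_apply, Pi.zero_apply, ← h1,
        ← Finset.sum_fiberwise_of_maps_to (fun i hi => Finset.mem_image_of_mem e hi)]
      refine Finset.sum_congr rfl fun j _ => ?_
      rw [Pi.smul_apply, circleChar_apply, map_sum, smul_eq_mul, Finset.sum_mul]
      refine Finset.sum_congr rfl fun i hi => ?_
      rw [(Finset.mem_filter.mp hi).2, map_smul, smul_eq_mul, mul_comm]
  · rw [Finset.filter_false_of_mem]
    · simp
    · rintro i hi rfl
      exact hm (Finset.mem_image_of_mem e hi)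

/-- Linear functionals of the coefficients are determined by the values on the circle. -/
lemma circle_functional_eq {ι κ F G : Type*} [AddCommGroup F] [Module ℂ F] [AddCommGroup G]
    [Module ℂ G] (s : Finset ι) (e : ι → ℤ) (c : ι → F) (t : Finset κ) (e' : κ → ℤ) (c' : κ → F)
    (h : ∀ z : Circle, ∑ i ∈ s, (z : ℂ) ^ e i • c i = ∑ i ∈ t, (z : ℂ) ^ e' i • c' i)
    (g : ℤ → F →ₗ[ℂ] G) :
    ∑ i ∈ s, g (e i) (c i) = ∑ i ∈ t, g (e' i) (c' i) := by
  classical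
  -- All terms are moved to one side. Grouped by exponent `m`, the coefficients in each group add up
  -- to zero, and `g m` is linear on the group.
  have key : ∑ i ∈ s.disjSum t, g (Sum.elim e e' i) (Sum.elim c (fun i => -c' i) i) = 0 := by
    rw [← Finset.sum_fiberwise_of_maps_to
      (fun i hi => Finset.mem_image_of_mem (Sum.elim e e') hi)]
    refine Finset.sum_eq_zero fun m _ => ?_
    have := circle_coeff_eq_zero (s.disjSum t) (Sum.elim e e') (Sum.elim c (fun i => -c' i))
      (fun z => by
        rw [Finset.sum_disjSum]
        simp [h z]) m
    rw [← map_zero (g m), ← this, map_sum]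
    refine Finset.sum_congr rfl fun i hi => ?_
    rw [(Finset.mem_filter.mp hi).2]
  rw [Finset.sum_disjSum] at key
  simpa [add_neg_eq_zero] using key

/-! ### Loops acting on sequences of coefficients -/

/-- Sequences of coefficients of formal Laurent series, with no convergence condition. -/
abbrev Sq (n : ℕ) := ℤ → E n

/-- The polynomial loop `∑_{k ≤ r} λ^k T_k`. -/
def polyLoop {n : ℕ} (r : ℕ) (T : ℕ → End n) (z : Circle) : End n :=
  ∑ k ∈ Finset.range (r + 1), (z : ℂ) ^ k • T k

/-- Multiplication by the polynomial loop `∑_{k ≤ r} λ^k T_k`. -/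
def mulS {n : ℕ} (r : ℕ) (T : ℕ → End n) : Sq n →ₗ[ℂ] Sq n where
  toFun f i := ∑ k ∈ Finset.range (r + 1), T k (f (i - k))
  map_add' f g := by ext1 i; simp [Finset.sum_add_distrib]
  map_smul' c f := by ext1 i; simp [Finset.smul_sum]

/-- Multiplication by the adjoint of the polynomial loop `∑_{k ≤ r} λ^k T_k`. -/
def divS {n : ℕ} (r : ℕ) (T : ℕ → End n) : Sq n →ₗ[ℂ] Sq n where
  toFun f i := ∑ k ∈ Finset.range (r + 1), star (T k) (f (i + k))
  map_add' f g := by ext1 i; simp [Finset.sum_add_distrib]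
  map_smul' c f := by ext1 i; simp [Finset.smul_sum]

/-- Multiplication by `λ^k`. -/
def sh {n : ℕ} (k : ℤ) : Sq n →ₗ[ℂ] Sq n where
  toFun f i := f (i - k)
  map_add' _ _ := rfl
  map_smul' _ _ := rfl

/-- Sequences of order at least `k`. -/
def pos (n : ℕ) (k : ℤ) : Submodule ℂ (Sq n) where
  carrier := {f | ∀ i < k, f i = 0}
  add_mem' hf hg i hi := by simp [hf i hi, hg i hi]
  zero_mem' i _ := rfl
  smul_mem' c f hf i hi := by simp [hf i hi]

/-- The constant sequence `v λ^0`. -/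
def dl {n : ℕ} : E n →ₗ[ℂ] Sq n where
  toFun v i := if i = 0 then v else 0
  map_add' v w := by ext1 i; by_cases h : i = 0 <;> simp [h]
  map_smul' c v := by ext1 i; by_cases h : i = 0 <;> simp [h]

variable {n r : ℕ} {T T' : ℕ → End n}

lemma mulS_apply (f : Sq n) (i : ℤ) :
    mulS r T f i = ∑ k ∈ Finset.range (r + 1), T k (f (i - k)) := rfl

lemma divS_apply (f : Sq n) (i : ℤ) :
    divS r T f i = ∑ k ∈ Finset.range (r + 1), star (T k) (f (i + k)) := rfl

lemma sh_apply (k : ℤ) (f : Sq n) (i : ℤ) : sh k f i = f (i - k) := rfl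

lemma dl_apply (v : E n) (i : ℤ) : dl v i = if i = 0 then v else 0 := rfl

@[simp] lemma dl_zero (v : E n) : dl v 0 = v := by simp [dl_apply]

lemma mem_pos {k : ℤ} {f : Sq n} : f ∈ pos n k ↔ ∀ i < k, f i = 0 := Iff.rfl

lemma pos_mono {k l : ℤ} (h : k ≤ l) : pos n l ≤ pos n k :=
  fun _ hf i hi => hf i (hi.trans_le h)

lemma dl_mem_pos (v : E n) : dl v ∈ pos n 0 := fun i hi => by simp [dl_apply, hi.ne]

lemma sh_sh (k l : ℤ) (f : Sq n) : sh k (sh l f) = sh (k + l) f := by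
  ext1 i; simp only [sh_apply]; congr 1; ring

lemma sh_zero (f : Sq n) : sh 0 f = f := by
  ext1 i; simp [sh_apply]

lemma sh_mem_pos {k l : ℤ} {f : Sq n} : sh k f ∈ pos n l ↔ f ∈ pos n (l - k) := by
  constructor
  · intro h i hi
    simpa [sh_apply] using h (i + k) (by omega)
  · intro h i hi
    exact h _ (by omega)

lemma mulS_sh (k : ℤ) (f : Sq n) : mulS r T (sh k f) = sh k (mulS r T f) := by
  ext1 i; simp only [mulS_apply, sh_apply]; congr! 3; ring

lemma divS_sh (k : ℤ) (f : Sq n) : divS r T (sh k f) = sh k (divS r T f) := by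
  ext1 i; simp only [divS_apply, sh_apply]; congr! 3; ring

lemma mulS_mem_pos {k : ℤ} {f : Sq n} (hf : f ∈ pos n k) : mulS r T f ∈ pos n k := by
  intro i hi
  rw [mulS_apply]
  exact Finset.sum_eq_zero fun j _ => by rw [hf _ (by omega), map_zero]

lemma divS_mem_pos {k : ℤ} {f : Sq n} (hf : f ∈ pos n (k + r)) : divS r T f ∈ pos n k := by
  intro i hi
  rw [divS_apply]
  refine Finset.sum_eq_zero fun j hj => ?_
  rw [hf _ (by have := Finset.mem_range.mp hj; omega), map_zero]

lemma star_polyLoop (z : Circle) :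
    star (polyLoop r T z) = ∑ k ∈ Finset.range (r + 1), (z : ℂ) ^ (-(k : ℤ)) • star (T k) := by
  have := map_sum (starAddEquiv (R := End n)) (fun k : ℕ => (z : ℂ) ^ k • T k)
    (Finset.range (r + 1))
  refine this.trans (Finset.sum_congr rfl fun k _ => ?_)
  change star ((z : ℂ) ^ k • T k) = _
  rw [star_smul, star_pow, zpow_neg, zpow_natCast, Complex.star_def, ← Circle.coe_inv_eq_conj,
    Circle.coe_inv, inv_pow]

/-- The coefficient of degree `i` is a linear functional of the coefficients of `γ⁎γ`, namely `∑ A_m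
↦ ∑ A_m (f (i - m))`, so the pointwise identity `γ⁎γ = 1` suffices. All sums are finite, and no
convergence condition on `f` is needed. -/
lemma divS_mulS (hU : ∀ z, star (polyLoop r T z) * polyLoop r T z = 1) (f : Sq n) :
    divS r T (mulS r T f) = f := by
  ext1 i
  let g : ℤ → End n →ₗ[ℂ] E n := fun m =>
    { toFun := fun A => A (f (i - m)), map_add' := fun _ _ => rfl, map_smul' := fun _ _ => rfl }
  have := circle_functional_eq (Finset.range (r + 1) ×ˢ Finset.range (r + 1))
    (fun x => (x.2 : ℤ) - x.1) (fun x => star (T x.1) * T x.2) (Finset.univ : Finset Unit)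
    (fun _ => 0) (fun _ => (1 : End n)) (fun z => by
      rw [Finset.sum_product]
      simp only [zpow_zero, one_smul, Finset.univ_unique, Finset.sum_singleton]
      rw [← hU z, star_polyLoop, polyLoop, Finset.sum_mul]
      refine Finset.sum_congr rfl fun k _ => ?_
      rw [Finset.mul_sum]
      refine Finset.sum_congr rfl fun l _ => ?_
      rw [smul_mul_smul_comm, sub_eq_neg_add, zpow_add₀ (Circle.coe_ne_zero z), zpow_natCast]) g
  simp only [Finset.univ_unique, Finset.sum_singleton, Finset.sum_product, g, LinearMap.coe_mk,
    AddHom.coe_mk, sub_zero] at this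
  rw [divS_apply]
  simp only [mulS_apply, map_sum]
  refine Eq.trans ?_ this
  refine Finset.sum_congr rfl fun k _ => Finset.sum_congr rfl fun l _ => ?_
  rw [mul_apply_eq_comp]
  congr 3; ring

lemma mulS_divS (hU : ∀ z, polyLoop r T z * star (polyLoop r T z) = 1) (f : Sq n) :
    mulS r T (divS r T f) = f := by
  ext1 i
  let g : ℤ → End n →ₗ[ℂ] E n := fun m =>
    { toFun := fun A => A (f (i - m)), map_add' := fun _ _ => rfl, map_smul' := fun _ _ => rfl }
  have := circle_functional_eq (Finset.range (r + 1) ×ˢ Finset.range (r + 1))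
    (fun x => (x.1 : ℤ) - x.2) (fun x => T x.1 * star (T x.2)) (Finset.univ : Finset Unit)
    (fun _ => 0) (fun _ => (1 : End n)) (fun z => by
      rw [Finset.sum_product]
      simp only [zpow_zero, one_smul, Finset.univ_unique, Finset.sum_singleton]
      rw [← hU z, star_polyLoop, polyLoop, Finset.sum_mul]
      refine Finset.sum_congr rfl fun k _ => ?_
      rw [Finset.mul_sum]
      refine Finset.sum_congr rfl fun l _ => ?_
      rw [smul_mul_smul_comm, sub_eq_add_neg, zpow_add₀ (Circle.coe_ne_zero z), zpow_natCast]) g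
  simp only [Finset.univ_unique, Finset.sum_singleton, Finset.sum_product, g, LinearMap.coe_mk,
    AddHom.coe_mk, sub_zero] at this
  rw [mulS_apply]
  simp only [divS_apply, map_sum]
  refine Eq.trans ?_ this
  refine Finset.sum_congr rfl fun k _ => Finset.sum_congr rfl fun l _ => ?_
  rw [mul_apply_eq_comp]
  congr 3; ring

/-- The space `γ H_+` of a polynomial unitary loop `γ`, in terms of formal series. -/
def WS (r : ℕ) (T : ℕ → End n) : Submodule ℂ (Sq n) := (pos n 0).comap (divS r T)

lemma mem_WS {f : Sq n} : f ∈ WS r T ↔ divS r T f ∈ pos n 0 := Iff.rfl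

lemma pos_le_WS : pos n r ≤ WS r T := fun _ hf => divS_mem_pos (by simpa using hf)

lemma sh_mem_WS {f : Sq n} {k : ℤ} (hk : 0 ≤ k) (hf : f ∈ WS r T) : sh k f ∈ WS r T := by
  rw [mem_WS, divS_sh, sh_mem_pos]
  exact pos_mono (by omega) hf

/-- The polynomial loop has unitary values. -/
def UnitaryCoeffs (r : ℕ) (T : ℕ → End n) : Prop := ∀ z, polyLoop r T z ∈ unitary (End n)

lemma UnitaryCoeffs.divS_mulS (h : UnitaryCoeffs r T) (f : Sq n) :
    divS r T (mulS r T f) = f :=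
  UnitonTheory.divS_mulS (fun z => (Unitary.mem_iff.mp (h z)).1) f

lemma UnitaryCoeffs.mulS_divS (h : UnitaryCoeffs r T) (f : Sq n) :
    mulS r T (divS r T f) = f :=
  UnitonTheory.mulS_divS (fun z => (Unitary.mem_iff.mp (h z)).2) f

lemma UnitaryCoeffs.WS_le_pos (h : UnitaryCoeffs r T) : WS r T ≤ pos n 0 := by
  intro f hf
  rw [← h.mulS_divS f]
  exact mulS_mem_pos hf

lemma UnitaryCoeffs.mulS_mem_WS (h : UnitaryCoeffs r T) {f : Sq n} (hf : f ∈ pos n 0) :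
    mulS r T f ∈ WS r T := by
  rw [mem_WS, h.divS_mulS]; exact hf

/-- A unitary loop is determined up to a constant factor by its Grassmannian model. -/
lemma polyLoop_eq_of_WS_eq {r' : ℕ} (h : UnitaryCoeffs r T) (h' : UnitaryCoeffs r' T')
    (hW : WS r T = WS r' T') :
    ∃ A : End n, ∀ z, polyLoop r' T' z = polyLoop r T z * A := by
  -- The loop `γ⁻¹γ'` has no negative powers of `λ`, and neither has its inverse `γ'⁻¹γ`. The
  -- inverse is the adjoint, so `γ⁻¹γ'` has no positive powers either and is the constant `A`.
  have h1 : ∀ v m, m < 0 → divS r T (mulS r' T' (dl v)) m = 0 := by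
    intro v m hm
    have : mulS r' T' (dl v) ∈ WS r T := by rw [hW]; exact h'.mulS_mem_WS (dl_mem_pos v)
    exact this m hm
  have h2 : ∀ v m, m < 0 → divS r' T' (mulS r T (dl v)) m = 0 := by
    intro v m hm
    have : mulS r T (dl v) ∈ WS r' T' := by rw [← hW]; exact h.mulS_mem_WS (dl_mem_pos v)
    exact this m hm
  have hadj : ∀ v w m, inner ℂ (divS r T (mulS r' T' (dl v)) m) w =
      inner ℂ v (divS r' T' (mulS r T (dl w)) (-m)) := by
    intro v w m
    simp only [divS_apply, mulS_apply, map_sum, sum_inner, inner_sum]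
    rw [Finset.sum_comm]
    refine Finset.sum_congr rfl fun k _ => Finset.sum_congr rfl fun l _ => ?_
    rw [ContinuousLinearMap.star_eq_adjoint, ContinuousLinearMap.star_eq_adjoint,
      ContinuousLinearMap.adjoint_inner_left, ContinuousLinearMap.adjoint_inner_right,
      dl_apply, dl_apply]
    by_cases hk : m + l - k = 0
    · rw [if_pos hk, if_pos (by omega)]
    · rw [if_neg hk, if_neg (by omega)]; simp
  have h3 : ∀ v m, 0 < m → divS r T (mulS r' T' (dl v)) m = 0 := by
    intro v m hm
    refine ext_inner_right ℂ fun w => ?_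
    rw [hadj, h2 w (-m) (by omega)]; simp
  let A : End n := LinearMap.toContinuousLinearMap
    ((LinearMap.proj 0 : Sq n →ₗ[ℂ] E n) ∘ₗ divS r T ∘ₗ mulS r' T' ∘ₗ dl)
  have hA : ∀ v, mulS r' T' (dl v) = mulS r T (dl (A v)) := by
    intro v
    rw [← h.mulS_divS (mulS r' T' (dl v))]
    congr 1
    ext1 m
    rcases lt_trichotomy m 0 with hm | rfl | hm
    · rw [h1 v m hm, dl_apply, if_neg hm.ne]
    · rw [dl_zero]; rfl
    · rw [h3 v m hm, dl_apply, if_neg hm.ne']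
  have hext : ∀ (r N : ℕ) (T : ℕ → End n) v (z : Circle), r ≤ N → polyLoop r T z v =
      ∑ k ∈ Finset.range (N + 1), (z : ℂ) ^ k • mulS r T (dl v) k := by
    intro r N T v z hrN
    have hdl : polyLoop r T z v = ∑ k ∈ Finset.range (r + 1), (z : ℂ) ^ k • mulS r T (dl v) k := by
      simp only [polyLoop, sum_apply, smul_apply]
      refine Finset.sum_congr rfl fun k hk => ?_
      rw [mulS_apply, Finset.sum_eq_single_of_mem k hk]
      · simp
      · intro j _ hj
        rw [dl_apply, if_neg (by omega), map_zero]
    rw [hdl]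
    refine Finset.sum_subset (Finset.range_mono (by omega)) fun k _ hk => ?_
    rw [mulS_apply, Finset.sum_eq_zero, smul_zero]
    intro j hj
    rw [dl_apply, if_neg, map_zero]
    simp only [Finset.mem_range] at hj hk
    omega
  refine ⟨A, fun z => ?_⟩
  ext1 v
  rw [mul_apply_eq_comp, hext r' (max r r') T' v z (le_max_right _ _),
    hext r (max r r') T (A v) z (le_max_left _ _), hA]

lemma polyLoop_eq_of_WS_eq_of_one {r' : ℕ} (h : UnitaryCoeffs r T) (h' : UnitaryCoeffs r' T')
    (hW : WS r T = WS r' T') (h1 : polyLoop r T 1 = 1) (h1' : polyLoop r' T' 1 = 1) :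
    polyLoop r T = polyLoop r' T' := by
  obtain ⟨A, hA⟩ := polyLoop_eq_of_WS_eq h h' hW
  have : A = 1 := by simpa [h1, h1'] using (hA 1).symm
  ext1 z
  rw [hA z, this, mul_one]

end

end UnitonTheory

namespace UnitonTheory

noncomputable section

variable {n r : ℕ} {T T' : ℕ → End n}

/-! ### The Grassmannian model in terms of formal series -/

lemma loopCoeff_polyLoop {γ : Circle → End n} (hγ : ∀ z, γ z = polyLoop r T z) (k : ℤ) :
    loopCoeff γ k = ∑ j ∈ Finset.range (r + 1), if (j : ℤ) = k then T j else 0 := by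
  have h : (fun t : AddCircle (1 : ℝ) => γ (AddCircle.toCircle t)) =
      ∑ j ∈ Finset.range (r + 1), fun t => (fourier (j : ℤ) t : ℂ) • T j := by
    ext1 t
    rw [hγ, polyLoop, Finset.sum_apply]
    refine Finset.sum_congr rfl fun j _ => ?_
    rw [fourier_apply, natCast_zsmul, AddCircle.toCircle_nsmul, Circle.coe_pow]
  have hint : ∀ j : ℕ, MeasureTheory.Integrable
      (fun t : AddCircle (1 : ℝ) => (fourier (j : ℤ) t : ℂ) • T j) AddCircle.haarAddCircle :=
    fun j => ((fourier (j : ℤ)).continuous.smul continuous_const).integrable_of_hasCompactSupport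
      (HasCompactSupport.of_compactSpace _)
  rw [loopCoeff, h, fourierCoeff.sum _ _ (fun j _ => hint j), Finset.sum_apply]
  refine Finset.sum_congr rfl fun j _ => ?_
  have h2 : fourierCoeff (fun t : AddCircle (1 : ℝ) => (fourier (j : ℤ) t : ℂ) • T j) k =
      fourierCoeff (T := (1 : ℝ)) (fourier (j : ℤ)) k • T j := by
    simp only [fourierCoeff, smul_smul, smul_eq_mul]
    exact integral_smul_const _ _
  rw [h2, fourierCoeff_fourier, Pi.single_apply]
  split_ifs with h1 h3 h3
  · exact one_smul ℂ (T j)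
  · exact absurd h1.symm h3
  · exact absurd h3.symm h1
  · exact zero_smul ℂ (T j)

lemma hasSum_loopCoeff_iff {γ : Circle → End n} (hγ : ∀ z, γ z = polyLoop r T z) (g : Sq n) (i : ℤ)
    (x : E n) :
    HasSum (fun k : ℤ => loopCoeff γ k (g (i - k))) x ↔ x = mulS r T g i := by
  have h : HasSum (fun k : ℤ => loopCoeff γ k (g (i - k))) (mulS r T g i) := by
    have := hasSum_sum_of_ne_finset_zero (f := fun k : ℤ => loopCoeff γ k (g (i - k)))
      (s := (Finset.range (r + 1)).image (fun j : ℕ => (j : ℤ))) (fun k hk => by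
        rw [loopCoeff_polyLoop hγ, Finset.sum_eq_zero]
        · rfl
        · intro j hj
          rw [if_neg]
          rintro rfl
          exact hk (Finset.mem_image_of_mem _ hj)) (L := .unconditional ℤ)
    rw [Finset.sum_image (fun a _ b _ h => Int.ofNat_inj.mp h)] at this
    rw [mulS_apply]
    convert this using 3 with j hj
    rw [loopCoeff_polyLoop hγ, Finset.sum_eq_single_of_mem j hj, if_pos rfl]
    intro l _ hl
    rw [if_neg (by exact_mod_cast hl)]
  exact ⟨fun hx => hx.unique h, fun hx => hx ▸ h⟩

lemma memℓp_comp_shift (A : End n) (k : ℤ) (f : H n) :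
    Memℓp (fun i : ℤ => A ((f : ∀ _ : ℤ, E n) (i + k))) 2 := by
  have hf : Memℓp (f : ∀ _ : ℤ, E n) 2 := lp.memℓp f
  apply memℓp_gen
  have h1 := (memℓp_gen_iff (p := 2) (by norm_num)).mp hf
  have h2 := (h1.comp_injective (add_left_injective k)).mul_left (‖A‖ ^ (2 : ENNReal).toReal)
  refine h2.of_nonneg_of_le (fun i => by positivity) fun i => ?_
  rw [Function.comp_apply, ← Real.mul_rpow (norm_nonneg _) (norm_nonneg _)]
  exact Real.rpow_le_rpow (norm_nonneg _) (A.le_opNorm _) (by norm_num)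

lemma memℓp_divS (f : H n) : Memℓp (divS r T (f : ∀ _ : ℤ, E n)) 2 := by
  have : divS r T (f : ∀ _ : ℤ, E n) =
      fun i => ∑ k ∈ Finset.range (r + 1), star (T k) ((f : ∀ _ : ℤ, E n) (i + k)) := rfl
  rw [this]
  exact Memℓp.finsetSum _ fun k _ => memℓp_comp_shift (star (T k)) k f

/-- This replaces the `L²` model by formal sequences. The only analytic point is that division by
`γ` is a finite sum of shifts composed with bounded operators, and so preserves square-summability.
-/
lemma mem_grassModel_iff {γ : Circle → End n} (hγ : ∀ z, γ z = polyLoop r T z)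
    (hU : UnitaryCoeffs r T) (f : H n) :
    f ∈ grassModel γ ↔ (f : ∀ _ : ℤ, E n) ∈ WS r T := by
  constructor
  · rintro ⟨g, hg, h⟩
    have : (f : ∀ _ : ℤ, E n) = mulS r T (g : ∀ _ : ℤ, E n) := by
      ext1 i
      exact (hasSum_loopCoeff_iff hγ _ i _).mp (h i)
    rw [this]
    exact hU.mulS_mem_WS hg
  · intro hf
    refine ⟨⟨divS r T (f : ∀ _ : ℤ, E n), memℓp_divS f⟩, hf, fun i => ?_⟩
    refine (hasSum_loopCoeff_iff hγ (divS r T (f : ∀ _ : ℤ, E n)) i _).mpr ?_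
    rw [hU.mulS_divS]

/-! ### Jets -/

lemma Jet.coeff_fin (x : Jet r n) (i : Fin r) : x.coeff (i : ℤ) = x i := by
  simp [Jet.coeff]

lemma Jet.coeff_of_lt {x : Jet r n} {i : ℤ} (hi : 0 ≤ i) (hr : i < r) :
    x.coeff i = x ⟨i.toNat, by omega⟩ := by
  rw [Jet.coeff, dif_pos ⟨hi, hr⟩]

lemma Jet.coeff_of_neg {x : Jet r n} {i : ℤ} (hi : i < 0) : x.coeff i = 0 := by
  rw [Jet.coeff, dif_neg (by omega)]

lemma Jet.coeff_of_le {x : Jet r n} {i : ℤ} (hi : r ≤ i) : x.coeff i = 0 := by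
  rw [Jet.coeff, dif_neg (by omega)]

/-- A jet as a sequence. -/
def ext : Jet r n →ₗ[ℂ] Sq n where
  toFun x i := x.coeff i
  map_add' x y := by ext1 i; by_cases h : 0 ≤ i ∧ i < r <;> simp [Jet.coeff, h]
  map_smul' c x := by ext1 i; by_cases h : 0 ≤ i ∧ i < r <;> simp [Jet.coeff, h]

/-- The jet of a sequence. -/
def tr (r : ℕ) : Sq n →ₗ[ℂ] Jet r n where
  toFun f i := f i
  map_add' _ _ := rfl
  map_smul' _ _ := rfl

lemma ext_apply (x : Jet r n) (i : ℤ) : ext x i = x.coeff i := rfl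

lemma tr_apply (f : Sq n) (i : Fin r) : tr r f i = f i := rfl

@[simp] lemma tr_ext (x : Jet r n) : tr r (ext x) = x := by
  ext1 i; exact x.coeff_fin i

lemma ext_mem_pos (x : Jet r n) : ext x ∈ pos n 0 := fun _ hi => Jet.coeff_of_neg hi

lemma tr_eq_zero {f : Sq n} (hf : f ∈ pos n r) : tr r f = 0 := by
  ext1 i; exact hf i (by have := i.2; omega)

lemma ext_tr_apply {f : Sq n} (i : ℤ) (hi : 0 ≤ i) (hr : i < r) : ext (tr r f) i = f i := by
  rw [ext_apply, Jet.coeff_of_lt hi hr, tr_apply]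
  congr 1
  change ((i.toNat : ℕ) : ℤ) = i
  omega

lemma sub_ext_tr_mem_pos {f : Sq n} (hf : f ∈ pos n 0) : f - ext (tr r f) ∈ pos n r := by
  intro i hi
  rw [Pi.sub_apply]
  rcases lt_or_ge i 0 with h | h
  · rw [hf i h, ext_mem_pos _ i h, sub_zero]
  · rw [ext_tr_apply i h hi, sub_self]

/-- A sequence in `H_+` differs from its truncation by an element of `λ^r H_+`, which lies in `W`.
This is the bridge between sequences and jets. -/
lemma mem_iff_ext_tr_mem {W : Submodule ℂ (Sq n)} (hW : pos n r ≤ W) {f : Sq n}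
    (hf : f ∈ pos n 0) : ext (tr r f) ∈ W ↔ f ∈ W := by
  have h := hW (sub_ext_tr_mem_pos (r := r) hf)
  constructor
  · intro h'
    simpa using W.add_mem h h'
  · intro h'
    simpa using W.sub_mem h' h

/-- Multiplication by `λ^k` on jets. -/
def shJ (k : ℕ) : Jet r n →ₗ[ℂ] Jet r n := tr r ∘ₗ sh k ∘ₗ ext

lemma shJ_apply (k : ℕ) (x : Jet r n) : shJ k x = tr r (sh k (ext x)) := rfl

lemma shJ_tr {k : ℕ} {f : Sq n} (hf : f ∈ pos n 0) : shJ k (tr r f) = tr r (sh k f) := by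
  have h := sub_ext_tr_mem_pos (r := r) hf
  have h2 : sh (k : ℤ) (f - ext (tr r f)) ∈ pos n r := sh_mem_pos.mpr (pos_mono (by omega) h)
  have h3 := tr_eq_zero h2
  rw [map_sub, map_sub, sub_eq_zero] at h3
  rw [shJ_apply, h3]

lemma sh_ext_mem_pos {k : ℤ} (hk : 0 ≤ k) (x : Jet r n) : sh k (ext x) ∈ pos n 0 :=
  sh_mem_pos.mpr (pos_mono (by omega) (ext_mem_pos x))

lemma shJ_shJ (k l : ℕ) (x : Jet r n) : shJ k (shJ l x) = shJ (k + l) x := by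
  rw [shJ_apply l, shJ_tr (sh_ext_mem_pos (by omega) x), sh_sh, shJ_apply]
  push_cast; rfl

lemma shJ_zero (x : Jet r n) : shJ 0 x = x := by
  rw [shJ_apply, Nat.cast_zero, sh_zero, tr_ext]

/-- Jets of order at least `k`. -/
def posJ (r n : ℕ) (k : ℤ) : Submodule ℂ (Jet r n) := (pos n k).comap ext

lemma mem_posJ {k : ℤ} {x : Jet r n} : x ∈ posJ r n k ↔ ext x ∈ pos n k := Iff.rfl

lemma tr_mem_posJ {k : ℤ} {f : Sq n} (hf : f ∈ pos n k) : tr r f ∈ posJ r n k := by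
  intro i hi
  rcases lt_or_ge i 0 with h | h
  · exact ext_mem_pos _ i h
  · rcases lt_or_ge i r with h' | h'
    · rw [ext_tr_apply i h h', hf i hi]
    · exact Jet.coeff_of_le h'

lemma posJ_zero : posJ r n 0 = ⊤ := eq_top_iff.mpr fun x _ => ext_mem_pos x

lemma posJ_self : posJ r n r = ⊥ := by
  rw [eq_bot_iff]
  intro x hx
  rw [Submodule.mem_bot, ← tr_ext x]
  exact tr_eq_zero hx

lemma posJ_mono {k l : ℤ} (h : k ≤ l) : posJ r n l ≤ posJ r n k :=
  Submodule.comap_mono (pos_mono h)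

lemma shJ_mem_posJ {k : ℕ} {l : ℤ} {x : Jet r n} (hx : x ∈ posJ r n l) :
    shJ k x ∈ posJ r n (l + k) :=
  by
  rw [shJ_apply]
  refine tr_mem_posJ (sh_mem_pos.mpr ?_)
  rw [add_sub_cancel_right]
  exact hx

/-! ### The alternating filtration on formal series and on jets -/

/-- `(λ^{-u} W ∩ H_+) + λ^i H_+`. -/
def altS (W : Submodule ℂ (Sq n)) (u i : ℕ) : Submodule ℂ (Sq n) :=
  (W.comap (sh u) ⊓ pos n 0) ⊔ pos n i

/-- `(λ^{-u} B ∩ H_+) + λ^i H_+`, modulo `λ^r H_+`. -/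
def altJ (B : Submodule ℂ (Jet r n)) (u i : ℕ) : Submodule ℂ (Jet r n) :=
  B.comap (shJ u) ⊔ posJ r n i

lemma altS_le_pos {W : Submodule ℂ (Sq n)} {u i : ℕ} : altS W u i ≤ pos n 0 :=
  sup_le inf_le_right (pos_mono (by omega))

lemma ext_shJ_mem_iff {W : Submodule ℂ (Sq n)} (hW : pos n r ≤ W) {u : ℕ} {x : Jet r n} :
    ext (shJ u x) ∈ W ↔ sh u (ext x) ∈ W :=
  mem_iff_ext_tr_mem hW (sh_ext_mem_pos (by omega) x)

/-- Truncation is compatible with the steps of the filtration because `λ^u` maps `λ^r H_+` into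
itself, hence into `W`. -/
lemma comap_ext_altS {W : Submodule ℂ (Sq n)} (hW : pos n r ≤ W) {u i : ℕ} :
    (altS W u i).comap ext = altJ (r := r) (W.comap ext) u i := by
  apply le_antisymm
  · intro x hx
    obtain ⟨a, ha, b, hb, hab⟩ := Submodule.mem_sup.mp hx
    have : x = tr r a + tr r b := by rw [← map_add, hab, tr_ext]
    rw [this]
    refine Submodule.add_mem_sup ?_ (tr_mem_posJ hb)
    rw [Submodule.mem_comap, Submodule.mem_comap, shJ_tr ha.2]
    exact (mem_iff_ext_tr_mem hW (sh_mem_pos.mpr (pos_mono (by omega) ha.2))).mpr ha.1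
  · refine sup_le ?_ (Submodule.comap_mono le_sup_right)
    intro x hx
    exact Submodule.mem_sup_left ⟨(ext_shJ_mem_iff hW).mp hx, ext_mem_pos x⟩

lemma pos_le_altS {W : Submodule ℂ (Sq n)} {u i : ℕ} (hir : i ≤ r) : pos n r ≤ altS W u i :=
  (pos_mono (by omega)).trans le_sup_right

end

end UnitonTheory

namespace UnitonTheory

noncomputable section

variable {n r : ℕ} {T T' : ℕ → End n}

/-! ### Complex conjugation and the complex bilinear form -/

lemma conjV_apply (v : E n) (i : Fin n) : conjV v i = conj (v i) := rfl

@[simp] lemma conjV_conjV (v : E n) : conjV (conjV v) = v := by ext i; simp [conjV]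

lemma conjV_add (v w : E n) : conjV (v + w) = conjV v + conjV w := by ext i; simp [conjV]

lemma conjV_smul (c : ℂ) (v : E n) : conjV (c • v) = conj c • conjV v := by ext i; simp [conjV]

lemma conjOp_apply (A : End n) (v : E n) : conjOp A v = conjV (A (conjV v)) := rfl

lemma conjOp_add (A B : End n) : conjOp (A + B) = conjOp A + conjOp B := by
  ext1 v; simp [conjOp_apply, conjV_add]

lemma conjOp_smul (c : ℂ) (A : End n) : conjOp (c • A) = conj c • conjOp A := by
  ext1 v; simp [conjOp_apply, conjV_smul]

lemma conjOp_mul (A B : End n) : conjOp (A * B) = conjOp A * conjOp B := by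
  ext1 v; simp [conjOp_apply]

lemma conjOp_one : conjOp (1 : End n) = 1 := by
  ext1 v; simp [conjOp_apply]

lemma conjOp_zero : conjOp (0 : End n) = 0 := by
  ext1 v; simp [conjOp_apply, conjV, Pi.zero_def]

lemma conjOp_sum {ι : Type*} (s : Finset ι) (A : ι → End n) :
    conjOp (∑ i ∈ s, A i) = ∑ i ∈ s, conjOp (A i) := by
  classical
  induction s using Finset.induction_on with
  | empty => simp [conjOp_zero]
  | insert a s ha ih => rw [Finset.sum_insert ha, Finset.sum_insert ha, conjOp_add, ih]

/-- The complex bilinear form `∑ v_i w_i` on `ℂⁿ`. -/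
def dotp : E n →ₗ[ℂ] E n →ₗ[ℂ] ℂ :=
  LinearMap.mk₂ ℂ (fun v w => ∑ i, v i * w i)
    (fun a b c => by simp [add_mul, Finset.sum_add_distrib])
    (fun a b c => by simp [Finset.mul_sum, mul_assoc])
    (fun a b c => by simp [mul_add, Finset.sum_add_distrib])
    (fun a b c => by simp [Finset.mul_sum, mul_left_comm])

lemma dotp_apply (v w : E n) : dotp v w = ∑ i, v i * w i := rfl

lemma dotp_comm (v w : E n) : dotp v w = dotp w v := by
  simp [dotp_apply, mul_comm]

lemma dotp_eq_inner (v w : E n) : dotp v w = inner ℂ (conjV v) w := by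
  simp [dotp_apply, PiLp.inner_apply, conjV, mul_comm]

lemma inner_conjV_conjV (v w : E n) : inner ℂ (conjV v) (conjV w) = inner ℂ w v := by
  simp [PiLp.inner_apply, conjV, mul_comm]

/-- The transpose of `A` for the bilinear form is the adjoint of its conjugate. -/
lemma dotp_star_conjOp (A : End n) (v w : E n) : dotp w (star (conjOp A) v) = dotp (A w) v := by
  rw [dotp_eq_inner, dotp_eq_inner, ContinuousLinearMap.star_eq_adjoint,
    ContinuousLinearMap.adjoint_inner_right, conjOp_apply, conjV_conjV]

lemma star_conjOp (A : End n) : star (conjOp A) = conjOp (star A) := by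
  ext1 v
  refine ext_inner_left ℂ fun w => ?_
  rw [ContinuousLinearMap.star_eq_adjoint, ContinuousLinearMap.adjoint_inner_right, conjOp_apply,
    conjOp_apply, ← conjV_conjV v, inner_conjV_conjV, conjV_conjV, ← conjV_conjV w,
    inner_conjV_conjV, conjV_conjV, ContinuousLinearMap.star_eq_adjoint,
    ContinuousLinearMap.adjoint_inner_left]

lemma eq_zero_of_dotp {v : E n} (h : ∀ w, dotp w v = 0) : v = 0 := by
  rw [← inner_self_eq_zero (𝕜 := ℂ), ← conjV_conjV v, ← dotp_eq_inner, conjV_conjV]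
  exact h _

/-- The pairing `∑_{k < r} f_k ⬝ g_{r-1-k}` of formal series. -/
def bform (r : ℕ) (f g : Sq n) : ℂ := ∑ k ∈ Finset.range r, dotp (f k) (g (r - 1 - k))

lemma bform_comm (f g : Sq n) : bform r f g = bform r g f := by
  rw [bform, ← Finset.sum_range_reflect, bform]
  refine Finset.sum_congr rfl fun k hk => ?_
  have hk := Finset.mem_range.mp hk
  rw [dotp_comm]
  congr 2 <;> congr 1 <;> omega

lemma bform_add_left (f f' g : Sq n) : bform r (f + f') g = bform r f g + bform r f' g := by
  simp [bform, Finset.sum_add_distrib]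

lemma bform_add_right (f g g' : Sq n) : bform r f (g + g') = bform r f g + bform r f g' := by
  simp [bform, Finset.sum_add_distrib]

lemma bform_eq_zero_of_pos {f g : Sq n} (hf : f ∈ pos n r) : bform r f g = 0 :=
  Finset.sum_eq_zero fun k hk => by
    rw [hf k (by have := Finset.mem_range.mp hk; omega), map_zero, LinearMap.zero_apply]

lemma bform_eq_zero_of_pos_right {f g : Sq n} (hg : g ∈ pos n r) : bform r f g = 0 := by
  rw [bform_comm, bform_eq_zero_of_pos hg]

/-- The coefficients of the loop `λ^r conj γ`. -/
def conjCoeffs (r : ℕ) (T : ℕ → End n) (k : ℕ) : End n := conjOp (T (r - k))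

lemma polyLoop_conjCoeffs (z : Circle) :
    polyLoop r (conjCoeffs r T) z = (z : ℂ) ^ r • conjOp (polyLoop r T z) := by
  rw [polyLoop, ← Finset.sum_range_reflect, polyLoop, conjOp_sum, Finset.smul_sum]
  refine Finset.sum_congr rfl fun k hk => ?_
  have hk := Finset.mem_range.mp hk
  rw [conjCoeffs, conjOp_smul, smul_smul, map_pow, ← Circle.coe_inv_eq_conj, Circle.coe_inv]
  have h1 : r + 1 - 1 - k = r - k := by omega
  have h2 : r - (r - k) = k := by omega
  have h3 : (z : ℂ) ^ r = (z : ℂ) ^ (r - k) * (z : ℂ) ^ k := by rw [← pow_add]; congr 1; omega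
  rw [h1, h2, h3, mul_assoc, ← mul_pow, mul_inv_cancel₀ (Circle.coe_ne_zero z), one_pow, mul_one]

lemma conjOp_mem_unitary {A : End n} (hA : A ∈ unitary (End n)) : conjOp A ∈ unitary (End n) := by
  rw [Unitary.mem_iff] at hA ⊢
  rw [star_conjOp, ← conjOp_mul, ← conjOp_mul, hA.1, hA.2, conjOp_one]
  exact ⟨rfl, rfl⟩

lemma smul_mem_unitary {A : End n} (hA : A ∈ unitary (End n)) (z : Circle) :
    (z : ℂ) • A ∈ unitary (End n) := by
  have hz : conj (z : ℂ) * z = 1 := by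
    rw [← Circle.coe_inv_eq_conj, Circle.coe_inv, inv_mul_cancel₀ (Circle.coe_ne_zero z)]
  rw [Unitary.mem_iff] at hA ⊢
  rw [star_smul, smul_mul_smul_comm, smul_mul_smul_comm, hA.1, hA.2, Complex.star_def, hz,
    mul_comm, hz, one_smul]
  exact ⟨rfl, rfl⟩

lemma UnitaryCoeffs.conjCoeffs (h : UnitaryCoeffs r T) : UnitaryCoeffs r (conjCoeffs r T) := by
  intro z
  rw [polyLoop_conjCoeffs, ← Circle.coe_pow]
  exact smul_mem_unitary (conjOp_mem_unitary (h z)) _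

/-- The pairing is the coefficient of `λ^{r-1}` in a product, and the transpose of multiplication by
`γ` is division by `λ^r conj γ`, up to the shift by `λ^r`. Both sides are the sum of the terms `T_k
h_j ⬝ f_{r-1-k-j}`; where the ranges of summation differ, a factor has negative degree and vanishes.
-/
lemma bform_mulS {h f : Sq n} (hh : h ∈ pos n 0) (hf : f ∈ pos n 0) :
    bform r (mulS r T h) f =
      ∑ j ∈ Finset.range r, dotp (h j) (divS r (conjCoeffs r T) f (-1 - j)) := by
  have h1 : ∀ j : ℕ, dotp (h j) (divS r (conjCoeffs r T) f (-1 - j)) =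
      ∑ k ∈ Finset.range (r + 1), dotp (T k (h j)) (f (r - 1 - k - j)) := by
    intro j
    rw [divS_apply, map_sum, ← Finset.sum_range_reflect]
    refine Finset.sum_congr rfl fun k hk => ?_
    have hk := Finset.mem_range.mp hk
    rw [conjCoeffs, dotp_star_conjOp]
    have e1 : r - (r + 1 - 1 - k) = k := by omega
    have e2 : -1 - (j : ℤ) + ((r + 1 - 1 - k : ℕ) : ℤ) = r - 1 - k - j := by omega
    rw [e1, e2]
  simp only [bform, mulS_apply, map_sum, LinearMap.sum_apply, h1]
  rw [Finset.sum_comm, Finset.sum_comm (s := Finset.range r)]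
  refine Finset.sum_congr rfl fun k _ => ?_
  refine Finset.sum_bij_ne_zero (fun a _ _ => a - k) ?_ ?_ ?_ ?_
  · intro a ha _
    have := Finset.mem_range.mp ha
    exact Finset.mem_range.mpr (by omega)
  · intro a ha hne b hb hne' hab
    have key : ∀ a : ℕ, dotp (T k (h (a - k))) (f (r - 1 - a)) ≠ 0 → k ≤ a := by
      intro a hne
      by_contra hlt
      exact hne (by rw [hh _ (by omega), map_zero, map_zero, LinearMap.zero_apply])
    have := key a hne
    have := key b hne'
    omega
  · intro j hj hne
    have hle : (j : ℤ) + k < r := by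
      by_contra hlt
      exact hne (by rw [hf _ (by omega), map_zero])
    have e1 : ((j + k : ℕ) : ℤ) - k = j := by push_cast; ring
    have e2 : (r : ℤ) - 1 - (j + k : ℕ) = r - 1 - k - j := by push_cast; ring
    exact ⟨j + k, Finset.mem_range.mpr (by omega), by rw [e1, e2]; exact hne, by omega⟩
  · intro a ha hne
    have hle : k ≤ a := by
      by_contra hlt
      exact hne (by rw [hh _ (by omega), map_zero, map_zero, LinearMap.zero_apply])
    have e1 : ((a - k : ℕ) : ℤ) = a - k := by omega
    have e2 : (r : ℤ) - 1 - k - (a - k) = r - 1 - a := by ring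
    rw [e1, e2]

/-- The Grassmannian model of `λ^r conj γ` is the annihilator of that of `γ`. -/
lemma mem_WS_conjCoeffs (hU : UnitaryCoeffs r T) {f : Sq n} (hf : f ∈ pos n 0) :
    f ∈ WS r (conjCoeffs r T) ↔ ∀ g ∈ WS r T, bform r g f = 0 := by
  constructor
  · intro h g hg
    rw [← hU.mulS_divS g, bform_mulS hg hf]
    exact Finset.sum_eq_zero fun j _ => by rw [h _ (by omega), map_zero]
  · intro h m hm
    obtain ⟨j, rfl⟩ : ∃ j : ℕ, m = -1 - j := ⟨(-1 - m).toNat, by omega⟩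
    refine eq_zero_of_dotp fun w => ?_
    -- For `j < r` the coefficient is tested against the elements `γ λ^j w` of the model. For `j ≥
    -- r` it only involves coefficients of `f` of negative degree.
    by_cases hj : j < r
    · have hpos : sh (j : ℤ) (dl w) ∈ pos n 0 :=
        sh_mem_pos.mpr (pos_mono (by omega) (dl_mem_pos w))
      have := h _ (hU.mulS_mem_WS hpos)
      rw [bform_mulS hpos hf, Finset.sum_eq_single_of_mem j (Finset.mem_range.mpr hj)] at this
      · simpa [sh_apply] using this
      · intro k _ hk
        rw [sh_apply, dl_apply, if_neg (by omega), map_zero, LinearMap.zero_apply]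
    · rw [divS_apply, Finset.sum_eq_zero, map_zero]
      intro k hk
      rw [hf _ (by have := Finset.mem_range.mp hk; omega), map_zero]

lemma divS_congr (h : ∀ z, polyLoop r T z = polyLoop r T' z) (f : Sq n) :
    divS r T f = divS r T' f := by
  ext1 i
  let g : ℤ → End n →ₗ[ℂ] E n := fun m =>
    { toFun := fun A => A (f (i - m)), map_add' := fun _ _ => rfl, map_smul' := fun _ _ => rfl }
  have := circle_functional_eq (Finset.range (r + 1)) (fun k => -(k : ℤ)) (fun k => star (T k))
    (Finset.range (r + 1)) (fun k => -(k : ℤ)) (fun k => star (T' k))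
    (fun z => by rw [← star_polyLoop, ← star_polyLoop, h]) g
  simpa [g, divS_apply] using this

/-- A formal Grassmannian model that is its own annihilator. -/
def IsLagr (r : ℕ) (W : Submodule ℂ (Sq n)) : Prop :=
  ∀ f ∈ pos n 0, f ∈ W ↔ ∀ g ∈ W, bform r g f = 0

/-- Reality says that `γ` and `λ^r conj γ` are the same loop, and the model of the latter is the
annihilator of the model of the former. -/
lemma isLagr_of_real (hU : UnitaryCoeffs r T)
    (h : ∀ z : Circle, conjOp (polyLoop r T z) = ((z : ℂ) ^ r)⁻¹ • polyLoop r T z) :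
    IsLagr r (WS r T) := by
  intro f hf
  rw [← mem_WS_conjCoeffs hU hf, mem_WS, mem_WS,
    divS_congr (T := T) (T' := conjCoeffs r T) fun z => ?_]
  rw [polyLoop_conjCoeffs, h, smul_smul, mul_inv_cancel₀ (pow_ne_zero _ (Circle.coe_ne_zero z)),
    one_smul]

/-- The loops `γ` and `λ^r conj γ` have the same model and both take the value `1` at `1`, so they
coincide. -/
lemma real_of_isLagr (hU : UnitaryCoeffs r T) (h1 : polyLoop r T 1 = 1)
    (h : IsLagr r (WS r T)) (z : Circle) :
    conjOp (polyLoop r T z) = ((z : ℂ) ^ r)⁻¹ • polyLoop r T z := by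
  have hW : WS r T = WS r (conjCoeffs r T) := by
    ext f
    constructor
    · intro hf
      have hp := hU.WS_le_pos hf
      exact (mem_WS_conjCoeffs hU hp).mpr ((h f hp).mp hf)
    · intro hf
      have hp := hU.conjCoeffs.WS_le_pos hf
      exact (h f hp).mpr ((mem_WS_conjCoeffs hU hp).mp hf)
  have := polyLoop_eq_of_WS_eq_of_one hU hU.conjCoeffs hW h1
    (by rw [polyLoop_conjCoeffs, h1, conjOp_one]; simp)
  have hz := congrFun this z
  rw [polyLoop_conjCoeffs] at hz
  conv_rhs => rw [hz]
  rw [smul_smul, inv_mul_cancel₀ (pow_ne_zero _ (Circle.coe_ne_zero z)), one_smul]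

/-! ### Reduction of Lagrangian models -/

/-- The pairing of formal series, on jets. -/
def jform (r n : ℕ) : LinearMap.BilinForm ℂ (Jet r n) :=
  LinearMap.mk₂ ℂ (fun x y => bform r (ext x) (ext y))
    (fun a b c => by rw [map_add, bform_add_left])
    (fun a b c => by simp [bform, Finset.mul_sum])
    (fun a b c => by rw [map_add, bform_add_right])
    (fun a b c => by simp [bform, Finset.mul_sum])

lemma jform_apply (x y : Jet r n) : jform r n x y = bform r (ext x) (ext y) := rfl

lemma jform_isRefl : (jform r n).IsRefl := fun x y h => by
  rw [jform_apply, bform_comm]; exact h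

/-- Degree `i` is paired perfectly with degree `r - 1 - i`; the test vectors are `λ^{r-1-i} w`. The
case `k = 0` yields nondegeneracy. -/
lemma jform_orthogonal_posJ {k l : ℕ} (h : k + l = r) :
    (jform r n).orthogonal (posJ r n k) = posJ r n l := by
  apply le_antisymm
  · intro x hx i hi
    rcases lt_or_ge i 0 with h0 | h0
    · exact ext_mem_pos x i h0
    refine eq_zero_of_dotp fun w => ?_
    have hp : sh (r - 1 - i) (dl w) ∈ pos n k := sh_mem_pos.mpr (pos_mono (by omega) (dl_mem_pos w))
    have := hx (tr r (sh (r - 1 - i) (dl w))) (tr_mem_posJ hp)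
    change jform r n _ _ = 0 at this
    rw [jform_apply, bform,
      Finset.sum_eq_single_of_mem (r - 1 - i).toNat (Finset.mem_range.mpr (by omega))] at this
    · rw [ext_tr_apply _ (by omega) (by omega), sh_apply, dl_apply, if_pos (by omega)] at this
      convert this using 3
      omega
    · intro j hj hne
      have := Finset.mem_range.mp hj
      rw [ext_tr_apply _ (by omega) (by omega), sh_apply, dl_apply, if_neg (by omega), map_zero,
        LinearMap.zero_apply]
  · intro x hx y hy
    change jform r n _ _ = 0
    rw [jform_apply]
    refine Finset.sum_eq_zero fun j hj => ?_
    rcases lt_or_ge j k with h0 | h0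
    · rw [hy j (by omega), map_zero, LinearMap.zero_apply]
    · rw [hx _ (by omega), map_zero]

lemma jform_nondegenerate : (jform r n).Nondegenerate := by
  have h := jform_orthogonal_posJ (n := n) (zero_add r)
  rw [posJ_self, Nat.cast_zero, posJ_zero] at h
  have key : ∀ x, (∀ y, jform r n x y = 0) → x = 0 := by
    intro x hx
    rw [← Submodule.mem_bot (R := ℂ), ← h]
    intro y _
    exact jform_isRefl _ _ (hx y)
  exact ⟨key, fun x hx => key x fun y => jform_isRefl _ _ (hx y)⟩

/-- Multiplying both arguments by `λ^u` raises the degree of the product by `2u = r - i`. The extra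
terms vanish because `f` and `g` have no negative degrees. -/
lemma bform_sh {f g : Sq n} (hf : f ∈ pos n 0) (hg : g ∈ pos n 0) {u i : ℕ} (h : i + 2 * u = r) :
    bform r (sh u f) (sh u g) = bform i f g := by
  symm
  refine Finset.sum_bij_ne_zero (fun a _ _ => a + u) ?_ ?_ ?_ ?_
  · intro a ha _
    have := Finset.mem_range.mp ha
    exact Finset.mem_range.mpr (by omega)
  · intro a _ _ b _ _ hab
    omega
  · intro j hj hne
    have h1 : u ≤ j := by
      by_contra hlt
      exact hne (by rw [sh_apply, hf _ (by omega), map_zero, LinearMap.zero_apply])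
    have h2 : j < i + u := by
      by_contra hlt
      exact hne (by rw [sh_apply (u : ℤ) g, hg _ (by omega), map_zero])
    refine ⟨j - u, Finset.mem_range.mpr (by omega), ?_, by omega⟩
    rw [sh_apply, sh_apply] at hne
    have e1 : ((j - u : ℕ) : ℤ) = j - u := by omega
    have e2 : (i : ℤ) - 1 - (j - u) = r - 1 - j - u := by omega
    rwa [e1, e2]
  · intro a ha hne
    have e1 : ((a + u : ℕ) : ℤ) - u = a := by omega
    have e2 : (r : ℤ) - 1 - (a + u : ℕ) - u = i - 1 - a := by omega
    rw [sh_apply, sh_apply, e1, e2]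

lemma IsLagr.comap_ext_orthogonal {W : Submodule ℂ (Sq n)} (hW : pos n r ≤ W) (hp : W ≤ pos n 0)
    (h : IsLagr r W) : (jform r n).orthogonal (W.comap ext) = W.comap ext := by
  ext x
  rw [Submodule.mem_comap, h _ (ext_mem_pos x)]
  constructor
  · intro hx g hg
    have h1 := hx (tr r g) ((mem_iff_ext_tr_mem hW (hp hg)).mpr hg)
    change jform r n _ _ = 0 at h1
    rw [jform_apply] at h1
    have h2 : g = (g - ext (tr r g)) + ext (tr r g) := by abel
    rw [h2, bform_add_left, h1, bform_eq_zero_of_pos (sub_ext_tr_mem_pos (hp hg)), add_zero]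
  · intro hx y hy
    exact hx _ hy

/-- Lagrangian reduction. -/
lemma IsLagr.altS {W : Submodule ℂ (Sq n)} (hW : pos n r ≤ W) (hp : W ≤ pos n 0)
    (h : IsLagr r W) {u i : ℕ} (hr : i + 2 * u = r) :
    IsLagr i (altS W u i) := by
  intro f hf
  constructor
  · intro hf' g hg'
    obtain ⟨a, ha, b, hb, rfl⟩ := Submodule.mem_sup.mp hf'
    obtain ⟨a', ha', b', hb', rfl⟩ := Submodule.mem_sup.mp hg'
    rw [bform_add_left, bform_eq_zero_of_pos hb', add_zero, bform_add_right,
      bform_eq_zero_of_pos_right hb, add_zero, ← bform_sh ha'.2 ha.2 hr]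
    exact (h _ (hp ha.1)).mp ha.1 _ ha'.1
  -- Conversely, if `f` annihilates the reduced space, then `λ^u f` annihilates `W ∩ λ^u H_+`. The
  -- annihilator of the latter is `W + λ^{i+u} H_+`, and division by `λ^u` puts `f` in the reduced
  -- space.
  · intro hf'
    set B := W.comap (ext : Jet r n →ₗ[ℂ] Sq n) with hB
    have h1 : (jform r n).orthogonal (B ⊓ posJ r n u) = B ⊔ posJ r n (i + u : ℕ) := by
      -- Here `B` is its own annihilator, and the jets of order at least `i + u` and at least `u`
      -- annihilate each other since `(i + u) + u = r`. Double annihilation then turns this equality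
      -- into `h1`.
      have h2 : (jform r n).orthogonal (B ⊔ posJ r n (i + u : ℕ)) = B ⊓ posJ r n u := by
        apply le_antisymm
        · refine le_inf ?_ ?_
          · refine (LinearMap.BilinForm.orthogonal_le le_sup_left).trans ?_
            rw [h.comap_ext_orthogonal hW hp]
          · refine (LinearMap.BilinForm.orthogonal_le le_sup_right).trans ?_
            rw [jform_orthogonal_posJ (l := u) (by omega)]
        · intro x hx y hy
          obtain ⟨a, ha, b, hb, rfl⟩ := Submodule.mem_sup.mp hy
          change jform r n _ _ = 0
          rw [map_add, LinearMap.add_apply]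
          have h3 : x ∈ W.comap (ext : Jet r n →ₗ[ℂ] Sq n) := hx.1
          rw [← h.comap_ext_orthogonal hW hp] at h3
          have h4 : x ∈ posJ r n u := hx.2
          rw [← jform_orthogonal_posJ (k := i + u) (by omega)] at h4
          rw [h3 a ha, h4 b hb, add_zero]
      rw [← h2, LinearMap.BilinForm.orthogonal_orthogonal jform_nondegenerate jform_isRefl]
    have hsf : sh (u : ℤ) f ∈ pos n 0 := sh_mem_pos.mpr (pos_mono (by omega) hf)
    have h5 : tr r (sh u f) ∈ (jform r n).orthogonal (B ⊓ posJ r n u) := by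
      intro y hy
      change jform r n _ _ = 0
      rw [jform_apply]
      have e1 : sh (u : ℤ) (sh (-u : ℤ) (ext y)) = ext y := by rw [sh_sh, add_neg_cancel, sh_zero]
      have hy' : sh (-u : ℤ) (ext y) ∈ pos n 0 := by
        rw [sh_mem_pos, zero_sub, neg_neg]
        exact hy.2
      have e2 : ext (tr r (sh u f)) = sh u f - (sh u f - ext (tr r (sh u f))) := by abel
      have e3 := bform_eq_zero_of_pos_right (f := ext y) (sub_ext_tr_mem_pos (r := r) hsf)
      have e4 := bform_add_right (r := r) (ext y) (sh u f - ext (tr r (sh u f)))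
        (ext (tr r (sh u f)))
      rw [sub_add_cancel, e3, zero_add] at e4
      rw [← e4, ← e1, bform_sh hy' hf hr]
      exact hf' _ (Submodule.mem_sup_left ⟨by
        change sh (u : ℤ) (sh (-u : ℤ) (ext y)) ∈ W
        rw [e1]
        exact hy.1, hy'⟩)
    rw [h1] at h5
    obtain ⟨a, ha, b, hb, hab⟩ := Submodule.mem_sup.mp h5
    have e5 : sh (u : ℤ) f = ext a + (ext b + (sh u f - ext (tr r (sh u f)))) := by
      rw [← hab, map_add]; abel
    have hc : ext b + (sh (u : ℤ) f - ext (tr r (sh u f))) ∈ pos n (i + u : ℕ) :=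
      Submodule.add_mem _ hb (pos_mono (by omega) (sub_ext_tr_mem_pos hsf))
    set c := ext b + (sh (u : ℤ) f - ext (tr r (sh u f)))
    have e6 : f = sh (-u : ℤ) (ext a) + sh (-u : ℤ) c := by
      rw [← map_add, ← e5, sh_sh, neg_add_cancel, sh_zero]
    have hcc : sh (-u : ℤ) c ∈ pos n i := sh_mem_pos.mpr (pos_mono (by push_cast; omega) hc)
    rw [e6]
    refine Submodule.add_mem_sup ⟨?_, ?_⟩ hcc
    · change sh (u : ℤ) (sh (-u : ℤ) (ext a)) ∈ W
      rw [sh_sh, add_neg_cancel, sh_zero]; exact ha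
    · have := Submodule.sub_mem _ hf (pos_mono (show (0 : ℤ) ≤ i by omega) hcc)
      rwa [e6, add_sub_cancel_right] at this

/-! ### The involution `ν` -/

/-- The substitution `λ ↦ -λ`. -/
def tau {n : ℕ} : Sq n →ₗ[ℂ] Sq n where
  toFun f i := (-1 : ℂ) ^ i • f i
  map_add' f g := by ext1 i; simp
  map_smul' c f := by ext1 i; exact smul_comm ((-1 : ℂ) ^ i) c (f i)

lemma tau_apply (f : Sq n) (i : ℤ) : tau f i = (-1 : ℂ) ^ i • f i := rfl

lemma tau_mem_pos {k : ℤ} {f : Sq n} : tau f ∈ pos n k ↔ f ∈ pos n k := by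
  simp [mem_pos, tau_apply, zpow_ne_zero]

lemma sh_tau (k : ℤ) (f : Sq n) : sh k (tau f) = (-1 : ℂ) ^ k • tau (sh k f) := by
  ext1 i
  rw [Pi.smul_apply, tau_apply, sh_apply, sh_apply, tau_apply, smul_smul,
    ← zpow_add₀ (by norm_num)]
  congr 1
  rw [show i - k = k + i - 2 * k by ring, zpow_sub₀ (by norm_num), zpow_mul]
  norm_num

/-- The coefficients of `γ(-λ)`. -/
def negCoeffs (T : ℕ → End n) (k : ℕ) : End n := (-1 : ℂ) ^ k • T k

lemma polyLoop_negCoeffs (z : Circle) : polyLoop r (negCoeffs T) z = polyLoop r T (-z) := by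
  rw [polyLoop, polyLoop]
  refine Finset.sum_congr rfl fun k _ => ?_
  rw [negCoeffs, smul_smul, ← mul_pow]
  congr 2
  change _ = -(z : ℂ)
  ring

lemma UnitaryCoeffs.negCoeffs (h : UnitaryCoeffs r T) : UnitaryCoeffs r (negCoeffs T) :=
  fun z => by rw [polyLoop_negCoeffs]; exact h _

lemma divS_negCoeffs (f : Sq n) : divS r (negCoeffs T) f = tau (divS r T (tau f)) := by
  ext1 i
  rw [tau_apply, divS_apply, divS_apply, Finset.smul_sum]
  refine Finset.sum_congr rfl fun k _ => ?_
  rw [tau_apply, map_smul, smul_smul, negCoeffs, star_smul, ← zpow_add₀ (by norm_num)]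
  rw [smul_apply]
  congr 1
  rw [show i + (i + k) = 2 * i + k by ring, zpow_add₀ (by norm_num), zpow_mul]
  norm_num

lemma mem_WS_negCoeffs {f : Sq n} : f ∈ WS r (negCoeffs T) ↔ tau f ∈ WS r T := by
  rw [mem_WS, mem_WS, divS_negCoeffs, tau_mem_pos]

/-- A formal Grassmannian model that is invariant under `λ ↦ -λ`. -/
def IsTau (W : Submodule ℂ (Sq n)) : Prop := ∀ f, tau f ∈ W ↔ f ∈ W

lemma tau_tau (f : Sq n) : tau (tau f) = f := by
  ext1 i
  rw [tau_apply, tau_apply, smul_smul, ← mul_zpow]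
  norm_num

/-- Invariance under `ν` means `γ(-λ) = γ(λ) γ(-1)`, and a constant right factor does not change the
model. -/
lemma isTau_of_nu (hU : UnitaryCoeffs r T) (h : nuInv (polyLoop r T) = polyLoop r T) :
    IsTau (WS r T) := by
  have h1 : ∀ z, polyLoop r (negCoeffs T) z = polyLoop r T z * polyLoop r T (-1) := by
    intro z
    rw [polyLoop_negCoeffs]
    conv_rhs => rw [← h]
    have e : nuInv (polyLoop r T) (-1) = polyLoop r T (-1) := by rw [h]
    have e1 : star (polyLoop r T (-1)) * polyLoop r T (-1) = 1 := (Unitary.mem_iff.mp (hU _)).1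
    rw [e, nuInv, mul_assoc, e1, mul_one]
  have key : ∀ f, f ∈ WS r T → tau f ∈ WS r T := by
    intro f hf
    rw [← mem_WS_negCoeffs, mem_WS]
    have : divS r (negCoeffs T) f = fun i => star (polyLoop r T (-1)) (divS r T f i) := by
      have h2 : divS r (negCoeffs T) f = divS r (fun k => T k * polyLoop r T (-1)) f := by
        refine divS_congr (fun z => ?_) f
        rw [h1]
        conv_lhs => rw [polyLoop]
        conv_rhs => rw [polyLoop]
        rw [Finset.sum_mul]
        exact Finset.sum_congr rfl fun k _ => by rw [smul_mul_assoc]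
      rw [h2]
      ext1 i
      rw [divS_apply, divS_apply, map_sum]
      exact Finset.sum_congr rfl fun k _ => by rw [star_mul, mul_apply_eq_comp]
    rw [this]
    intro i hi
    have := hf i hi
    simp only [this, map_zero]
  refine fun f => ⟨fun hf => ?_, key f⟩
  rw [← tau_tau f]
  exact key _ hf

/-- The loops `γ(-λ)` and `γ(λ)` have the same model, hence differ by a constant right factor;
evaluation at `λ = 1` identifies it as `γ(-1)`. -/
lemma nu_of_isTau (hU : UnitaryCoeffs r T) (h1 : polyLoop r T 1 = 1) (h : IsTau (WS r T)) :
    nuInv (polyLoop r T) = polyLoop r T := by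
  obtain ⟨A, hA⟩ := polyLoop_eq_of_WS_eq hU hU.negCoeffs (by ext f; rw [mem_WS_negCoeffs, h])
  have hA1 : polyLoop r T (-1) = A := by
    rw [← polyLoop_negCoeffs, hA, h1, one_mul]
  ext1 z
  rw [nuInv, ← polyLoop_negCoeffs, hA, hA1, mul_assoc, ← hA1, (Unitary.mem_iff.mp (hU _)).2,
    mul_one]

/-- The substitution `λ ↦ -λ` commutes with `λ^u` up to a sign and preserves every `λ^i H_+`. -/
lemma IsTau.altS {W : Submodule ℂ (Sq n)} (h : IsTau W) (u i : ℕ) : IsTau (altS W u i) := by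
  have key : ∀ f, f ∈ UnitonTheory.altS W u i → tau f ∈ UnitonTheory.altS W u i := by
    intro f hf
    obtain ⟨a, ha, b, hb, rfl⟩ := Submodule.mem_sup.mp hf
    rw [map_add]
    refine Submodule.add_mem_sup ⟨?_, tau_mem_pos.mpr ha.2⟩ (tau_mem_pos.mpr hb)
    change sh (u : ℤ) (tau a) ∈ W
    rw [sh_tau]
    exact W.smul_mem _ ((h _).mpr ha.1)
  refine fun f => ⟨fun hf => ?_, key f⟩
  rw [← tau_tau f]
  exact key _ hf

end

end UnitonTheory

namespace UnitonTheory

noncomputable section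

variable {n r : ℕ} {V V' : ℕ → Submodule ℂ (E n)}

/-! ### Products of linear factors -/

lemma op_star_add (A B : End n) : star (A + B) = star A + star B := star_add A B

lemma op_star_sub (A B : End n) : star (A - B) = star A - star B := star_sub A B

lemma op_star_zero : star (0 : End n) = 0 := star_zero (End n)

lemma op_smul_zero (c : ℂ) : c • (0 : End n) = 0 := by
  ext1 v; simp

lemma star_proj (U : Submodule ℂ (E n)) : star (proj U) = proj U :=
  (isSelfAdjoint_starProjection U).star_eq

lemma proj_mul_proj (U : Submodule ℂ (E n)) : proj U * proj U = proj U :=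
  U.isIdempotentElem_starProjection

lemma proj_orthogonal (U : Submodule ℂ (E n)) : proj Uᗮ = 1 - proj U := by
  ext1 v
  rw [Submodule.starProjection_orthogonal_val]
  rfl

lemma proj_mul_proj_orthogonal (U : Submodule ℂ (E n)) : proj U * proj Uᗮ = 0 := by
  rw [proj_orthogonal, mul_sub, mul_one, proj_mul_proj, sub_self]

lemma proj_orthogonal_mul_proj (U : Submodule ℂ (E n)) : proj Uᗮ * proj U = 0 := by
  rw [proj_orthogonal, sub_mul, one_mul, proj_mul_proj, sub_self]

lemma proj_mem (U : Submodule ℂ (E n)) (v : E n) : proj U v ∈ U :=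
  Submodule.starProjection_apply_mem U v

lemma proj_eq_self_iff {U : Submodule ℂ (E n)} {v : E n} : proj U v = v ↔ v ∈ U :=
  Submodule.starProjection_eq_self_iff

lemma proj_orthogonal_eq_zero_iff {U : Submodule ℂ (E n)} {v : E n} : proj Uᗮ v = 0 ↔ v ∈ U := by
  rw [proj_orthogonal, ← proj_eq_self_iff, sub_apply, sub_eq_zero]
  exact eq_comm

lemma star_linFactor (U : Submodule ℂ (E n)) (z : Circle) :
    star (linFactor U z) = proj U + (z : ℂ)⁻¹ • proj Uᗮ := by
  rw [linFactor, op_star_add, star_smul, star_proj, star_proj, Complex.star_def,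
    ← Circle.coe_inv_eq_conj, Circle.coe_inv]

lemma linFactor_mem_unitary (U : Submodule ℂ (E n)) (z : Circle) :
    linFactor U z ∈ unitary (End n) := by
  have h := Circle.coe_ne_zero z
  rw [Unitary.mem_iff, star_linFactor, linFactor]
  constructor <;>
  · rw [add_mul, mul_add, mul_add, proj_mul_proj, mul_smul_comm, smul_mul_assoc,
      smul_mul_smul_comm, proj_mul_proj_orthogonal, proj_orthogonal_mul_proj, proj_mul_proj,
      op_smul_zero, op_smul_zero, proj_orthogonal]
    simp [h]

lemma linFactor_one (U : Submodule ℂ (E n)) : linFactor U 1 = 1 := by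
  rw [linFactor, proj_orthogonal]
  simp

/-- The coefficients of `(π_{V_1} + λ π_{V_1}^⊥) ⋯ (π_{V_i} + λ π_{V_i}^⊥)`. -/
def etaCoeffs (V : ℕ → Submodule ℂ (E n)) (i k : ℕ) : End n := star (invCoeff V i k)

lemma invCoeff_of_lt {i k : ℕ} (h : i < k) : invCoeff V i k = 0 := by
  induction i generalizing k with
  | zero =>
    obtain ⟨k, rfl⟩ := Nat.exists_eq_succ_of_ne_zero (by omega : k ≠ 0)
    rfl
  | succ i ih =>
    obtain ⟨k, rfl⟩ := Nat.exists_eq_succ_of_ne_zero (by omega : k ≠ 0)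
    rw [Nat.succ_eq_add_one, invCoeff, ih (by omega), ih (by omega), mul_zero, mul_zero, add_zero]

lemma invCoeff_congr {i : ℕ} (h : ∀ j ≤ i, V j = V' j) (k : ℕ) :
    invCoeff V i k = invCoeff V' i k := by
  induction i generalizing k with
  | zero => cases k <;> rfl
  | succ i ih =>
    have ih := ih fun j hj => h j (by omega)
    cases k with
    | zero => rw [invCoeff, invCoeff, ih, h _ le_rfl]
    | succ k => rw [invCoeff, invCoeff, ih, ih, h _ le_rfl]

lemma etaCoeffs_succ_zero (i : ℕ) :
    etaCoeffs V (i + 1) 0 = etaCoeffs V i 0 * proj (V (i + 1)) := by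
  rw [etaCoeffs, invCoeff, star_mul, star_proj, etaCoeffs]

lemma etaCoeffs_succ_succ (i k : ℕ) :
    etaCoeffs V (i + 1) (k + 1) =
      etaCoeffs V i (k + 1) * proj (V (i + 1)) + etaCoeffs V i k * proj (V (i + 1))ᗮ := by
  rw [etaCoeffs, invCoeff, op_star_add, star_mul, star_mul, star_proj, star_proj, etaCoeffs,
    etaCoeffs]

lemma etaCoeffs_of_lt {i k : ℕ} (h : i < k) : etaCoeffs V i k = 0 := by
  rw [etaCoeffs, invCoeff_of_lt h, op_star_zero]

lemma polyLoop_etaCoeffs_succ (i : ℕ) (z : Circle) :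
    polyLoop (i + 1) (etaCoeffs V (i + 1)) z =
      polyLoop i (etaCoeffs V i) z * linFactor (V (i + 1)) z := by
  have h : polyLoop i (etaCoeffs V i) z =
      etaCoeffs V i 0 + ∑ k ∈ Finset.range (i + 1), (z : ℂ) ^ (k + 1) • etaCoeffs V i (k + 1) := by
    rw [polyLoop, Finset.sum_range_succ', Finset.sum_range_succ,
      etaCoeffs_of_lt (show i < i + 1 by omega), pow_zero, one_smul, op_smul_zero, add_zero, add_comm]
  rw [linFactor, mul_add]
  conv_rhs => enter [1]; rw [h]
  rw [polyLoop, polyLoop, Finset.sum_range_succ', etaCoeffs_succ_zero, pow_zero, one_smul, add_mul,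
    Finset.sum_mul, Finset.sum_mul, add_comm, add_assoc, ← Finset.sum_add_distrib]
  congr 1
  refine Finset.sum_congr rfl fun k _ => ?_
  rw [etaCoeffs_succ_succ, smul_add, smul_mul_assoc, smul_mul_smul_comm, pow_succ]

variable {M : Type*} {α : ℕ → M → Submodule ℂ (E n)}

lemma etaProd_eq_polyLoop (i : ℕ) (p : M) :
    etaProd α 0 i p = polyLoop i (etaCoeffs (fun j => α j p) i) := by
  induction i with
  | zero =>
    ext1 z
    simp [etaProd, polyLoop, etaCoeffs, invCoeff]
  | succ i ih =>
    ext1 z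
    rw [etaProd, ih, polyLoop_etaCoeffs_succ, Nat.zero_add]

lemma etaProd_mem_unitary (a k : ℕ) (p : M) (z : Circle) :
    etaProd α a k p z ∈ unitary (End n) := by
  induction k with
  | zero => exact one_mem _
  | succ k ih => exact mul_mem ih (linFactor_mem_unitary _ z)

lemma etaProd_one (a k : ℕ) (p : M) : etaProd α a k p 1 = 1 := by
  induction k with
  | zero => rfl
  | succ k ih => rw [etaProd, ih, linFactor_one, mul_one]

lemma etaProd_add (a b : ℕ) (p : M) (z : Circle) :
    etaProd α 0 (a + b) p z = etaProd α 0 a p z * etaProd α a b p z := by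
  induction b with
  | zero => rw [etaProd, mul_one, add_zero]
  | succ b ih => rw [← add_assoc, etaProd, etaProd, ih, mul_assoc, Nat.zero_add]

lemma etaProd_shift (a k : ℕ) (p : M) :
    etaProd α a k p = etaProd (fun j => α (a + j)) 0 k p := by
  induction k with
  | zero => rfl
  | succ k ih =>
    ext1 z
    rw [etaProd, etaProd, ih]
    congr 3
    omega

lemma unitaryCoeffs_etaCoeffs (V : ℕ → Submodule ℂ (E n)) (i : ℕ) :
    UnitaryCoeffs i (etaCoeffs V i) := by
  intro z
  rw [← etaProd_eq_polyLoop (M := Unit) (α := fun j _ => V j) i ()]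
  exact etaProd_mem_unitary _ _ _ _

lemma contMDiff_circle_coe : ContMDiff (𝓡 1) 𝓘(ℝ, ℂ) ∞ (fun z : Circle => (z : ℂ)) :=
  haveI : Fact (Module.finrank ℝ ℂ = 1 + 1) := finrank_real_complex_fact'
  contMDiff_coe_sphere (n := 1)

lemma contMDiff_polyLoop (i : ℕ) (T : ℕ → End n) :
    ContMDiff (𝓡 1) 𝓘(ℝ, End n) ∞ (polyLoop i T) := by
  have h : ContDiff ℝ ∞ (fun w : ℂ => ∑ k ∈ Finset.range (i + 1), w ^ k • T k) := by
    have : ContDiff ℂ ∞ (fun w : ℂ => ∑ k ∈ Finset.range (i + 1), w ^ k • T k) := by fun_prop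
    exact this.restrict_scalars ℝ
  exact h.comp_contMDiff contMDiff_circle_coe

lemma etaProd_mem_polyLoops (a k : ℕ) (p : M) : etaProd α a k p ∈ polyLoops n k := by
  refine ⟨⟨?_, etaProd_mem_unitary a k p, etaProd_one a k p⟩,
    etaCoeffs (fun j => α (a + j) p) k, fun z => ?_⟩
  · rw [etaProd_shift, etaProd_eq_polyLoop]
    exact contMDiff_polyLoop _ _
  · rw [etaProd_shift, etaProd_eq_polyLoop, polyLoop]

/-! ### From the filtration to the unitons, at a point -/

lemma divS_etaCoeffs_apply (i : ℕ) (f : Sq n) (m : ℤ) :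
    divS i (etaCoeffs V i) f m = ∑ k ∈ Finset.range (i + 1), invCoeff V i k (f (m + k)) := by
  rw [divS_apply]
  exact Finset.sum_congr rfl fun k _ => by rw [etaCoeffs, star_star]

lemma divS_etaCoeffs_succ (i : ℕ) (f : Sq n) (m : ℤ) :
    divS (i + 1) (etaCoeffs V (i + 1)) f m =
      proj (V (i + 1)) (divS i (etaCoeffs V i) f m) +
        proj (V (i + 1))ᗮ (divS i (etaCoeffs V i) f (m + 1)) := by
  have h : divS i (etaCoeffs V i) f m = invCoeff V i 0 (f m) +
      ∑ k ∈ Finset.range (i + 1), invCoeff V i (k + 1) (f (m + (k + 1 : ℕ))) := by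
    rw [divS_etaCoeffs_apply, Finset.sum_range_succ', Finset.sum_range_succ,
      invCoeff_of_lt (show i < i + 1 by omega), zero_apply, add_zero, add_comm, Nat.cast_zero,
      add_zero]
  rw [h, divS_etaCoeffs_apply, divS_etaCoeffs_apply, Finset.sum_range_succ', invCoeff, map_add,
    map_sum, map_sum, add_comm, Nat.cast_zero, add_zero, add_assoc, ← Finset.sum_add_distrib]
  congr 1
  refine Finset.sum_congr rfl fun k _ => ?_
  rw [invCoeff, add_apply, mul_apply_eq_comp, mul_apply_eq_comp]
  congr 4
  push_cast; ring

/-- With `g = Φ_i⁻¹ f` one has `Φ_{i+1}⁻¹ f = (π + λ⁻¹ π^⊥) g`. The vanishing of its negative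
coefficients separates into `π g_m = 0` for `m < 0` and `π^⊥ g_m = 0` for `m ≤ 0`: that is, `g ∈
H_+` and `g_0 ∈ V_{i+1}`. -/
lemma mem_WS_etaCoeffs_succ {i : ℕ} {f : Sq n} :
    f ∈ WS (i + 1) (etaCoeffs V (i + 1)) ↔
      f ∈ WS i (etaCoeffs V i) ∧ divS i (etaCoeffs V i) f 0 ∈ V (i + 1) := by
  set g := divS i (etaCoeffs V i) f with hg
  have hrec := fun m => divS_etaCoeffs_succ (V := V) i f m
  constructor
  · intro h
    have h1 : ∀ m < 0, proj (V (i + 1)) (g m) = 0 ∧ proj (V (i + 1))ᗮ (g (m + 1)) = 0 := by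
      intro m hm
      have h2 := h m hm
      rw [hrec] at h2
      constructor
      · have h3 := congrArg (proj (V (i + 1))) h2
        rw [map_add, map_zero, ← mul_apply_eq_comp, ← mul_apply_eq_comp, proj_mul_proj,
          proj_mul_proj_orthogonal, zero_apply, add_zero] at h3
        exact h3
      · have h3 := congrArg (proj (V (i + 1))ᗮ) h2
        rw [map_add, map_zero, ← mul_apply_eq_comp, ← mul_apply_eq_comp, proj_mul_proj,
          proj_orthogonal_mul_proj, zero_apply, zero_add] at h3
        exact h3
    refine ⟨fun m hm => ?_, ?_⟩
    · have h2 := (h1 (m - 1) (by omega)).2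
      rw [sub_add_cancel, proj_orthogonal, sub_apply, (h1 m hm).1, sub_zero] at h2
      exact h2
    · have := (h1 (-1) (by omega)).2
      rwa [neg_add_cancel, proj_orthogonal_eq_zero_iff] at this
  · rintro ⟨h1, h2⟩ m hm
    have h1 : ∀ m < 0, g m = 0 := h1
    rw [hrec]
    change proj (V (i + 1)) (g m) + proj (V (i + 1))ᗮ (g (m + 1)) = 0
    rw [h1 m hm, map_zero, zero_add]
    rcases eq_or_ne (m + 1) 0 with h3 | h3
    · rw [h3]; exact proj_orthogonal_eq_zero_iff.mpr h2
    · rw [h1 (m + 1) (by omega), map_zero]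

/-- The map `P_0 Φ_i⁻¹` on jets. -/
def evA (r : ℕ) (V : ℕ → Submodule ℂ (E n)) (i : ℕ) : Jet r n →ₗ[ℂ] E n :=
  (LinearMap.proj 0 : Sq n →ₗ[ℂ] E n) ∘ₗ divS i (etaCoeffs V i) ∘ₗ ext

lemma evA_apply (i : ℕ) (x : Jet r n) : evA r V i x = divS i (etaCoeffs V i) (ext x) 0 := rfl

lemma evA_tr {i : ℕ} (hi : i < r) {f : Sq n} (hf : f ∈ pos n 0) :
    evA r V i (tr r f) = divS i (etaCoeffs V i) f 0 := by
  have h : divS i (etaCoeffs V i) (f - ext (tr r f)) ∈ pos n 1 :=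
    divS_mem_pos (pos_mono (by omega) (sub_ext_tr_mem_pos hf))
  have := h 0 (by norm_num)
  rw [map_sub, Pi.sub_apply, sub_eq_zero] at this
  exact this.symm

lemma evA_congr {i : ℕ} (h : ∀ j ≤ i, V j = V' j) : evA r V i = evA r V' i := by
  refine LinearMap.ext fun x => ?_
  rw [evA_apply, evA_apply, divS_etaCoeffs_apply, divS_etaCoeffs_apply]
  exact Finset.sum_congr rfl fun k _ => by rw [invCoeff_congr h]

/-- Inductive step for `Φ_i H_+ = W_i`. If `x ∈ W_i` and `P_0 Φ_i⁻¹ x` equals `P_0 Φ_i⁻¹ y` with `y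
∈ W_{i+1}`, then `Φ_i⁻¹(x - y)` is divisible by `λ`. So `x - y ∈ λ W_i ⊆ W_{i+1}` and `x ∈ W_{i+1}`.
-/
lemma comap_ext_WS_succ {i : ℕ} (hi : i < r) {B₀ B₁ : Submodule ℂ (Jet r n)}
    (h₀ : (WS i (etaCoeffs V i)).comap ext = B₀) (hle : B₁ ≤ B₀) (hN : ∀ x ∈ B₀, shJ 1 x ∈ B₁)
    (hV : V (i + 1) = B₁.map (evA r V i)) :
    (WS (i + 1) (etaCoeffs V (i + 1))).comap ext = B₁ := by
  have hU := unitaryCoeffs_etaCoeffs V i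
  ext x
  rw [Submodule.mem_comap, mem_WS_etaCoeffs_succ, hV]
  constructor
  · rintro ⟨h1, y, hy, hxy⟩
    have hy0 : ext y ∈ WS i (etaCoeffs V i) := by
      rw [← Submodule.mem_comap, h₀]; exact hle hy
    have hz : divS i (etaCoeffs V i) (ext (x - y)) ∈ pos n 1 := by
      intro m hm
      rw [map_sub, map_sub, Pi.sub_apply]
      rcases eq_or_ne m 0 with rfl | h
      · rw [← hxy, evA_apply, sub_self]
      · rw [h1 m (by omega), hy0 m (by omega), sub_self]
    set f := sh (-1) (ext (x - y)) with hf
    have hfW : f ∈ WS i (etaCoeffs V i) := by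
      rw [mem_WS, hf, divS_sh, sh_mem_pos]; exact hz
    have hf0 := hU.WS_le_pos hfW
    have hx : shJ 1 (tr r f) = x - y := by
      rw [shJ_tr hf0, hf, sh_sh, Nat.cast_one, add_neg_cancel, sh_zero, tr_ext]
    have hmem : tr r f ∈ B₀ := by
      rw [← h₀, Submodule.mem_comap, mem_iff_ext_tr_mem ((pos_mono (by omega)).trans pos_le_WS) hf0]
      exact hfW
    have := hN _ hmem
    rw [hx] at this
    simpa using B₁.add_mem this hy
  · intro hx
    refine ⟨?_, x, hx, rfl⟩
    rw [← Submodule.mem_comap, h₀]; exact hle hx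

/-- The first `i` of the subspaces `α_1, α_2, …` determined by a filtration, the others being
zero. -/
def unitonAux (B : ℕ → Submodule ℂ (Jet r n)) : ℕ → ℕ → Submodule ℂ (E n)
  | 0 => fun _ => ⊥
  | i + 1 => Function.update (unitonAux B i) (i + 1) ((B (i + 1)).map (evA r (unitonAux B i) i))

/-- The subspaces `α_i = P_0 Φ_{i-1}⁻¹ B_i` determined by a filtration. -/
def unitonSeq (B : ℕ → Submodule ℂ (Jet r n)) (i : ℕ) : Submodule ℂ (E n) := unitonAux B i i

lemma unitonAux_of_le (B : ℕ → Submodule ℂ (Jet r n)) {i j : ℕ} (h : j ≤ i) :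
    unitonAux B i j = unitonSeq B j := by
  induction i, h using Nat.le_induction with
  | base => rfl
  | succ i hi ih => rw [unitonAux, Function.update_of_ne (by omega), ih]

lemma unitonSeq_succ (B : ℕ → Submodule ℂ (Jet r n)) (i : ℕ) :
    unitonSeq B (i + 1) = (B (i + 1)).map (evA r (unitonSeq B) i) := by
  rw [unitonSeq, unitonAux, Function.update_self,
    evA_congr (V' := unitonSeq B) fun j hj => unitonAux_of_le B hj]

/-- A decreasing filtration of the space of jets with the properties of the alternating one. -/
structure IsFiltr (B : ℕ → Submodule ℂ (Jet r n)) : Prop where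
  zero : B 0 = ⊤
  le : ∀ i < r, B (i + 1) ≤ B i
  shift : ∀ i < r, ∀ x ∈ B i, shJ 1 x ∈ B (i + 1)

lemma IsFiltr.comap_ext_WS {B : ℕ → Submodule ℂ (Jet r n)} (h : IsFiltr B) {i : ℕ} (hi : i ≤ r) :
    (WS i (etaCoeffs (unitonSeq B) i)).comap ext = B i := by
  induction i with
  | zero =>
    rw [h.zero, eq_top_iff]
    intro x _ m hm
    rw [divS_etaCoeffs_apply]
    simp [ext_mem_pos x m hm]
  | succ i ih =>
    exact comap_ext_WS_succ (by omega) (ih (by omega)) (h.le i (by omega)) (h.shift i (by omega))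
      (unitonSeq_succ B i)

lemma IsFiltr.mem_WS_iff {B : ℕ → Submodule ℂ (Jet r n)} (h : IsFiltr B) {i : ℕ} (hi : i ≤ r)
    {f : Sq n} (hf : f ∈ pos n 0) :
    f ∈ WS i (etaCoeffs (unitonSeq B) i) ↔ tr r f ∈ B i := by
  rw [← h.comap_ext_WS hi, Submodule.mem_comap,
    mem_iff_ext_tr_mem ((pos_mono (by omega)).trans pos_le_WS) hf]

end

end UnitonTheory

namespace UnitonTheory

noncomputable section

section Wirtinger

variable {F F₁ F₂ F₃ : Type*} [NormedAddCommGroup F] [NormedSpace ℂ F]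
  [NormedAddCommGroup F₁] [NormedSpace ℂ F₁] [NormedAddCommGroup F₂] [NormedSpace ℂ F₂]
  [NormedAddCommGroup F₃] [NormedSpace ℂ F₃]

/-! ### Wirtinger derivatives -/

/-- The real linear map `w ↦ w a + w̄ b`. -/
def wirt (a b : F) : ℂ →L[ℝ] F :=
  (ContinuousLinearMap.toSpanSingleton ℂ a).restrictScalars ℝ +
    ((ContinuousLinearMap.toSpanSingleton ℂ b).restrictScalars ℝ).comp
      (Complex.conjCLE : ℂ →L[ℝ] ℂ)

lemma wirt_apply (a b : F) (w : ℂ) : wirt a b w = w • a + conj w • b := rfl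

/-- `a` and `b` are the derivatives `∂g/∂z` and `∂g/∂z̄`. -/
def HasW (g : ℂ → F) (a b : F) (z : ℂ) : Prop := HasFDerivAt (𝕜 := ℝ) g (wirt a b) z

lemma wirt_eq (L : ℂ →L[ℝ] F) :
    wirt ((1 / 2 : ℂ) • (L 1 - Complex.I • L Complex.I))
      ((1 / 2 : ℂ) • (L 1 + Complex.I • L Complex.I)) = L := by
  ext1 w
  have h : L w = w.re • L 1 + w.im • L Complex.I := by
    rw [← map_smul, ← map_smul, ← map_add]
    congr 1
    apply Complex.ext <;> simp
  rw [wirt_apply, h, ← Complex.coe_smul, ← Complex.coe_smul]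
  have hw : conj w = (w.re : ℂ) - w.im * Complex.I := by apply Complex.ext <;> simp
  have hw' : w = (w.re : ℂ) + w.im * Complex.I := by apply Complex.ext <;> simp
  have hI : Complex.I * Complex.I = -1 := Complex.I_mul_I
  rw [hw]
  nth_rewrite 1 [hw']
  match_scalars
  · ring
  · linear_combination (-w.im : ℂ) * hI

lemma hasW_of_differentiableAt {g : ℂ → F} {z : ℂ} (h : DifferentiableAt ℝ g z) :
    HasW g ((1 / 2 : ℂ) • (fderiv ℝ g z 1 - Complex.I • fderiv ℝ g z Complex.I))
      ((1 / 2 : ℂ) • (fderiv ℝ g z 1 + Complex.I • fderiv ℝ g z Complex.I)) z := by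
  rw [HasW, wirt_eq]; exact h.hasFDerivAt

lemma HasW.dz_eq {g : ℂ → F} {a b : F} {z : ℂ} (h : HasW g a b z) :
    (1 / 2 : ℂ) • (fderiv ℝ g z 1 - Complex.I • fderiv ℝ g z Complex.I) = a := by
  rw [HasFDerivAt.fderiv h, wirt_apply, wirt_apply]
  have hI : Complex.I * Complex.I = -1 := Complex.I_mul_I
  simp only [map_one, Complex.conj_I]
  match_scalars
  · linear_combination (-1 / 2 : ℂ) * hI
  · linear_combination (1 / 2 : ℂ) * hI

lemma HasW.dzbar_eq {g : ℂ → F} {a b : F} {z : ℂ} (h : HasW g a b z) :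
    (1 / 2 : ℂ) • (fderiv ℝ g z 1 + Complex.I • fderiv ℝ g z Complex.I) = b := by
  rw [HasFDerivAt.fderiv h, wirt_apply, wirt_apply]
  have hI : Complex.I * Complex.I = -1 := Complex.I_mul_I
  simp only [map_one, Complex.conj_I]
  match_scalars
  · linear_combination (1 / 2 : ℂ) * hI
  · linear_combination (-1 / 2 : ℂ) * hI

lemma HasW.unique {g : ℂ → F} {a b a' b' : F} {z : ℂ} (h : HasW g a b z) (h' : HasW g a' b' z) :
    a = a' ∧ b = b' :=
  ⟨h.dz_eq.symm.trans h'.dz_eq, h.dzbar_eq.symm.trans h'.dzbar_eq⟩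

lemma HasW.congr {g g' : ℂ → F} {a b : F} {z : ℂ} (h : HasW g a b z) (hg : g' =ᶠ[𝓝 z] g) :
    HasW g' a b z :=
  HasFDerivAt.congr_of_eventuallyEq h hg

lemma HasW.differentiableAt {g : ℂ → F} {a b : F} {z : ℂ} (h : HasW g a b z) :
    DifferentiableAt ℝ g z := HasFDerivAt.differentiableAt h

lemma HasW.continuousAt {g : ℂ → F} {a b : F} {z : ℂ} (h : HasW g a b z) : ContinuousAt g z :=
  HasFDerivAt.continuousAt h

lemma hasW_const (c : F) (z : ℂ) : HasW (fun _ => c) 0 0 z := by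
  have h : wirt (0 : F) 0 = 0 := by ext1 w; simp [wirt_apply]
  rw [HasW, h]; exact hasFDerivAt_const c z

lemma HasW.add {g g' : ℂ → F} {a b a' b' : F} {z : ℂ} (h : HasW g a b z) (h' : HasW g' a' b' z) :
    HasW (fun w => g w + g' w) (a + a') (b + b') z := by
  have e : wirt (a + a') (b + b') = wirt a b + wirt a' b' := by
    ext1 w; simp only [wirt_apply, add_apply, smul_add]; abel
  rw [HasW, e]; exact HasFDerivAt.add h h'

lemma HasW.clm {g : ℂ → F₁} {a b : F₁} {z : ℂ} (h : HasW g a b z) (L : F₁ →L[ℂ] F₂) :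
    HasW (fun w => L (g w)) (L a) (L b) z := by
  have e : wirt (L a) (L b) = (L.restrictScalars ℝ).comp (wirt a b) := by
    ext1 w; simp [wirt_apply]
  rw [HasW, e]; exact (L.restrictScalars ℝ).hasFDerivAt.comp z h

lemma HasW.neg {g : ℂ → F} {a b : F} {z : ℂ} (h : HasW g a b z) :
    HasW (fun w => -g w) (-a) (-b) z := by
  simpa using h.clm (-(ContinuousLinearMap.id ℂ F))

lemma HasW.sub {g g' : ℂ → F} {a b a' b' : F} {z : ℂ} (h : HasW g a b z) (h' : HasW g' a' b' z) :
    HasW (fun w => g w - g' w) (a - a') (b - b') z := by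
  simpa only [sub_eq_add_neg] using h.add h'.neg

lemma HasW.const_smul {g : ℂ → F} {a b : F} {z : ℂ} (h : HasW g a b z) (c : ℂ) :
    HasW (fun w => c • g w) (c • a) (c • b) z := by
  simpa using h.clm (c • (ContinuousLinearMap.id ℂ F))

lemma HasW.sum {ι : Type*} (s : Finset ι) {g : ι → ℂ → F} {a b : ι → F} {z : ℂ}
    (h : ∀ i ∈ s, HasW (g i) (a i) (b i) z) :
    HasW (fun w => ∑ i ∈ s, g i w) (∑ i ∈ s, a i) (∑ i ∈ s, b i) z := by
  classical
  induction s using Finset.induction_on with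
  | empty => simpa using hasW_const (0 : F) z
  | insert i s hi ih =>
    simp only [Finset.sum_insert hi]
    exact (h i (Finset.mem_insert_self i s)).add
      (ih fun j hj => h j (Finset.mem_insert_of_mem hj))

lemma hasW_pi {ι : Type*} [Fintype ι] {g : ℂ → ι → F} {a b : ι → F} {z : ℂ}
    (h : ∀ i, HasW (fun w => g w i) (a i) (b i) z) : HasW g a b z := by
  rw [HasW, hasFDerivAt_pi']
  intro i
  exact h i

lemma HasW.bilin (B : F₁ →L[ℂ] F₂ →L[ℂ] F₃) {f : ℂ → F₁} {g : ℂ → F₂} {a b : F₁} {a' b' : F₂}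
    {z : ℂ} (hf : HasW f a b z) (hg : HasW g a' b' z) :
    HasW (fun w => B (f w) (g w)) (B a (g z) + B (f z) a') (B b (g z) + B (f z) b') z := by
  have := (B.bilinearRestrictScalars ℝ).hasFDerivAt_of_bilinear hf hg
  refine HasFDerivAt.congr_fderiv this ?_
  ext1 w
  change B (f z) (wirt a' b' w) + B (wirt a b w) (g z) = _
  simp only [wirt_apply, map_add, map_smul, add_apply, smul_apply, smul_add]
  abel

lemma HasW.clm_apply {f : ℂ → F₁ →L[ℂ] F₂} {g : ℂ → F₁} {a b : F₁ →L[ℂ] F₂} {a' b' : F₁}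
    {z : ℂ} (hf : HasW f a b z) (hg : HasW g a' b' z) :
    HasW (fun w => f w (g w)) (a (g z) + f z a') (b (g z) + f z b') z :=
  hf.bilin (ContinuousLinearMap.id ℂ (F₁ →L[ℂ] F₂)) hg

lemma HasW.mul {f g : ℂ → F₁ →L[ℂ] F₁} {a b : F₁ →L[ℂ] F₁} {a' b' : F₁ →L[ℂ] F₁}
    {z : ℂ} (hf : HasW f a b z) (hg : HasW g a' b' z) :
    HasW (fun w => f w * g w) (a * g z + f z * a') (b * g z + f z * b') z :=
  hf.bilin (ContinuousLinearMap.mul ℂ (F₁ →L[ℂ] F₁)) hg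

lemma hasW_of_hasDerivAt {g : ℂ → F} {a : F} {z : ℂ} (h : HasDerivAt g a z) : HasW g a 0 z := by
  have e : wirt a 0 = (ContinuousLinearMap.toSpanSingleton ℂ a).restrictScalars ℝ := by
    ext1 w; simp [wirt_apply]
  rw [HasW, e]
  exact h.hasFDerivAt.restrictScalars ℝ

lemma HasW.hasDerivAt {g : ℂ → F} {a : F} {z : ℂ} (h : HasW g a 0 z) : HasDerivAt g a z := by
  rw [hasDerivAt_iff_hasFDerivAt]
  refine hasFDerivAt_of_restrictScalars ℝ (f := g) h ?_
  ext1 w; simp [wirt_apply]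

end Wirtinger

/-! ### Idempotents depending analytically on a parameter -/

section Idempotents

variable {V : Type*} [NormedAddCommGroup V] [NormedSpace ℂ V]

lemma AnalyticAt.bilin {F₁ F₂ F₃ : Type*} [NormedAddCommGroup F₁] [NormedSpace ℂ F₁]
    [NormedAddCommGroup F₂] [NormedSpace ℂ F₂] [NormedAddCommGroup F₃] [NormedSpace ℂ F₃]
    (B : F₁ →L[ℂ] F₂ →L[ℂ] F₃) {f : ℂ → F₁} {g : ℂ → F₂} {z : ℂ} (hf : AnalyticAt ℂ f z)
    (hg : AnalyticAt ℂ g z) : AnalyticAt ℂ (fun w => B (f w) (g w)) z :=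
  AnalyticAt.comp (g := fun x : F₁ × F₂ => B x.1 x.2) (f := fun w => (f w, g w))
    (B.analyticAt_bilinear (f z, g z)) (hf.prod hg)

lemma AnalyticAt.op_apply {F₁ F₂ : Type*} [NormedAddCommGroup F₁] [NormedSpace ℂ F₁]
    [NormedAddCommGroup F₂] [NormedSpace ℂ F₂] {f : ℂ → F₁ →L[ℂ] F₂} {g : ℂ → F₁} {z : ℂ}
    (hf : AnalyticAt ℂ f z) (hg : AnalyticAt ℂ g z) : AnalyticAt ℂ (fun w => f w (g w)) z :=
  AnalyticAt.bilin (ContinuousLinearMap.id ℂ (F₁ →L[ℂ] F₂)) hf hg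

lemma AnalyticAt.op_comp {F₁ F₂ F₃ : Type*} [NormedAddCommGroup F₁] [NormedSpace ℂ F₁]
    [NormedAddCommGroup F₂] [NormedSpace ℂ F₂] [NormedAddCommGroup F₃] [NormedSpace ℂ F₃]
    {f : ℂ → F₂ →L[ℂ] F₃} {g : ℂ → F₁ →L[ℂ] F₂} {z : ℂ}
    (hf : AnalyticAt ℂ f z) (hg : AnalyticAt ℂ g z) : AnalyticAt ℂ (fun w => (f w).comp (g w)) z :=
  AnalyticAt.bilin (ContinuousLinearMap.compL ℂ F₁ F₂ F₃) hf hg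

/-- `P` is an idempotent with range `b`. -/
def ProjOnto (P : V →L[ℂ] V) (b : Submodule ℂ V) : Prop := (∀ x, P x ∈ b) ∧ ∀ x ∈ b, P x = x

lemma ProjOnto.mem_iff {P : V →L[ℂ] V} {b : Submodule ℂ V} (h : ProjOnto P b) {x : V} :
    x ∈ b ↔ P x = x := ⟨h.2 x, fun hx => hx ▸ h.1 x⟩

lemma ProjOnto.mul_self {P : V →L[ℂ] V} {b : Submodule ℂ V} (h : ProjOnto P b) : P * P = P := by
  ext1 x; exact h.2 _ (h.1 x)

lemma projOnto_range {P : V →L[ℂ] V} (h : P * P = P) : ProjOnto P (LinearMap.range (P : V →ₗ[ℂ] V)) := by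
  refine ⟨fun x => ⟨x, rfl⟩, ?_⟩
  rintro _ ⟨x, rfl⟩
  exact DFunLike.congr_fun h x

lemma ProjOnto.congr {P P' : V →L[ℂ] V} {b : Submodule ℂ V} (h : ProjOnto P b) (h1 : P * P' = P')
    (h2 : P' * P = P) : ProjOnto P' b := by
  refine ⟨fun x => ?_, fun x hx => ?_⟩
  · rw [← h1]; exact h.1 _
  · rw [← h.2 x hx, ← mul_apply_eq_comp, h2]

/-- `b` is given near `z₀`, but not necessarily at `z₀`, by an analytic family of idempotents. -/
def MeroAt (b : ℂ → Submodule ℂ V) (z₀ : ℂ) : Prop :=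
  ∃ P : ℂ → V →L[ℂ] V, AnalyticAt ℂ P z₀ ∧ ∀ᶠ z in 𝓝[≠] z₀, ProjOnto (P z) (b z)

/-- `b` is given near `z₀` by an analytic family of idempotents. -/
def HolAt (b : ℂ → Submodule ℂ V) (z₀ : ℂ) : Prop :=
  ∃ P : ℂ → V →L[ℂ] V, AnalyticAt ℂ P z₀ ∧ ∀ᶠ z in 𝓝 z₀, ProjOnto (P z) (b z)

lemma HolAt.meroAt {b : ℂ → Submodule ℂ V} {z₀ : ℂ} (h : HolAt b z₀) : MeroAt b z₀ := by
  obtain ⟨P, hP, h⟩ := h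
  exact ⟨P, hP, h.filter_mono nhdsWithin_le_nhds⟩

lemma HolAt.congr {b b' : ℂ → Submodule ℂ V} {z₀ : ℂ} (h : HolAt b z₀) (hb : b' =ᶠ[𝓝 z₀] b) :
    HolAt b' z₀ := by
  obtain ⟨P, hP, h⟩ := h
  refine ⟨P, hP, ?_⟩
  filter_upwards [h, hb] with z h1 h2
  rw [h2]; exact h1

/-- An analytic function that is not identically zero is a product of a power of `z - z₀` and an
analytic function without zeros. -/
lemma analyticAt_dichotomy {F : Type*} [NormedAddCommGroup F] [NormedSpace ℂ F] {f : ℂ → F}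
    {z₀ : ℂ} (hf : AnalyticAt ℂ f z₀) :
    (∀ᶠ z in 𝓝[≠] z₀, f z = 0) ∨ ∃ g : ℂ → F, AnalyticAt ℂ g z₀ ∧ g z₀ ≠ 0 ∧
      ∀ᶠ z in 𝓝[≠] z₀, ∃ c : ℂ, c ≠ 0 ∧ f z = c • g z := by
  by_cases h : ∀ᶠ z in 𝓝 z₀, f z = 0
  · exact Or.inl (h.filter_mono nhdsWithin_le_nhds)
  · obtain ⟨m, g, hg, hg0, h⟩ := hf.exists_eventuallyEq_pow_smul_nonzero_iff.mpr h
    refine Or.inr ⟨g, hg, hg0, ?_⟩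
    filter_upwards [h.filter_mono nhdsWithin_le_nhds, self_mem_nhdsWithin] with z hz hz0
    exact ⟨_, pow_ne_zero _ (sub_ne_zero.mpr hz0), hz⟩

/-- Unless `φ ∘ P` vanishes identically, removing a power of `z - z₀` from it leaves an analytic `ψ`
with `ψ(z₀) ≠ 0`. If `ψ(z₀) v ≠ 0`, then `x ↦ P x - (ψ x / ψ v) P v` is analytic at `z₀`, and near
but off `z₀` it is an idempotent onto `b ∩ ker φ`. -/
lemma MeroAt.inf_ker {b : ℂ → Submodule ℂ V} {z₀ : ℂ} (h : MeroAt b z₀) {φ : ℂ → V →L[ℂ] ℂ}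
    (hφ : AnalyticAt ℂ φ z₀) :
    MeroAt (fun z => b z ⊓ LinearMap.ker (φ z : V →ₗ[ℂ] ℂ)) z₀ := by
  obtain ⟨P, hP, hb⟩ := h
  have hf : AnalyticAt ℂ (fun z => (φ z).comp (P z)) z₀ := AnalyticAt.op_comp hφ hP
  rcases analyticAt_dichotomy hf with h0 | ⟨ψ, hψ, hψ0, h1⟩
  · refine ⟨P, hP, ?_⟩
    filter_upwards [hb, h0] with z h1 h2
    exact ⟨fun x => ⟨h1.1 x, DFunLike.congr_fun h2 x⟩, fun x hx => h1.2 x hx.1⟩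
  · obtain ⟨v, hv⟩ : ∃ v, ψ z₀ v ≠ 0 := by
      by_contra! hcon
      exact hψ0 (ContinuousLinearMap.ext hcon)
    have hd : AnalyticAt ℂ (fun z => ψ z v) z₀ := AnalyticAt.op_apply hψ analyticAt_const
    refine ⟨fun z => P z - (ψ z v)⁻¹ • (ψ z).smulRight (P z v), ?_, ?_⟩
    · refine hP.sub ((hd.inv hv).smul ?_)
      exact AnalyticAt.bilin (ContinuousLinearMap.smulRightL ℂ V V) hψ
        (AnalyticAt.op_apply hP analyticAt_const)
    · filter_upwards [hb, h1, (hd.continuousAt.eventually_ne hv).filter_mono nhdsWithin_le_nhds]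
        with z h1 ⟨c, hc, h2⟩ h3
      have h4 : ∀ x, φ z (P z x) = c * ψ z x := fun x => DFunLike.congr_fun h2 x
      constructor
      · intro x
        refine ⟨(b z).sub_mem (h1.1 x) ((b z).smul_mem _ ((b z).smul_mem _ (h1.1 v))), ?_⟩
        change φ z (P z x - (ψ z v)⁻¹ • ψ z x • P z v) = 0
        rw [map_sub, map_smul, map_smul, h4, h4, smul_eq_mul, smul_eq_mul]
        field_simp
        ring
      · rintro x ⟨hx, hx'⟩
        have h5 : ψ z x = 0 := by
          have := h4 x
          rw [h1.2 x hx] at this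
          have h6 : φ z x = 0 := hx'
          rw [h6] at this
          exact (mul_eq_zero.mp this.symm).resolve_left hc
        change P z x - (ψ z v)⁻¹ • ψ z x • P z v = x
        rw [h5, zero_smul, smul_zero, sub_zero, h1.2 x hx]

lemma MeroAt.inf_ker_of_finiteDimensional {b : ℂ → Submodule ℂ V} {z₀ : ℂ} (h : MeroAt b z₀)
    {V' : Type*} [NormedAddCommGroup V'] [NormedSpace ℂ V'] [FiniteDimensional ℂ V']
    {R : ℂ → V →L[ℂ] V'} (hR : AnalyticAt ℂ R z₀) :
    MeroAt (fun z => b z ⊓ LinearMap.ker (R z : V →ₗ[ℂ] V')) z₀ := by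
  classical
  let β := Module.finBasis ℂ V'
  have key : ∀ s : Finset (Fin (Module.finrank ℂ V')),
      MeroAt (fun z => b z ⊓ ⨅ i ∈ s, LinearMap.ker
        (((LinearMap.toContinuousLinearMap (β.coord i)).comp (R z) : V →L[ℂ] ℂ) : V →ₗ[ℂ] ℂ))
        z₀ := by
    intro s
    induction s using Finset.induction_on with
    | empty => simpa using h
    | insert i s hi ih =>
      have := ih.inf_ker (φ := fun z => (LinearMap.toContinuousLinearMap (β.coord i)).comp (R z))
        (AnalyticAt.op_comp analyticAt_const hR)
      convert this using 2 with z
      rw [Finset.iInf_insert, inf_assoc, inf_comm (LinearMap.ker _)]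
  convert key Finset.univ using 2 with z
  congr 1
  ext x
  simp only [LinearMap.mem_ker, Finset.mem_univ, iInf_pos, Submodule.mem_iInf]
  constructor
  · intro hx i
    change β.coord i (R z x) = 0
    have : R z x = 0 := hx
    rw [this, map_zero]
  · intro hx
    exact β.forall_coord_eq_zero_iff.mp hx

/-- The preimage of `b` under `A` is the kernel of the analytic family `(1 - P) A`. -/
lemma MeroAt.comap {b : ℂ → Submodule ℂ V} {z₀ : ℂ} (h : MeroAt b z₀) [FiniteDimensional ℂ V]
    (A : V →ₗ[ℂ] V) : MeroAt (fun z => (b z).comap A) z₀ := by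
  obtain ⟨P, hP, hb⟩ := h
  have h1 : MeroAt (fun _ => (⊤ : Submodule ℂ V)) z₀ :=
    ⟨fun _ => 1, analyticAt_const, Eventually.of_forall fun _ => ⟨fun _ => trivial, fun _ _ => rfl⟩⟩
  obtain ⟨P', hP', hb'⟩ := h1.inf_ker_of_finiteDimensional
    (R := fun z => (1 - P z).comp (LinearMap.toContinuousLinearMap A))
    (AnalyticAt.op_comp (analyticAt_const.sub hP) analyticAt_const)
  refine ⟨P', hP', ?_⟩
  filter_upwards [hb, hb'] with z h1 h2
  convert h2 using 1
  ext x
  rw [Submodule.mem_comap, h1.mem_iff, top_inf_eq, LinearMap.mem_ker]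
  change _ ↔ A x - P z (A x) = 0
  rw [sub_eq_zero, eq_comm]

/-- Dual to `MeroAt.inf_ker`. If `w - P w` is not identically zero, a power of `z - z₀` is removed
from it, leaving an analytic direction `u` with `u(z₀) ≠ 0`. A functional `ψ` with `ψ(u(z₀)) ≠ 0`
then serves to add the line spanned by `u` to the range of `P`. -/
lemma MeroAt.sup_span {b : ℂ → Submodule ℂ V} {z₀ : ℂ} (h : MeroAt b z₀) (w : V) :
    MeroAt (fun z => b z ⊔ Submodule.span ℂ {w}) z₀ := by
  obtain ⟨P, hP, hb⟩ := h
  have hf : AnalyticAt ℂ (fun z => w - P z w) z₀ :=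
    analyticAt_const.sub (AnalyticAt.op_apply hP analyticAt_const)
  rcases analyticAt_dichotomy hf with h0 | ⟨u, hu, hu0, h1⟩
  · refine ⟨P, hP, ?_⟩
    filter_upwards [hb, h0] with z h1 h2
    convert h1 using 1
    rw [sup_eq_left, Submodule.span_singleton_le_iff_mem, h1.mem_iff]
    exact (sub_eq_zero.mp h2).symm
  · obtain ⟨ψ, hψ⟩ : ∃ ψ : V →L[ℂ] ℂ, ψ (u z₀) ≠ 0 := SeparatingDual.exists_ne_zero hu0
    have hd : AnalyticAt ℂ (fun z => ψ (u z)) z₀ := AnalyticAt.op_apply analyticAt_const hu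
    refine ⟨fun z => P z + (ψ (u z))⁻¹ • (ψ.comp (1 - P z)).smulRight (u z), ?_, ?_⟩
    · refine hP.add ((hd.inv hψ).smul ?_)
      exact AnalyticAt.bilin (ContinuousLinearMap.smulRightL ℂ V V)
        (AnalyticAt.op_comp analyticAt_const (analyticAt_const.sub hP)) hu
    · filter_upwards [hb, h1, (hd.continuousAt.eventually_ne hψ).filter_mono nhdsWithin_le_nhds]
        with z h1 ⟨c, hc, h2⟩ h3
      have hu : u z = c⁻¹ • (w - P z w) := by rw [h2, inv_smul_smul₀ hc]
      have hw : w ∈ b z ⊔ Submodule.span ℂ {w} :=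
        Submodule.mem_sup_right (Submodule.mem_span_singleton_self w)
      have hum : u z ∈ b z ⊔ Submodule.span ℂ {w} := by
        rw [hu]
        exact Submodule.smul_mem _ _ (Submodule.sub_mem _ hw (Submodule.mem_sup_left (h1.1 w)))
      constructor
      · intro x
        exact Submodule.add_mem _ (Submodule.mem_sup_left (h1.1 x))
          (Submodule.smul_mem _ _ (Submodule.smul_mem _ _ hum))
      · intro x hx
        obtain ⟨y, hy, v, hv, rfl⟩ := Submodule.mem_sup.mp hx
        obtain ⟨t, rfl⟩ := Submodule.mem_span_singleton.mp hv
        change P z (y + t • w) + (ψ (u z))⁻¹ • ψ ((y + t • w) - P z (y + t • w)) • u z = _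
        have e : (y + t • w) - P z (y + t • w) = (t * c) • u z := by
          rw [map_add, map_smul, h1.2 y hy, mul_smul, ← h2, smul_sub]; abel
        rw [e, map_smul, smul_eq_mul, smul_smul, mul_comm, mul_assoc, mul_inv_cancel₀ h3, mul_one,
          ← e]
        abel

lemma MeroAt.sup {b : ℂ → Submodule ℂ V} {z₀ : ℂ} (h : MeroAt b z₀) [FiniteDimensional ℂ V]
    (J : Submodule ℂ V) : MeroAt (fun z => b z ⊔ J) z₀ := by
  have hJ : J.FG := IsNoetherian.noetherian J
  induction J, hJ using Submodule.fg_induction generalizing b with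
  | singleton w => exact h.sup_span w
  | sup J₁ J₂ _ _ ih₁ ih₂ =>
    have := ih₂ (ih₁ h)
    simpa only [sup_assoc] using this

end Idempotents

end

end UnitonTheory

namespace UnitonTheory

noncomputable section

variable {V : Type*} [NormedAddCommGroup V] [NormedSpace ℂ V]

/-! ### Holomorphy of smooth families of subspaces -/

lemma ringInverse_hasW [CompleteSpace V] {G : ℂ → V →L[ℂ] V} {a c : V →L[ℂ] V} {z : ℂ}
    (hG : HasW G a c z) (hu : IsUnit (G z)) :
    ∃ a' c', HasW (fun w => Ring.inverse (G w)) a' c' z := by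
  have h1 : DifferentiableAt ℂ (Ring.inverse : (V →L[ℂ] V) → V →L[ℂ] V) (G z) :=
    differentiableAt_inverse hu
  have h2 : DifferentiableAt ℝ (Ring.inverse : (V →L[ℂ] V) → V →L[ℂ] V) (G z) :=
    h1.restrictScalars ℝ
  have h3 : DifferentiableAt ℝ (Ring.inverse ∘ G) z := h2.comp z hG.differentiableAt
  exact ⟨_, _, hasW_of_differentiableAt h3⟩

/-- A smooth family of subspaces whose sections are preserved by `∂/∂z̄` is holomorphic. -/
lemma holAt_of_smooth [CompleteSpace V] {b : ℂ → Submodule ℂ V} {Q : ℂ → V →L[ℂ] V} {z₀ : ℂ}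
    (hQ : ∀ᶠ z in 𝓝 z₀, ∃ a c, HasW Q a c z) (hproj : ∀ᶠ z in 𝓝 z₀, ProjOnto (Q z) (b z))
    (hsec : ∀ᶠ z in 𝓝 z₀, ∀ v ∈ b z, ∃ σ a c, HasW σ a c z ∧ (∀ᶠ w in 𝓝 z, σ w ∈ b w) ∧
      σ z = v ∧ c ∈ b z) : HolAt b z₀ := by
  set Q₀ := Q z₀ with hQ₀
  have hQ₀₀ : Q₀ * Q₀ = Q₀ := hproj.self_of_nhds.mul_self
  -- `G` maps the range of `Q₀` to `b z` and fixes the kernel of `Q₀`, so `P = G Q₀ G⁻¹` is the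
  -- projection onto `b z` along the fixed complement `ker Q₀`. The auxiliary `K` satisfies `Q K = G
  -- Q₀`, and its invertibility shows that the range of `P` is all of `b z`.
  let G : ℂ → V →L[ℂ] V := fun z => Q z * Q₀ + (1 - Q₀)
  let K : ℂ → V →L[ℂ] V := fun z => Q z * Q₀ + (1 - Q z) * (1 - Q₀)
  have hcont : ContinuousAt Q z₀ := by
    obtain ⟨a, c, h⟩ := hQ.self_of_nhds
    exact h.continuousAt
  have hG0 : G z₀ = 1 := by simp only [G]; rw [← hQ₀, hQ₀₀]; abel
  have hK0 : K z₀ = 1 := by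
    simp only [K]; rw [← hQ₀, sub_mul, one_mul, mul_sub, mul_one, hQ₀₀]; abel
  have hGu : ∀ᶠ z in 𝓝 z₀, IsUnit (G z) := by
    have : ContinuousAt G z₀ := (hcont.mul continuousAt_const).add continuousAt_const
    exact this.eventually (Units.isOpen.mem_nhds (by rw [hG0]; exact isUnit_one))
  have hKu : ∀ᶠ z in 𝓝 z₀, IsUnit (K z) := by
    have : ContinuousAt K z₀ :=
      (hcont.mul continuousAt_const).add ((continuousAt_const.sub hcont).mul continuousAt_const)
    exact this.eventually (Units.isOpen.mem_nhds (by rw [hK0]; exact isUnit_one))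
  let P : ℂ → V →L[ℂ] V := fun z => G z * Q₀ * Ring.inverse (G z)
  have hGQ : ∀ z, G z * Q₀ = Q z * Q₀ := by
    intro z; simp only [G]; rw [add_mul, mul_assoc, hQ₀₀, sub_mul, one_mul, hQ₀₀]; abel
  have hP : ∀ᶠ z in 𝓝 z₀, ProjOnto (P z) (b z) ∧ P z * (1 - Q₀) = 0 ∧ Q₀ * (1 - P z) = 0 := by
    filter_upwards [hproj, hGu, hKu] with z h1 h2 h3
    have hGG := Ring.inverse_mul_cancel (G z) h2
    have hGG' := Ring.mul_inverse_cancel (G z) h2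
    have hG1 : G z * (1 - Q₀) = 1 - Q₀ := by
      rw [mul_sub, mul_one, hGQ]; simp only [G]; abel
    refine ⟨⟨fun x => ?_, fun v hv => ?_⟩, ?_, ?_⟩
    · simp only [P]; rw [hGQ]; exact h1.1 _
    · have hQK : Q z * K z = G z * Q₀ := by
        rw [hGQ]
        simp only [K]
        have h0 : Q z * (1 - Q z) = 0 := by rw [mul_sub, mul_one, h1.mul_self, sub_self]
        rw [mul_add, ← mul_assoc, ← mul_assoc, h0, h1.mul_self, zero_mul, add_zero]
      have e : v = (G z * Q₀ * Ring.inverse (K z)) v := by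
        rw [← hQK, mul_assoc, Ring.mul_inverse_cancel _ h3, mul_one, h1.2 v hv]
      have e2 : P z * (G z * Q₀ * Ring.inverse (K z)) = G z * Q₀ * Ring.inverse (K z) := by
        simp only [P]
        calc G z * Q₀ * Ring.inverse (G z) * (G z * Q₀ * Ring.inverse (K z))
            = G z * Q₀ * (Ring.inverse (G z) * G z) * Q₀ * Ring.inverse (K z) := by noncomm_ring
          _ = G z * (Q₀ * Q₀) * Ring.inverse (K z) := by rw [hGG]; noncomm_ring
          _ = _ := by rw [hQ₀₀]
      have e3 := DFunLike.congr_fun e2 v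
      rw [mul_apply_eq_comp, ← e] at e3
      exact e3
    · simp only [P]
      have : Ring.inverse (G z) * (1 - Q₀) = 1 - Q₀ := by
        conv_lhs => rw [← hG1]
        rw [← mul_assoc, hGG, one_mul]
      rw [mul_assoc, this, mul_assoc, mul_sub, mul_one, hQ₀₀, sub_self, mul_zero]
    · have : 1 - P z = G z * (1 - Q₀) * Ring.inverse (G z) := by
        simp only [P]
        rw [mul_sub, sub_mul, mul_one, hGG']
      rw [this, hG1, ← mul_assoc, mul_sub, mul_one, hQ₀₀, sub_self, zero_mul]
  have hPW : ∀ᶠ z in 𝓝 z₀, ∃ a, HasW P a 0 z := by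
    filter_upwards [hP.eventually_nhds, hQ, hGu, hsec] with z h1 ⟨a, c, h2⟩ h3 h4
    have hGW : HasW G _ _ z := (h2.mul (hasW_const Q₀ z)).add (hasW_const (1 - Q₀) z)
    obtain ⟨a', c', hI⟩ := ringInverse_hasW hGW h3
    obtain ⟨pa, pc, hPz⟩ : ∃ pa pc, HasW P pa pc z :=
      ⟨_, _, (hGW.mul (hasW_const Q₀ z)).mul hI⟩
    refine ⟨pa, ?_⟩
    -- The derivative `∂P/∂z̄` vanishes on `ker Q₀`, where `P` is constantly zero. It vanishes on `b
    -- z` by differentiating `P σ = σ` for a section `σ` with `∂σ/∂z̄ ∈ b z`. These two spaces span,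
    -- so `P` is analytic.
    have hc1 : pc * (1 - Q₀) = 0 := by
      have e1 := hPz.mul (hasW_const (1 - Q₀) z)
      have e2 : HasW (fun w => P w * (1 - Q₀)) 0 0 z :=
        (hasW_const (0 : V →L[ℂ] V) z).congr (h1.mono fun w hw => hw.2.1)
      have := (e1.unique e2).2
      rwa [mul_zero, add_zero] at this
    have hc2 : ∀ v ∈ b z, pc v = 0 := by
      intro v hv
      obtain ⟨σ, sa, sc, hσ, hσb, hσv, hsc⟩ := h4 v hv
      have e1 := hPz.clm_apply hσ
      have e2 : (fun w => P w (σ w)) =ᶠ[𝓝 z] σ := by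
        filter_upwards [h1, hσb] with w hw hw'
        exact hw.1.2 _ hw'
      have := (e1.unique (hσ.congr e2)).2
      rw [h1.self_of_nhds.1.2 _ hsc, hσv] at this
      exact add_eq_right.mp this
    have hc : pc = 0 := by
      ext1 x
      have e1 : x = P z x + (1 - Q₀) ((1 - P z) x) := by
        have := DFunLike.congr_fun h1.self_of_nhds.2.2 x
        rw [mul_apply_eq_comp, zero_apply] at this
        rw [sub_apply (1 : V →L[ℂ] V) Q₀, this]
        simp
      rw [e1, map_add, hc2 _ (h1.self_of_nhds.1.1 x), ← mul_apply_eq_comp, hc1]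
      simp
    rw [← hc]
    exact hPz
  refine ⟨P, ?_, hP.mono fun z hz => hz.1⟩
  rw [Complex.analyticAt_iff_eventually_differentiableAt]
  filter_upwards [hPW] with z ⟨a, ha⟩
  exact ha.hasDerivAt.differentiableAt

/-! ### Families closed under a multiple of the derivative -/

/-- For all local sections `σ` of `b`, the vector `N ∂σ/∂z` lies in `b` at `z₀`. -/
def DCAt (N : V →L[ℂ] V) (b : ℂ → Submodule ℂ V) (z₀ : ℂ) : Prop :=
  ∀ σ a c, HasW σ a c z₀ → (∀ᶠ z in 𝓝 z₀, σ z ∈ b z) → N a ∈ b z₀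

variable {N : V →L[ℂ] V} {b : ℂ → Submodule ℂ V} {z₀ : ℂ}

lemma DCAt.congr {b' : ℂ → Submodule ℂ V} (h : DCAt N b z₀) (hb : b' =ᶠ[𝓝 z₀] b) :
    DCAt N b' z₀ := by
  intro σ a c hσ hσb
  rw [hb.self_of_nhds]
  refine h σ a c hσ ?_
  filter_upwards [hσb, hb] with z h1 h2
  rwa [← h2]

/-- For an analytic projection `P`, the equation `P σ = σ` gives `P (∂σ/∂z̄) = ∂σ/∂z̄`. -/
lemma HolAt.dzbar_mem (h : HolAt b z₀) {σ : ℂ → V} {a c : V} (hσ : HasW σ a c z₀)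
    (hσb : ∀ᶠ z in 𝓝 z₀, σ z ∈ b z) : c ∈ b z₀ := by
  obtain ⟨P, hP, hb⟩ := h
  have e1 := (hasW_of_hasDerivAt hP.differentiableAt.hasDerivAt).clm_apply hσ
  have e2 : (fun w => P w (σ w)) =ᶠ[𝓝 z₀] σ := by
    filter_upwards [hb, hσb] with w hw hw'
    exact hw.2 _ hw'
  have := (e1.unique (hσ.congr e2)).2
  rw [zero_apply, zero_add] at this
  exact hb.self_of_nhds.mem_iff.mpr this

lemma hasW_idempotent_apply {P : ℂ → V →L[ℂ] V} {z : ℂ} (hP : AnalyticAt ℂ P z) (v : V) :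
    HasW (fun w => P w v) (deriv P z v) 0 z := by
  simpa using (hasW_of_hasDerivAt hP.differentiableAt.hasDerivAt).clm_apply (hasW_const v z)

/-- From `σ = P σ` one has `∂σ = (∂P) σ + P ∂σ`. As `N` preserves `b`, only the first term has to be
controlled. -/
lemma dcAt_of_deriv {P : ℂ → V →L[ℂ] V} (hP : AnalyticAt ℂ P z₀)
    (hb : ∀ᶠ z in 𝓝 z₀, ProjOnto (P z) (b z)) (hN : ∀ x ∈ b z₀, N x ∈ b z₀)
    (hd : ∀ v ∈ b z₀, N (deriv P z₀ v) ∈ b z₀) : DCAt N b z₀ := by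
  intro σ a c hσ hσb
  have e1 := (hasW_of_hasDerivAt hP.differentiableAt.hasDerivAt).clm_apply hσ
  have e2 : (fun w => P w (σ w)) =ᶠ[𝓝 z₀] σ := by
    filter_upwards [hb, hσb] with w hw hw'
    exact hw.2 _ hw'
  have := (e1.unique (hσ.congr e2)).1
  rw [← this, map_add]
  exact Submodule.add_mem _ (hd _ hσb.self_of_nhds) (hN _ (hb.self_of_nhds.1 a))

lemma DCAt.deriv_mem {P : ℂ → V →L[ℂ] V} (h : DCAt N b z₀) (hP : AnalyticAt ℂ P z₀)
    (hb : ∀ᶠ z in 𝓝 z₀, ProjOnto (P z) (b z)) (v : V) : N (deriv P z₀ v) ∈ b z₀ :=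
  h _ _ _ (hasW_idempotent_apply hP v) (hb.mono fun _ hz => hz.1 v)

lemma eq_of_eventuallyEq_nhdsNE {X F : Type*} [TopologicalSpace X] [TopologicalSpace F] [T2Space F]
    {p : X} [(𝓝[≠] p).NeBot] {f g : X → F} (hf : ContinuousAt f p) (hg : ContinuousAt g p)
    (h : ∀ᶠ q in 𝓝[≠] p, f q = g q) : f p = g p :=
  tendsto_nhds_unique_of_eventuallyEq (hf.mono_left nhdsWithin_le_nhds)
    (hg.mono_left nhdsWithin_le_nhds) h

/-- In terms of an analytic projection the condition is `P N ∂P = N ∂P`, a closed condition that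
passes to the limit at `z₀`. -/
lemma dcAt_of_eventually [CompleteSpace V] (h : HolAt b z₀) (hN : ∀ x ∈ b z₀, N x ∈ b z₀)
    (hd : ∀ᶠ z in 𝓝[≠] z₀, DCAt N b z) : DCAt N b z₀ := by
  obtain ⟨P, hP, hb⟩ := h
  refine dcAt_of_deriv hP hb hN fun v _ => ?_
  rw [hb.self_of_nhds.mem_iff]
  have hP' : AnalyticAt ℂ (deriv P) z₀ := hP.deriv
  have hc : ContinuousAt (fun z => N (deriv P z v)) z₀ :=
    N.continuous.continuousAt.comp (AnalyticAt.op_apply hP' analyticAt_const).continuousAt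
  refine eq_of_eventuallyEq_nhdsNE (f := fun z => P z (N (deriv P z v))) ?_ hc ?_
  · exact hP.continuousAt.clm_apply hc
  · filter_upwards [hd, hb.eventually_nhds.filter_mono nhdsWithin_le_nhds,
      hP.eventually_analyticAt.filter_mono nhdsWithin_le_nhds] with z h1 h2 h3
    exact h2.self_of_nhds.2 _ (h1.deriv_mem h3 h2 v)

lemma DCAt.comap {A : V →L[ℂ] V} (hA : ∀ x, A (N x) = N (A x)) (h : DCAt N b z₀) :
    DCAt N (fun z => (b z).comap (A : V →ₗ[ℂ] V)) z₀ := by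
  intro σ a c hσ hσb
  change A (N a) ∈ b z₀
  rw [hA]
  exact h _ _ _ (hσ.clm A) hσb

/-- A vector `v = y + w` of `b + J` is the value at `z₀` of the section `P y + w`. Differentiating
`P'(P y + w) = P y + w` gives `(∂P') v = (∂P) y - P' (∂P) y`, and `N` maps both terms into `b + J`.
-/
lemma DCAt.sup [CompleteSpace V] {J : Submodule ℂ V} (h : DCAt N b z₀) (hb : HolAt b z₀)
    (hbJ : HolAt (fun z => b z ⊔ J) z₀) (hN : ∀ x ∈ b z₀, N x ∈ b z₀) (hJ : ∀ x ∈ J, N x ∈ J) :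
    DCAt N (fun z => b z ⊔ J) z₀ := by
  obtain ⟨P, hP, hb⟩ := hb
  obtain ⟨P', hP', hb'⟩ := hbJ
  have hN' : ∀ x ∈ b z₀ ⊔ J, N x ∈ b z₀ ⊔ J := by
    intro x hx
    obtain ⟨y, hy, w, hw, rfl⟩ := Submodule.mem_sup.mp hx
    rw [map_add]
    exact Submodule.add_mem_sup (hN y hy) (hJ w hw)
  refine dcAt_of_deriv hP' hb' hN' fun v hv => ?_
  obtain ⟨y, hy, w, hw, rfl⟩ := Submodule.mem_sup.mp hv
  have h1 : HasW (fun z => P z y + w) (deriv P z₀ y) 0 z₀ := by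
    simpa using (hasW_idempotent_apply hP y).add (hasW_const w z₀)
  have h2 := (hasW_of_hasDerivAt hP'.differentiableAt.hasDerivAt).clm_apply h1
  have e : (fun z => P' z (P z y + w)) =ᶠ[𝓝 z₀] fun z => P z y + w := by
    filter_upwards [hb, hb'] with z hz hz'
    exact hz'.2 _ (Submodule.add_mem_sup (hz.1 y) hw)
  have h3 := (h2.unique (h1.congr e)).1
  have h4 : P z₀ y = y := hb.self_of_nhds.2 y hy
  rw [h4] at h3
  rw [eq_sub_of_add_eq h3, map_sub]
  refine Submodule.sub_mem _ (Submodule.mem_sup_left (h.deriv_mem hP hb y)) ?_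
  exact hN' _ (hb'.self_of_nhds.1 _)

/-! ### Orthogonal projections -/

/-- If `P x + P⁎ x = x`, applying `P` gives `P P⁎ x = 0`. Hence `P⁎ x = 0` and `x = P x`, so `⟨x, x⟩
= ⟨x, P⁎ x⟩ = 0`. -/
lemma isUnit_add_star_sub_one {n : ℕ} {P : End n} (hP : P * P = P) :
    IsUnit (P + star P - 1) := by
  rw [ContinuousLinearMap.isUnit_iff_bijective]
  have hinj : Function.Injective (P + star P - 1 : End n) := by
    rw [injective_iff_map_eq_zero]
    intro x hx
    have h1 : P x + star P x - x = 0 := hx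
    have h2 : P (star P x) = 0 := by
      have := congrArg P h1
      rw [map_sub, map_add, map_zero, ← mul_apply_eq_comp, hP] at this
      simpa using this
    have h3 : star P x = 0 := by
      rw [← inner_self_eq_zero (𝕜 := ℂ)]
      nth_rewrite 1 [ContinuousLinearMap.star_eq_adjoint]
      rw [ContinuousLinearMap.adjoint_inner_left, h2, inner_zero_right]
    rw [h3, add_zero, sub_eq_zero] at h1
    rw [← inner_self_eq_zero (𝕜 := ℂ)]
    nth_rewrite 1 [← h1]
    rw [← ContinuousLinearMap.adjoint_inner_right, ← ContinuousLinearMap.star_eq_adjoint, h3,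
      inner_zero_right]
  exact ⟨hinj, LinearMap.surjective_of_injective (f := ((P + star P - 1 : End n) : E n →ₗ[ℂ] E n))
    hinj⟩

/-- For the orthogonal projection `π` with the same range, `π P = P`, and `P π = π` gives `π P⁎ =
π`. Hence `π (P + P⁎ - 1) = P`. The formula shows that `π` depends smoothly on `P`. -/
lemma proj_eq_of_projOnto {n : ℕ} {P : End n} {U : Submodule ℂ (E n)} (h : ProjOnto P U) :
    proj U = P * Ring.inverse (P + star P - 1) := by
  have h1 : proj U * P = P := by
    ext1 x; exact proj_eq_self_iff.mpr (h.1 x)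
  have h2 : P * proj U = proj U := by
    ext1 x; exact h.2 _ (proj_mem U x)
  have h3 : proj U * star P = proj U := by
    have := congrArg star h2
    rwa [star_mul, star_proj] at this
  have h4 : proj U * (P + star P - 1) = P := by
    rw [mul_sub, mul_add, h1, h3, mul_one, add_sub_cancel_right]
  conv_rhs => enter [1]; rw [← h4]
  rw [mul_assoc, Ring.mul_inverse_cancel _ (isUnit_add_star_sub_one h.mul_self), mul_one]

lemma contDiff_star_op {n : ℕ} : ContDiff ℝ ∞ (star : End n → End n) :=
  (starL' ℝ : End n ≃L[ℝ] End n).contDiff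

lemma contDiffAt_proj {n : ℕ} {P : ℂ → End n} {U : ℂ → Submodule ℂ (E n)} {z : ℂ}
    (hP : ContDiffAt ℝ ∞ P z) (h : ∀ᶠ w in 𝓝 z, ProjOnto (P w) (U w)) :
    ContDiffAt ℝ ∞ (fun w => proj (U w)) z := by
  have hmul : ContDiff ℝ ∞ (fun x : End n × End n => x.1 * x.2) :=
    (contDiff_mul (𝕜 := ℂ)).restrict_scalars ℝ
  have hu := isUnit_add_star_sub_one h.self_of_nhds.mul_self
  have hinv : ContDiffAt ℝ ∞ (Ring.inverse : End n → End n) (P z + star (P z) - 1) :=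
    (contDiffAt_ringInverse ℂ hu.unit).restrict_scalars ℝ
  have hS : ContDiffAt ℝ ∞ (fun w => P w + star (P w) - 1) z :=
    (hP.add (contDiff_star_op.contDiffAt.comp z hP)).sub contDiffAt_const
  have hI : ContDiffAt ℝ ∞
      ((Ring.inverse : End n → End n) ∘ fun w => P w + star (P w) - 1) z :=
    ContDiffAt.comp z hinv hS
  have := hmul.contDiffAt.comp z (hP.prodMk hI)
  refine this.congr_of_eventuallyEq ?_
  filter_upwards [h] with w hw
  exact proj_eq_of_projOnto hw

end

end UnitonTheory

namespace UnitonTheory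

noncomputable section

variable {V : Type*} [NormedAddCommGroup V] [NormedSpace ℂ V]

/-! ### Limits of analytic families of subspaces -/

lemma exists_projOnto [FiniteDimensional ℂ V] (J : Submodule ℂ V) :
    ∃ P : V →L[ℂ] V, ProjOnto P J := by
  obtain ⟨p, hp⟩ := LinearMap.exists_leftInverse_of_injective J.subtype J.ker_subtype
  refine ⟨LinearMap.toContinuousLinearMap (J.subtype ∘ₗ p), fun x => (p x).2, fun x hx => ?_⟩
  exact congrArg Subtype.val (DFunLike.congr_fun hp ⟨x, hx⟩)

lemma HolAt.const [FiniteDimensional ℂ V] (J : Submodule ℂ V) (z₀ : ℂ) :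
    HolAt (fun _ => J) z₀ := by
  obtain ⟨P, hP⟩ := exists_projOnto J
  exact ⟨fun _ => P, analyticAt_const, Eventually.of_forall fun _ => hP⟩

lemma MeroAt.inf [FiniteDimensional ℂ V] {b : ℂ → Submodule ℂ V} {z₀ : ℂ} (h : MeroAt b z₀)
    (J : Submodule ℂ V) : MeroAt (fun z => b z ⊓ J) z₀ := by
  obtain ⟨P, hP⟩ := exists_projOnto J
  have := h.inf_ker_of_finiteDimensional (R := fun _ => 1 - P) analyticAt_const
  convert this using 3 with z
  ext x
  rw [hP.mem_iff]
  change _ ↔ x - P x = 0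
  rw [sub_eq_zero, eq_comm]

/-- The inclusion is the identity `P₂ A P₁ = A P₁` between continuous families, so it extends from a
punctured neighbourhood to `z₀`. -/
lemma HolAt.map_mem {b₁ b₂ : ℂ → Submodule ℂ V} {z₀ : ℂ} (h₁ : HolAt b₁ z₀) (h₂ : HolAt b₂ z₀)
    (A : V →L[ℂ] V) (h : ∀ᶠ z in 𝓝[≠] z₀, ∀ x ∈ b₁ z, A x ∈ b₂ z) :
    ∀ x ∈ b₁ z₀, A x ∈ b₂ z₀ := by
  obtain ⟨P₁, hP₁, hb₁⟩ := h₁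
  obtain ⟨P₂, hP₂, hb₂⟩ := h₂
  intro x hx
  have h1 : ContinuousAt (fun z => A (P₁ z x)) z₀ :=
    A.continuous.continuousAt.comp (hP₁.continuousAt.clm_apply continuousAt_const)
  have h2 : ContinuousAt (fun z => P₂ z (A (P₁ z x))) z₀ := hP₂.continuousAt.clm_apply h1
  have := eq_of_eventuallyEq_nhdsNE h2 h1 (by
    filter_upwards [h, hb₁.filter_mono nhdsWithin_le_nhds,
      hb₂.filter_mono nhdsWithin_le_nhds] with z hz hz1 hz2
    exact hz2.2 _ (hz _ (hz1.1 x)))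
  rw [hb₁.self_of_nhds.2 x hx] at this
  exact hb₂.self_of_nhds.mem_iff.mpr this

lemma HolAt.comp {b : ℂ → Submodule ℂ V} {t : ℂ → ℂ} {z₀ : ℂ} (h : HolAt b (t z₀))
    (ht : AnalyticAt ℂ t z₀) : HolAt (fun z => b (t z)) z₀ := by
  obtain ⟨P, hP, hb⟩ := h
  exact ⟨fun z => P (t z), hP.comp ht, ht.continuousAt.eventually hb⟩

/-! ### Charts -/

section Charts

set_option linter.unusedSectionVars false

variable {M : Type*} [TopologicalSpace M] [ChartedSpace ℂ M]

/-- The holomorphic charts. -/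
abbrev holCharts (M : Type*) [TopologicalSpace M] [ChartedSpace ℂ M] :
    Set (OpenPartialHomeomorph M ℂ) := IsManifold.maximalAtlas 𝓘(ℂ, ℂ) ω M

lemma eventually_codiscrete_iff {X : Type*} [TopologicalSpace X] {Q : X → Prop} :
    (∀ᶠ p in codiscrete X, Q p) ↔ ∀ p, ∀ᶠ q in 𝓝[≠] p, Q q := by
  change {p | Q p} ∈ codiscrete X ↔ _
  rw [mem_codiscrete]
  refine forall_congr' fun p => ?_
  rw [disjoint_principal_right, compl_compl]
  rfl

lemma eventually_nhdsNE_chart {e : OpenPartialHomeomorph M ℂ} {p : M} (hp : p ∈ e.source)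
    (Q : M → Prop) : (∀ᶠ z in 𝓝[≠] (e p), Q (e.symm z)) ↔ ∀ᶠ q in 𝓝[≠] p, Q q := by
  rw [eventually_nhdsWithin_iff, eventually_nhdsWithin_iff,
    ← e.eventually_nhds' (fun q => q ∈ ({p}ᶜ : Set M) → Q q) hp]
  refine eventually_congr ?_
  filter_upwards [e.open_target.mem_nhds (e.map_source hp)] with z hz
  refine imp_congr_left ?_
  simp only [mem_compl_iff, mem_singleton_iff, not_iff_not]
  constructor
  · rintro rfl; exact e.left_inv hp
  · rintro h; rw [← h, e.right_inv hz]

lemma nhdsNE_neBot (p : M) : (𝓝[≠] p).NeBot := by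
  rw [neBot_iff]
  intro h
  have h1 : ∀ᶠ q in 𝓝[≠] p, False := by rw [h]; exact trivial
  rw [← eventually_nhdsNE_chart (mem_chart_source ℂ p) (fun _ => False)] at h1
  exact h1.exists.elim fun _ h => h

lemma eventually_nhdsNE_nhds [T1Space M] {p : M} {Q : M → Prop} (h : ∀ᶠ q in 𝓝[≠] p, Q q) :
    ∀ᶠ q in 𝓝[≠] p, ∀ᶠ q' in 𝓝 q, Q q' := by
  filter_upwards [eventually_eventually_nhdsWithin.mpr h, self_mem_nhdsWithin] with z h1 h2
  rwa [(isOpen_compl_singleton.nhdsWithin_eq h2)] at h1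

lemma eventually_codiscrete_nhds [T1Space M] {Q : M → Prop} (h : ∀ᶠ q in codiscrete M, Q q) :
    ∀ᶠ q in codiscrete M, ∀ᶠ q' in 𝓝 q, Q q' := by
  rw [eventually_codiscrete_iff] at h ⊢
  exact fun p => eventually_nhdsNE_nhds (h p)

variable [IsManifold 𝓘(ℂ, ℂ) ω M]

lemma chartAt_mem_holCharts (p : M) : chartAt ℂ p ∈ holCharts M :=
  IsManifold.chart_mem_maximalAtlas p

lemma analyticAt_transition {e e' : OpenPartialHomeomorph M ℂ} (he : e ∈ holCharts M)
    (he' : e' ∈ holCharts M) {p : M} (hp : p ∈ e.source) (hp' : p ∈ e'.source) :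
    AnalyticAt ℂ (e ∘ e'.symm) (e' p) := by
  have h1 : ContMDiffAt 𝓘(ℂ, ℂ) 𝓘(ℂ, ℂ) ω (e ∘ e'.symm) (e' p) := by
    refine ContMDiffAt.comp (I' := 𝓘(ℂ, ℂ)) (M' := M) (e' p) ?_ ?_
    · rw [e'.left_inv hp']
      exact contMDiffAt_of_mem_maximalAtlas he hp
    · exact contMDiffAt_symm_of_mem_maximalAtlas he' (e'.map_source hp')
  exact h1.contDiffAt.analyticAt

lemma contDiffGroupoid_complex_le :
    contDiffGroupoid ω 𝓘(ℂ, ℂ) ≤ contDiffGroupoid ∞ 𝓘(ℝ, ℂ) := by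
  rw [contDiffGroupoid, contDiffGroupoid]
  apply groupoid_of_pregroupoid_le
  intro f s hf
  exact (ContDiffOn.of_le (n := ω) hf (by simp)).restrict_scalars ℝ

lemma mem_real_maximalAtlas {e : OpenPartialHomeomorph M ℂ} (he : e ∈ holCharts M) :
    e ∈ IsManifold.maximalAtlas 𝓘(ℝ, ℂ) ∞ M :=
  StructureGroupoid.maximalAtlas_mono contDiffGroupoid_complex_le he

lemma contMDiffAt_iff_chart {F : Type*} [NormedAddCommGroup F] [NormedSpace ℝ F] {f : M → F}
    {e : OpenPartialHomeomorph M ℂ} (he : e ∈ holCharts M) {p : M} (hp : p ∈ e.source) :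
    ContMDiffAt 𝓘(ℝ, ℂ) 𝓘(ℝ, F) ∞ f p ↔ ContDiffAt ℝ ∞ (f ∘ e.symm) (e p) := by
  constructor
  · intro h
    have : ContMDiffAt 𝓘(ℝ, ℂ) 𝓘(ℝ, F) ∞ (f ∘ e.symm) (e p) := by
      refine ContMDiffAt.comp (I' := 𝓘(ℝ, ℂ)) (M' := M) (e p) ?_ ?_
      · rwa [e.left_inv hp]
      · exact contMDiffAt_symm_of_mem_maximalAtlas (mem_real_maximalAtlas he) (e.map_source hp)
    exact this.contDiffAt
  · intro h
    have h1 : ContMDiffAt 𝓘(ℝ, ℂ) 𝓘(ℝ, F) ∞ ((f ∘ e.symm) ∘ e) p :=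
      ContMDiffAt.comp (I' := 𝓘(ℝ, ℂ)) p h.contMDiffAt
        (contMDiffAt_of_mem_maximalAtlas (mem_real_maximalAtlas he) hp)
    refine h1.congr_of_eventuallyEq ?_
    filter_upwards [e.open_source.mem_nhds hp] with q hq
    simp [e.left_inv hq]

lemma smoothMap_iff_chart {F : Type*} [NormedAddCommGroup F] [NormedSpace ℝ F] {f : M → F} :
    SmoothMap f ↔ ∀ e ∈ holCharts M, ∀ p ∈ e.source, ContDiffAt ℝ ∞ (f ∘ e.symm) (e p) :=
  ⟨fun h _ he p hp => (contMDiffAt_iff_chart he hp).mp (h p), fun h p =>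
    (contMDiffAt_iff_chart (chartAt_mem_holCharts p) (mem_chart_source ℂ p)).mpr
      (h _ (chartAt_mem_holCharts p) p (mem_chart_source ℂ p))⟩

/-! ### Bundles -/

/-- Subbundles of a trivial bundle that are holomorphic off a discrete set, with analytic
continuation. -/
def MeroBundle (B : M → Submodule ℂ V) : Prop :=
  ∀ e ∈ holCharts M, ∀ p ∈ e.source, MeroAt (fun z => B (e.symm z)) (e p)

/-- Holomorphic subbundles of a trivial bundle. -/
def HolBundle (B : M → Submodule ℂ V) : Prop :=
  ∀ e ∈ holCharts M, ∀ p ∈ e.source, HolAt (fun z => B (e.symm z)) (e p)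

/-- `N ∂/∂z` preserves the sections of `B`. -/
def DClosed (N : V →L[ℂ] V) (B : M → Submodule ℂ V) : Prop :=
  ∀ e ∈ holCharts M, ∀ p ∈ e.source, DCAt N (fun z => B (e.symm z)) (e p)

lemma HolBundle.meroBundle {B : M → Submodule ℂ V} (h : HolBundle B) : MeroBundle B :=
  fun e he p hp => (h e he p hp).meroAt

lemma HolAt.change_chart {B : M → Submodule ℂ V} {e e' : OpenPartialHomeomorph M ℂ}
    (he : e ∈ holCharts M) (he' : e' ∈ holCharts M) {p : M} (hp : p ∈ e.source)
    (hp' : p ∈ e'.source) (h : HolAt (fun z => B (e.symm z)) (e p)) :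
    HolAt (fun z => B (e'.symm z)) (e' p) := by
  have h1 : HolAt (fun z => B (e.symm ((e ∘ e'.symm) z))) (e' p) := by
    refine HolAt.comp (b := fun z => B (e.symm z)) ?_ (analyticAt_transition he he' hp hp')
    simpa [e'.left_inv hp'] using h
  refine h1.congr ?_
  have : ∀ᶠ z in 𝓝 (e' p), e'.symm z ∈ e.source :=
    (e'.eventually_nhds' (fun q => q ∈ e.source) hp').mpr (e.open_source.mem_nhds hp)
  filter_upwards [this] with z hz
  simp [e.left_inv hz]

lemma holBundle_of_chartAt {B : M → Submodule ℂ V}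
    (h : ∀ p, HolAt (fun z => B ((chartAt ℂ p).symm z)) (chartAt ℂ p p)) : HolBundle B :=
  fun _ he p hp => (h p).change_chart (chartAt_mem_holCharts p) he (mem_chart_source ℂ p) hp

lemma eventually_mem_source {e : OpenPartialHomeomorph M ℂ} {p : M} (hp : p ∈ e.source) :
    ∀ᶠ q in 𝓝 p, q ∈ e.source := e.open_source.mem_nhds hp

/-- The value at `p` is the range at `p` of the analytic family of idempotents around `p`. Families
centred at different points have the same range on punctured neighbourhoods, and by continuity also
at the centre, so the values fit together to a holomorphic bundle. -/
lemma exists_fill [T1Space M] {B : M → Submodule ℂ V} (h : MeroBundle B) :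
    ∃ B' : M → Submodule ℂ V, HolBundle B' ∧ ∀ᶠ p in codiscrete M, B' p = B p := by
  choose P hP hb using fun p => h _ (chartAt_mem_holCharts p) p (mem_chart_source ℂ p)
  set R : M → M → V →L[ℂ] V := fun p q => P p (chartAt ℂ p q) with hR
  have hcont : ∀ p, ∀ᶠ q in 𝓝 p, ContinuousAt (R p) q := by
    intro p
    have h1 : ∀ᶠ z in 𝓝 (chartAt ℂ p p), ContinuousAt (P p) z :=
      (hP p).eventually_continuousAt
    have h2 := ((chartAt ℂ p).continuousAt (mem_chart_source ℂ p)).eventually h1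
    filter_upwards [h2, eventually_mem_source (mem_chart_source ℂ p)] with q hq hq'
    exact ContinuousAt.comp (g := P p) hq ((chartAt ℂ p).continuousAt hq')
  have hpr : ∀ p, ∀ᶠ q in 𝓝[≠] p, ProjOnto (R p q) (B q) := by
    intro p
    have h1 : ∀ᶠ z in 𝓝[≠] (chartAt ℂ p p), ProjOnto (R p ((chartAt ℂ p).symm z))
        (B ((chartAt ℂ p).symm z)) := by
      filter_upwards [hb p, mem_nhdsWithin_of_mem_nhds ((chartAt ℂ p).open_target.mem_nhds
        ((chartAt ℂ p).map_source (mem_chart_source ℂ p)))]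
        with z hz hz'
      simpa [hR, (chartAt ℂ p).right_inv hz'] using hz
    exact (eventually_nhdsNE_chart (mem_chart_source ℂ p) (fun q => ProjOnto (R p q) (B q))).mp h1
  -- For idempotents, equality of ranges is equivalent to `R R' = R'` and `R' R = R`, which are
  -- closed conditions.
  have hmul : ∀ p p' q, ContinuousAt (R p) q → ContinuousAt (R p') q →
      (∀ᶠ q' in 𝓝[≠] q, ProjOnto (R p q') (B q')) → (∀ᶠ q' in 𝓝[≠] q, ProjOnto (R p' q') (B q')) →
      R p q * R p' q = R p' q := by
    intro p p' q h1 h2 h3 h4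
    have := nhdsNE_neBot q
    refine eq_of_eventuallyEq_nhdsNE (f := fun q => R p q * R p' q) (h1.mul h2) h2 ?_
    filter_upwards [h3, h4] with q' h5 h6
    ext1 x
    exact h5.2 _ (h6.1 x)
  have hself : ∀ p, R p p * R p p = R p p := fun p =>
    hmul p p p (hcont p).self_of_nhds (hcont p).self_of_nhds (hpr p) (hpr p)
  refine ⟨fun p => LinearMap.range (R p p : V →ₗ[ℂ] V), holBundle_of_chartAt fun p => ?_, ?_⟩
  · refine ⟨P p, hP p, ?_⟩
    have key : ∀ᶠ q in 𝓝 p, ProjOnto (R p q) (LinearMap.range (R q q : V →ₗ[ℂ] V)) := by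
      have h1 := eventually_nhdsNE_nhds (hpr p)
      rw [eventually_nhdsWithin_iff] at h1
      filter_upwards [h1, hcont p] with q hq hq'
      by_cases hqp : q = p
      · rw [hqp]; exact projOnto_range (hself p)
      · have h2 := (hq hqp).filter_mono (nhdsWithin_le_nhds (s := {q}ᶜ))
        have hqq := (hcont q).self_of_nhds
        exact (projOnto_range (hself q)).congr (hmul q p q hqq hq' (hpr q) h2)
          (hmul p q q hq' hqq h2 (hpr q))
    have h2 := ((chartAt ℂ p).eventually_nhds' _ (mem_chart_source ℂ p)).mpr key
    filter_upwards [h2, ((chartAt ℂ p).open_target.mem_nhds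
        ((chartAt ℂ p).map_source (mem_chart_source ℂ p)))] with z hz hz'
    simpa [hR, (chartAt ℂ p).right_inv hz'] using hz
  · rw [eventually_codiscrete_iff]
    intro p
    have h1 := eventually_nhdsNE_nhds (hpr p)
    filter_upwards [h1, (hcont p).filter_mono nhdsWithin_le_nhds] with q hq hq'
    have h2 := hq.filter_mono (nhdsWithin_le_nhds (s := {q}ᶜ))
    have hqq := (hcont q).self_of_nhds
    have h3 : ProjOnto (R q q) (B q) := hq.self_of_nhds.congr (hmul p q q hq' hqq h2 (hpr q))
      (hmul q p q hqq hq' (hpr q) h2)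
    ext x
    rw [h3.mem_iff, (projOnto_range (hself q)).mem_iff]

lemma HolBundle.map_mem {B₁ B₂ : M → Submodule ℂ V} (h₁ : HolBundle B₁) (h₂ : HolBundle B₂)
    (A : V →L[ℂ] V) (h : ∀ᶠ p in codiscrete M, ∀ x ∈ B₁ p, A x ∈ B₂ p) (p : M) :
    ∀ x ∈ B₁ p, A x ∈ B₂ p := by
  have hp := mem_chart_source ℂ p
  have := (h₁ _ (chartAt_mem_holCharts p) p hp).map_mem (h₂ _ (chartAt_mem_holCharts p) p hp) A
    ((eventually_nhdsNE_chart hp (fun q => ∀ x ∈ B₁ q, A x ∈ B₂ q)).mpr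
      (eventually_codiscrete_iff.mp h p))
  simpa [(chartAt ℂ p).left_inv hp] using this

lemma HolBundle.le {B₁ B₂ : M → Submodule ℂ V} (h₁ : HolBundle B₁) (h₂ : HolBundle B₂)
    (h : ∀ᶠ p in codiscrete M, B₁ p ≤ B₂ p) (p : M) : B₁ p ≤ B₂ p :=
  h₁.map_mem h₂ 1 h p

lemma HolBundle.eq {B₁ B₂ : M → Submodule ℂ V} (h₁ : HolBundle B₁) (h₂ : HolBundle B₂)
    (h : ∀ᶠ p in codiscrete M, B₁ p = B₂ p) : B₁ = B₂ :=
  funext fun p => le_antisymm (h₁.le h₂ (h.mono fun _ h => h.le) p)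
    (h₂.le h₁ (h.mono fun _ h => h.ge) p)

lemma HolBundle.const [FiniteDimensional ℂ V] (J : Submodule ℂ V) : HolBundle (fun _ : M => J) :=
  fun e _ p _ => HolAt.const J (e p)

lemma eventuallyEq_chart {B B' : M → Submodule ℂ V} {q : M} (h : ∀ᶠ q' in 𝓝 q, B' q' = B q')
    {e : OpenPartialHomeomorph M ℂ} (hq : q ∈ e.source) :
    (fun z => B' (e.symm z)) =ᶠ[𝓝 (e q)] fun z => B (e.symm z) :=
  (e.eventually_nhds' (fun q => B' q = B q) hq).mpr h

/-- The sections of `B` are preserved by `N ∂/∂z` near `p`. -/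
def DClosedAt (N : V →L[ℂ] V) (B : M → Submodule ℂ V) (p : M) : Prop :=
  ∀ e ∈ holCharts M, p ∈ e.source → DCAt N (fun z => B (e.symm z)) (e p)

lemma HolBundle.dClosed [CompleteSpace V] {N : V →L[ℂ] V} {B : M → Submodule ℂ V}
    (h : HolBundle B) (hN : ∀ p, ∀ x ∈ B p, N x ∈ B p)
    (hd : ∀ᶠ p in codiscrete M, DClosedAt N B p) : DClosed N B := by
  intro e he p hp
  refine dcAt_of_eventually (h e he p hp) ?_ ?_
  · exact hN (e.symm (e p))
  · have h1 : ∀ᶠ q in 𝓝[≠] p, q ∈ e.source → DCAt N (fun z => B (e.symm z)) (e q) :=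
      (eventually_codiscrete_iff.mp hd p).mono fun q hq hqe => hq e he hqe
    have h2 := (eventually_nhdsNE_chart hp _).mpr h1
    filter_upwards [h2, mem_nhdsWithin_of_mem_nhds
      (e.open_target.mem_nhds (e.map_source hp))] with z hz hz'
    have := hz (e.map_target hz')
    rwa [e.right_inv hz'] at this

end Charts

end

end UnitonTheory

namespace UnitonTheory

noncomputable section

/-! ### Smooth families of operators -/

/-- An operator is a fixed linear expression in its values on a basis, so regularity of a family of
operators can be tested on vectors. -/
lemma op_eq_sum {V W : Type*} [NormedAddCommGroup V] [NormedSpace ℂ V] [FiniteDimensional ℂ V]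
    [NormedAddCommGroup W] [NormedSpace ℂ W] :
    ∃ (m : ℕ) (x : Fin m → V) (L : Fin m → W →L[ℂ] V →L[ℂ] W),
      ∀ Q : V →L[ℂ] W, Q = ∑ i, L i (Q (x i)) := by
  let β := Module.finBasis ℂ V
  refine ⟨_, β, fun i => ContinuousLinearMap.smulRightL ℂ V W
    (LinearMap.toContinuousLinearMap (β.coord i)), fun Q => ?_⟩
  ext1 y
  rw [sum_apply]
  conv_lhs => rw [← β.sum_repr y, map_sum]
  simp

lemma contDiffAt_of_apply {V W : Type*} [NormedAddCommGroup V] [NormedSpace ℂ V]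
    [FiniteDimensional ℂ V] [NormedAddCommGroup W] [NormedSpace ℂ W] {Q : ℂ → V →L[ℂ] W} {z : ℂ}
    (h : ∀ x, ContDiffAt ℝ ∞ (fun w => Q w x) z) : ContDiffAt ℝ ∞ Q z := by
  obtain ⟨m, x, L, hL⟩ := op_eq_sum (V := V) (W := W)
  have : Q = fun w => ∑ i, L i (Q w (x i)) := funext fun w => hL (Q w)
  rw [this]
  exact ContDiffAt.sum fun i _ =>
    (((L i).restrictScalars ℝ).contDiff.contDiffAt.comp z (h (x i)) :)

lemma ContDiffAt.hasW {F : Type*} [NormedAddCommGroup F] [NormedSpace ℂ F] {g : ℂ → F} {z : ℂ}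
    (h : ContDiffAt ℝ ∞ g z) : ∃ a c, HasW g a c z :=
  ⟨_, _, hasW_of_differentiableAt (h.differentiableAt (by simp))⟩

lemma contDiffAt_op_apply {V W : Type*} [NormedAddCommGroup V] [NormedSpace ℂ V]
    [NormedAddCommGroup W] [NormedSpace ℂ W] {Q : ℂ → V →L[ℂ] W} {y : ℂ → V} {z : ℂ}
    (hQ : ContDiffAt ℝ ∞ Q z) (hy : ContDiffAt ℝ ∞ y z) :
    ContDiffAt ℝ ∞ (fun w => Q w (y w)) z := by
  have hb : ContDiff ℝ ∞ (fun x : (V →L[ℂ] W) × V => x.1 x.2) :=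
    (isBoundedBilinearMap_apply (𝕜 := ℂ)).contDiff.restrict_scalars ℝ
  exact hb.contDiffAt.comp z (hQ.prodMk hy)

lemma contDiffAt_op_mul {V : Type*} [NormedAddCommGroup V] [NormedSpace ℂ V]
    {P Q : ℂ → V →L[ℂ] V} {z : ℂ} (hP : ContDiffAt ℝ ∞ P z) (hQ : ContDiffAt ℝ ∞ Q z) :
    ContDiffAt ℝ ∞ (fun w => P w * Q w) z := by
  have hmul : ContDiff ℝ ∞ (fun x : (V →L[ℂ] V) × (V →L[ℂ] V) => x.1 * x.2) :=
    (contDiff_mul (𝕜 := ℂ)).restrict_scalars ℝ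
  exact hmul.contDiffAt.comp z (hP.prodMk hQ)

lemma HasW.star_op {n : ℕ} {T : ℂ → End n} {a c : End n} {z : ℂ} (h : HasW T a c z) :
    HasW (fun w => star (T w)) (star c) (star a) z := by
  have h1 := HasFDerivAt.comp (𝕜 := ℝ) z
    (((starL' ℝ : End n ≃L[ℝ] End n) : End n →L[ℝ] End n).hasFDerivAt) h
  have h2 : ((starL' ℝ : End n ≃L[ℝ] End n) : End n →L[ℝ] End n).comp (wirt a c) =
      wirt (star c) (star a) := by
    ext1 w
    change star (w • a + conj w • c) = w • star c + conj w • star a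
    have e1 : ∀ (u : ℂ) (X : End n), star (u • X) = conj u • star X := fun u X =>
      star_smul u X
    rw [op_star_add, e1, e1, add_comm, Complex.conj_conj]
  rw [h2] at h1
  exact h1

/-! ### Convolution of jets -/

variable {r n : ℕ}

/-- Convolution with finitely many operator coefficients, in the degrees `ε k`. -/
def convJ (d : ℕ) (ε : ℤ) (C : ℕ → End n) : Jet r n →ₗ[ℂ] Jet r n where
  toFun x := fun i => ∑ k ∈ Finset.range (d + 1), C k (ext x ((i : ℤ) - ε * k))
  map_add' x y := by
    funext i
    simp [Finset.sum_add_distrib]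
  map_smul' c x := by
    funext i
    simp [Finset.smul_sum]

lemma convJ_apply (d : ℕ) (ε : ℤ) (C : ℕ → End n) (x : Jet r n) (i : Fin r) :
    convJ d ε C x i = ∑ k ∈ Finset.range (d + 1), C k (ext x ((i : ℤ) - ε * k)) := rfl

lemma convJ_one (d : ℕ) (T : ℕ → End n) (x : Jet r n) :
    convJ d 1 T x = tr r (mulS d T (ext x)) := by
  funext i
  simp [convJ_apply, tr_apply, mulS_apply]

lemma convJ_neg_one (d : ℕ) (T : ℕ → End n) (x : Jet r n) :
    convJ d (-1) (fun k => star (T k)) x = tr r (divS d T (ext x)) := by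
  funext i
  simp [convJ_apply, tr_apply, divS_apply]

/-- The coefficient maps of jets. -/
def coeffL (r n : ℕ) (j : ℤ) : Jet r n →L[ℂ] E n :=
  LinearMap.toContinuousLinearMap (LinearMap.proj j ∘ₗ ext)

lemma HasW.convJ {d : ℕ} {ε : ℤ} {C : ℂ → ℕ → End n} {a c : ℕ → End n} {y : ℂ → Jet r n}
    {y₁ y₂ : Jet r n} {z : ℂ} (hC : ∀ k, HasW (fun w => C w k) (a k) (c k) z)
    (hy : HasW y y₁ y₂ z) :
    HasW (fun w => convJ d ε (C w) (y w)) (convJ d ε a (y z) + convJ d ε (C z) y₁)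
      (convJ d ε c (y z) + convJ d ε (C z) y₂) z := by
  refine hasW_pi fun i => ?_
  have := HasW.sum (Finset.range (d + 1)) fun k _ =>
    (hC k).clm_apply (hy.clm (coeffL r n ((i : ℤ) - ε * k)))
  rw [Finset.sum_add_distrib, Finset.sum_add_distrib] at this
  exact this

lemma contDiffAt_convJ {d : ℕ} {ε : ℤ} {C : ℂ → ℕ → End n} {y : ℂ → Jet r n}
    {z : ℂ} (hC : ∀ k, ContDiffAt ℝ ∞ (fun w => C w k) z) (hy : ContDiffAt ℝ ∞ y z) :
    ContDiffAt ℝ ∞ (fun w => convJ d ε (C w) (y w)) z := by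
  refine contDiffAt_pi.mpr fun i => ?_
  change ContDiffAt ℝ ∞
    (fun w => ∑ k ∈ Finset.range (d + 1), C w k (coeffL r n ((i : ℤ) - ε * k) (y w))) z
  refine ContDiffAt.sum fun k _ => contDiffAt_op_apply (hC k) ?_
  exact (((coeffL r n ((i : ℤ) - ε * k)).restrictScalars ℝ).contDiff.contDiffAt.comp z hy :)

/-- Division only lowers degrees and `x` lies in the model, so the quotient lives in degrees `0, …,
r - 1` and truncation loses nothing. -/
lemma ext_tr_divS {d : ℕ} {T : ℕ → End n} {x : Jet r n} (hx : ext x ∈ WS d T) :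
    ext (tr r (divS d T (ext x))) = divS d T (ext x) := by
  funext j
  by_cases hj : j < 0
  · rw [ext_mem_pos _ j hj, hx j hj]
  · by_cases hjr : j < r
    · exact ext_tr_apply j (not_lt.mp hj) hjr
    · rw [ext_apply, Jet.coeff_of_le (not_lt.mp hjr), divS_apply]
      refine (Finset.sum_eq_zero fun k _ => ?_).symm
      rw [ext_apply, Jet.coeff_of_le (by omega), map_zero]

/-! ### Extended solutions in a coordinate -/

/-- Pointwise application of an operator to a sequence. -/
def opS (A : End n) : Sq n →ₗ[ℂ] Sq n where
  toFun f := fun i => A (f i)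
  map_add' f g := by funext i; simp
  map_smul' c f := by funext i; simp

lemma opS_apply (A : End n) (f : Sq n) (i : ℤ) : opS A f i = A (f i) := rfl

lemma opS_mem_pos {A : End n} {f : Sq n} {k : ℤ} (hf : f ∈ pos n k) : opS A f ∈ pos n k :=
  fun i hi => by rw [opS_apply, hf i hi, map_zero]

/-- This carries the equations of an extended solution over to sequences; `ε = -1` is used for `∂_z`
and `ε = 1` for `∂_z̄`. -/
lemma mulS_eq_of_polyLoop {d : ℕ} {a T : ℕ → End n} {A : End n} {ε : ℤ}
    (h : ∀ l : Circle, polyLoop d a l = (1 - (l : ℂ) ^ ε) • (polyLoop d T l * A)) (f : Sq n) :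
    mulS d a f = mulS d T (opS A f - sh ε (opS A f)) := by
  funext i
  have key := circle_functional_eq (Finset.range (d + 1)) (fun k : ℕ => (k : ℤ)) a
    ((Finset.range (d + 1)).disjSum (Finset.range (d + 1)))
    (Sum.elim (fun k : ℕ => (k : ℤ)) (fun k : ℕ => (k : ℤ) + ε))
    (Sum.elim (fun k => T k * A) (fun k => -(T k * A))) (fun z => ?_)
    (fun m => (ContinuousLinearMap.apply ℂ (E n) (f (i - m))).toLinearMap)
  · rw [Finset.sum_disjSum] at key
    simp only [Sum.elim_inl, Sum.elim_inr] at key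
    rw [mulS_apply, mulS_apply]
    refine Eq.trans key ?_
    rw [← Finset.sum_add_distrib]
    refine Finset.sum_congr rfl fun k _ => ?_
    change T k (A (f (i - k))) + -(T k (A (f (i - (k + ε))))) =
      T k (A (f (i - k)) - A (f (i - k - ε)))
    rw [map_sub, sub_sub i]
    exact (sub_eq_add_neg _ _).symm
  · have hz := h z
    rw [polyLoop, polyLoop, Finset.sum_mul, Finset.smul_sum] at hz
    rw [Finset.sum_disjSum]
    simp only [Sum.elim_inl, Sum.elim_inr, zpow_natCast]
    rw [hz, ← Finset.sum_add_distrib]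
    refine Finset.sum_congr rfl fun k _ => ?_
    have e : ∀ (u w : ℂ) (X Y : End n), (1 - w) • (u • X * Y) = u • (X * Y) + (u * w) • -(X * Y) := by
      intro u w X Y
      rw [smul_mul_assoc]
      module
    rw [zpow_add₀ (Circle.coe_ne_zero z), zpow_natCast]
    exact e _ _ _ _

/-- The polynomial loops with coefficients `t z` form an extended solution with
`Φ⁻¹ Φ_z = (1 - λ⁻¹) A` at `z`. -/
def ExtAt (d : ℕ) (t : ℂ → ℕ → End n) (A : End n) (z : ℂ) : Prop :=
  ∃ a c : ℕ → End n, (∀ k, HasW (fun w => t w k) (a k) (c k) z) ∧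
    (∀ l : Circle, polyLoop d a l = (1 - (l : ℂ) ^ (-1 : ℤ)) • (polyLoop d (t z) l * A)) ∧
    ∀ l : Circle, polyLoop d c l = (1 - (l : ℂ) ^ (1 : ℤ)) • (polyLoop d (t z) l * -star A)

lemma hasW_polyLoop {d : ℕ} {t : ℂ → ℕ → End n} {a c : ℕ → End n} {z : ℂ}
    (h : ∀ k, HasW (fun w => t w k) (a k) (c k) z) (l : Circle) :
    HasW (fun w => polyLoop d (t w) l) (polyLoop d a l) (polyLoop d c l) z :=
  HasW.sum _ fun k _ => (h k).const_smul _

/-- Differentiating `Φ⁎Φ = 1` gives `Φ_z̄ = -Φ (Φ_z)⁎ Φ`, and the conjugate of `1 - λ⁻¹` on the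
circle is `1 - λ`. -/
lemma extAt_of_dz {d : ℕ} {t : ℂ → ℕ → End n} {a c : ℕ → End n} {A : End n} {z : ℂ}
    (h : ∀ k, HasW (fun w => t w k) (a k) (c k) z) (hU : ∀ᶠ w in 𝓝 z, UnitaryCoeffs d (t w))
    (ha : ∀ l : Circle, polyLoop d a l = (1 - (l : ℂ) ^ (-1 : ℤ)) • (polyLoop d (t z) l * A)) :
    ExtAt d t A z := by
  refine ⟨a, c, h, ha, fun l => ?_⟩
  set T := polyLoop d (t z) l with hT
  have h1 := hasW_polyLoop (d := d) h l
  have h2 := (h1.star_op.mul h1).congr (g' := fun _ => (1 : End n)) (by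
    filter_upwards [hU] with w hw
    exact ((hw l).1).symm)
  have h3 := (h2.unique (hasW_const (1 : End n) z)).2
  have hTT : T * star T = 1 := (hU.self_of_nhds l).2
  have hTT' : star T * T = 1 := (hU.self_of_nhds l).1
  have h4 : polyLoop d c l = - (T * star (polyLoop d a l) * T) := by
    have := congrArg (fun X => T * X) h3
    simp only [mul_add, mul_zero, ← mul_assoc] at this
    rw [← hT, hTT, one_mul] at this
    rw [eq_neg_iff_add_eq_zero, add_comm]
    exact this
  have h5 : star (polyLoop d a l) = (1 - (l : ℂ)) • (star A * star T) := by
    rw [ha]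
    have e1 : ∀ (u : ℂ) (X : End n), star (u • X) = conj u • star X := fun u X => star_smul u X
    rw [e1, star_mul, map_sub, map_one]
    congr 2
    rw [zpow_neg_one, ← Circle.coe_inv, ← Circle.coe_inv_eq_conj, inv_inv]
  have e : ∀ (u : ℂ) (X : End n), -(T * (u • (X * star T)) * T) = u • (T * -X) := by
    intro u X
    rw [mul_smul_comm, smul_mul_assoc, mul_assoc, mul_assoc, hTT', mul_one,
      show T * -X = -(T * X) from mul_neg T X]
    exact (smul_neg u (T * X)).symm
  rw [h4, h5, zpow_one]
  exact e _ _

lemma tr_mem_of_mem_WS {d : ℕ} (hd : d ≤ r) {T : ℕ → End n} {f : Sq n}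
    (hf : f ∈ pos n 0) (h : f ∈ WS d T) : tr r f ∈ (WS d T).comap (ext : Jet r n →ₗ[ℂ] Sq n) := by
  change ext (tr r f) ∈ WS d T
  exact (mem_iff_ext_tr_mem ((pos_mono (by exact_mod_cast hd)).trans pos_le_WS) hf).mpr h

/-- The Grassmannian model of an extended solution is holomorphic. -/
lemma holAt_comap_WS {d : ℕ} (hd : d ≤ r) {t : ℂ → ℕ → End n} {z₀ : ℂ}
    (hU : ∀ᶠ w in 𝓝 z₀, UnitaryCoeffs d (t w)) (hE : ∀ᶠ w in 𝓝 z₀, ∃ A, ExtAt d t A w) :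
    HolAt (fun w => (WS d (t w)).comap (ext : Jet r n →ₗ[ℂ] Sq n)) z₀ := by
  -- The idempotent is `Φ π_+ Φ⁻¹` on jets, where `π_+` discards the negative powers of `λ`. It is
  -- only smooth in the parameter.
  refine holAt_of_smooth (Q := fun w => LinearMap.toContinuousLinearMap
    (convJ d 1 (t w) ∘ₗ convJ d (-1) (fun k => star (t w k)))) ?_ ?_ ?_
  · filter_upwards [hE] with z ⟨A, a, c, h, _⟩
    obtain ⟨m, x, L, hL⟩ := op_eq_sum (V := Jet r n) (W := Jet r n)
    have key : ∀ x : Jet r n, ∃ a' c', HasW (fun w => (LinearMap.toContinuousLinearMap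
        (convJ d 1 (t w) ∘ₗ convJ d (-1) (fun k => star (t w k)))) x) a' c' z := fun x =>
      ⟨_, _, HasW.convJ h (HasW.convJ (C := fun w k => star (t w k)) (fun k => (h k).star_op)
        (hasW_const x z))⟩
    choose a' c' hac using key
    refine ⟨_, _, (HasW.sum Finset.univ fun i _ => (hac (x i)).clm (L i)).congr
      (Eventually.of_forall fun w => ?_)⟩
    exact hL _
  · filter_upwards [hU] with z hz
    refine ⟨fun x => ?_, fun x hx => ?_⟩
    · change convJ d 1 (t z) (convJ d (-1) (fun k => star (t z k)) x) ∈ _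
      rw [convJ_one]
      exact tr_mem_of_mem_WS hd (mulS_mem_pos (ext_mem_pos _)) (hz.mulS_mem_WS (ext_mem_pos _))
    · change convJ d 1 (t z) (convJ d (-1) (fun k => star (t z k)) x) = x
      rw [convJ_one, convJ_neg_one, ext_tr_divS hx, hz.mulS_divS, tr_ext]
  · filter_upwards [hU.eventually_nhds, hE] with z hUz ⟨A, a, c, h, ha, hc⟩ v hv
    have hz := hUz.self_of_nhds
    set y : Jet r n := tr r (divS d (t z) (ext v)) with hy
    have hyv : ext y = divS d (t z) (ext v) := ext_tr_divS hv
    -- The section through `v` is `Φ y` with the constant `y = Φ(z)⁻¹ v ∈ H_+`. Its derivative `Φ_z̄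
    -- y = -Φ (1 - λ) A⁎ y` again lies in `Φ H_+`.
    refine ⟨fun w => convJ d 1 (t w) y, _, _, HasW.convJ h (hasW_const y z), ?_, ?_, ?_⟩
    · filter_upwards [hUz] with w hw
      rw [convJ_one]
      exact tr_mem_of_mem_WS hd (mulS_mem_pos (ext_mem_pos _)) (hw.mulS_mem_WS (ext_mem_pos _))
    · change convJ d 1 (t z) y = v
      rw [convJ_one, hyv, hz.mulS_divS, tr_ext]
    · rw [map_zero, add_zero, convJ_one, mulS_eq_of_polyLoop hc]
      have hp : opS (-star A) (ext y) - sh 1 (opS (-star A) (ext y)) ∈ pos n 0 :=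
        Submodule.sub_mem _ (opS_mem_pos (ext_mem_pos _))
          (sh_mem_pos.mpr (pos_mono (by norm_num) (opS_mem_pos (ext_mem_pos _))))
      exact tr_mem_of_mem_WS hd (mulS_mem_pos hp) (hz.mulS_mem_WS hp)

/-- The shift on jets, as a continuous linear map. -/
def shL (r n k : ℕ) : Jet r n →L[ℂ] Jet r n := LinearMap.toContinuousLinearMap (shJ k)

lemma shL_apply (k : ℕ) (x : Jet r n) : shL r n k x = shJ k x := rfl

lemma ExtAt.sub_sh_mem_pos {A : End n} {f : Sq n} (hf : f ∈ pos n 0) :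
    sh 1 (opS A f - sh (-1) (opS A f)) ∈ pos n 0 := by
  rw [map_sub, sh_sh]
  simp only [add_neg_cancel, sh_zero]
  exact Submodule.sub_mem _ (sh_mem_pos.mpr (pos_mono (by norm_num) (opS_mem_pos hf)))
    (opS_mem_pos hf)

/-- For a section `σ = Φ y` one has `λ ∂_z σ = Φ ((λ - 1) A y + λ ∂_z y)`: the factor `λ` cancels
the pole of `1 - λ⁻¹`. -/
lemma dcAt_comap_WS {d : ℕ} (hd : d ≤ r) {t : ℂ → ℕ → End n} {z : ℂ}
    (hU : ∀ᶠ w in 𝓝 z, UnitaryCoeffs d (t w)) {A : End n} (hE : ExtAt d t A z) :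
    DCAt (shL r n 1) (fun w => (WS d (t w)).comap (ext : Jet r n →ₗ[ℂ] Sq n)) z := by
  intro σ s₁ s₂ hσ hσb
  obtain ⟨a, c, h, ha, hc⟩ := hE
  have hz := hU.self_of_nhds
  obtain ⟨y₁, y₂, hy⟩ : ∃ y₁ y₂,
      HasW (fun w => convJ d (-1) (fun k => star (t w k)) (σ w)) y₁ y₂ z :=
    ⟨_, _, HasW.convJ (C := fun w k => star (t w k)) (fun k => (h k).star_op) hσ⟩
  have h1 := (HasW.convJ (d := d) (ε := 1) h hy).congr (g' := σ) (by
    filter_upwards [hU, hσb] with w hw hw'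
    rw [convJ_one, convJ_neg_one, ext_tr_divS hw', hw.mulS_divS, tr_ext])
  rw [(hσ.unique h1).1, map_add]
  set y := convJ d (-1) (fun k => star (t z k)) (σ z)
  have hsh : ∀ x : Jet r n, shL r n 1 (tr r (mulS d (t z) (ext x))) ∈
      (WS d (t z)).comap (ext : Jet r n →ₗ[ℂ] Sq n) := by
    intro x
    rw [shL_apply, shJ_tr (mulS_mem_pos (ext_mem_pos _))]
    rw [← mulS_sh]
    exact tr_mem_of_mem_WS hd (mulS_mem_pos (sh_ext_mem_pos (by norm_num) _))
      (hz.mulS_mem_WS (sh_ext_mem_pos (by norm_num) _))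
  refine Submodule.add_mem _ ?_ (by rw [convJ_one]; exact hsh y₁)
  rw [convJ_one, shL_apply, shJ_tr (mulS_mem_pos (ext_mem_pos _)), mulS_eq_of_polyLoop ha]
  rw [Nat.cast_one, ← mulS_sh]
  have hp := ExtAt.sub_sh_mem_pos (A := A) (ext_mem_pos y)
  exact tr_mem_of_mem_WS hd (mulS_mem_pos hp) (hz.mulS_mem_WS hp)

/-! ### Coefficients of polynomial loops -/

/-- Lagrange interpolation at the `d + 1` points `e^{i/(j+1)}`, which are distinct because their
arguments lie in `(0, 1]`. It makes the coefficients of a polynomial loop as smooth in parameters as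
its values. -/
lemma exists_coeff_functional (d : ℕ) :
    ∃ (v : ℕ → Circle) (c : ℕ → ℕ → ℂ), ∀ (T : ℕ → End n), ∀ k ≤ d,
      ∑ j ∈ Finset.range (d + 1), c k j • polyLoop d T (v j) = T k := by
  let v : ℕ → Circle := fun j => Circle.exp (1 / ((j : ℝ) + 1))
  have hv : Function.Injective v := by
    intro i j hij
    have hb : ∀ j : ℕ, 0 < 1 / ((j : ℝ) + 1) ∧ 1 / ((j : ℝ) + 1) ≤ 1 := fun j =>
      ⟨by positivity, by rw [div_le_one (by positivity)]; linarith [j.cast_nonneg (α := ℝ)]⟩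
    have h := congrArg (fun z : Circle => Complex.arg z) hij
    simp only [v] at h
    rw [Circle.arg_exp, Circle.arg_exp] at h
    · have h2 : ((i : ℝ) + 1) = j + 1 := by
        have := congrArg (fun x : ℝ => 1 / x) h
        simpa using this
      exact_mod_cast (add_right_cancel h2)
    all_goals first | linarith [(hb j).1, Real.pi_pos] | linarith [(hb i).1, Real.pi_pos] |
      linarith [(hb j).2, Real.pi_gt_three] | linarith [(hb i).2, Real.pi_gt_three]
  let s := Finset.range (d + 1)
  let w : ℕ → ℂ := fun j => v j
  have hw : Set.InjOn w s := fun i _ j _ h => hv (Circle.ext h)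
  refine ⟨v, fun k j => (Lagrange.basis s w j).coeff k, fun T k hk => ?_⟩
  have key : ∀ l ≤ d, ∑ j ∈ s, w j ^ l * (Lagrange.basis s w j).coeff k = if k = l then 1 else 0 := by
    intro l hl
    have h := Lagrange.eq_interpolate (f := (Polynomial.X ^ l : Polynomial ℂ)) hw (by
      rw [Polynomial.degree_X_pow, Finset.card_range]
      exact_mod_cast Nat.lt_succ_of_le hl)
    have h2 := congrArg (fun f => Polynomial.coeff f k) h
    simp only [Lagrange.interpolate_apply, Polynomial.coeff_X_pow, Polynomial.finsetSum_coeff,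
      Polynomial.coeff_C_mul, Polynomial.eval_pow, Polynomial.eval_X] at h2
    exact h2.symm
  simp only [polyLoop, Finset.smul_sum]
  rw [Finset.sum_comm]
  rw [Finset.sum_eq_single_of_mem k (Finset.mem_range.mpr (by omega))]
  · have := key k hk
    rw [if_pos rfl] at this
    simp only [smul_smul, ← Finset.sum_smul]
    conv_rhs => rw [← one_smul ℂ (T k), ← this]
    congr 1
    exact Finset.sum_congr rfl fun j _ => mul_comm _ _
  · intro l hl hlk
    have := key l (by have := Finset.mem_range.mp hl; omega)
    rw [if_neg (Ne.symm hlk)] at this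
    simp only [smul_smul, ← Finset.sum_smul]
    have e : ∑ j ∈ Finset.range (d + 1), (Lagrange.basis s w j).coeff k * (v j : ℂ) ^ l = 0 := by
      rw [← this]
      exact Finset.sum_congr rfl fun j _ => mul_comm _ _
    rw [e, zero_smul]

end

end UnitonTheory

namespace UnitonTheory

noncomputable section

set_option linter.unusedSectionVars false

variable {r n : ℕ} {M : Type*} [TopologicalSpace M] [ChartedSpace ℂ M]

lemma HasW.dz {F : Type*} [NormedAddCommGroup F] [NormedSpace ℂ F]
    {e : OpenPartialHomeomorph M ℂ} {f : M → F} {p : M} {a b : F}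
    (h : HasW (fun w => f (e.symm w)) a b (e p)) : dz e f p = a := HasW.dz_eq h

lemma HasW.dzbar {F : Type*} [NormedAddCommGroup F] [NormedSpace ℂ F]
    {e : OpenPartialHomeomorph M ℂ} {f : M → F} {p : M} {a b : F}
    (h : HasW (fun w => f (e.symm w)) a b (e p)) : dzbar e f p = b := HasW.dzbar_eq h

lemma eventually_target {e : OpenPartialHomeomorph M ℂ} {p : M} (hp : p ∈ e.source) {Q : ℂ → Prop}
    (h : ∀ q ∈ e.source, Q (e q)) : ∀ᶠ w in 𝓝 (e p), Q w := by
  filter_upwards [e.open_target.mem_nhds (e.map_source hp)] with w hw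
  have := h _ (e.map_target hw)
  rwa [e.right_inv hw] at this

variable [IsManifold 𝓘(ℂ, ℂ) ω M]

/-- The coefficients of a polynomial extended solution. -/
structure ExtCoeffs (d : ℕ) (T : M → ℕ → End n) : Prop where
  unitary : ∀ p, UnitaryCoeffs d (T p)
  one : ∀ p, polyLoop d (T p) 1 = 1
  smooth : ∀ k, SmoothMap fun p => T p k
  ext : ∀ e ∈ holCharts M, ∀ p ∈ e.source, ∃ A, ExtAt d (fun w => T (e.symm w)) A (e p)

lemma SmoothMap.contDiffAt {F : Type*} [NormedAddCommGroup F] [NormedSpace ℝ F] {f : M → F}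
    (h : SmoothMap f) {e : OpenPartialHomeomorph M ℂ} (he : e ∈ holCharts M) {p : M}
    (hp : p ∈ e.source) : ContDiffAt ℝ ∞ (fun w => f (e.symm w)) (e p) :=
  smoothMap_iff_chart.mp h e he p hp

lemma exists_extCoeffs {Φ : M → Circle → End n} (h : IsExtendedSolution Φ)
    (hp : ∀ p, Φ p ∈ polyLoops n r) :
    ∃ T : M → ℕ → End n, ExtCoeffs r T ∧ ∀ p z, Φ p z = polyLoop r (T p) z := by
  obtain ⟨v, c, hvc⟩ := exists_coeff_functional (n := n) r
  set T : M → ℕ → End n := fun p k => ∑ j ∈ Finset.range (r + 1), c k j • Φ p (v j) with hT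
  have hΦ : ∀ p z, Φ p z = polyLoop r (T p) z := by
    intro p z
    obtain ⟨T', hT'⟩ := (hp p).2
    rw [hT' z, polyLoop]
    refine Finset.sum_congr rfl fun k hk => ?_
    congr 1
    rw [← hvc T' k (by have := Finset.mem_range.mp hk; omega)]
    exact Finset.sum_congr rfl fun j _ => by rw [hT' (v j)]; rfl
  have hs : ∀ z, SmoothMap fun p => Φ p z := fun z =>
    h.2.1.comp (contMDiff_id.prodMk contMDiff_const)
  have hTs : ∀ k, SmoothMap fun p => T p k := by
    intro k
    rw [smoothMap_iff_chart]
    intro e he p hp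
    change ContDiffAt ℝ ∞ (fun w => ∑ j ∈ Finset.range (r + 1), c k j • Φ (e.symm w) (v j)) (e p)
    refine ContDiffAt.sum fun j _ => ?_
    exact ((hs (v j)).contDiffAt he hp).const_smul (c k j)
  have hU : ∀ p, UnitaryCoeffs r (T p) := fun p z => by
    rw [← hΦ]; exact (h.1 p).2.1 z
  refine ⟨T, ⟨hU, fun p => by rw [← hΦ]; exact (h.1 p).2.2, hTs, fun e he p hp => ?_⟩, hΦ⟩
  obtain ⟨A, hA⟩ := h.2.2 e he
  choose a c' hac using fun k => ((hTs k).contDiffAt he hp).hasW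
  refine ⟨A p, extAt_of_dz hac (eventually_target (Q := fun w => UnitaryCoeffs r (T (e.symm w))) hp
    fun q _ => hU _) fun l => ?_⟩
  have h1 := (hasW_polyLoop (d := r) hac l).dz (f := fun q => polyLoop r (T q) l)
  have h2 := hA p hp l
  simp only [hΦ] at h2
  rw [h1] at h2
  rw [e.left_inv hp]
  have h3 := congrArg (fun X => polyLoop r (T p) l * X) h2
  simp only [← mul_assoc] at h3
  have h4 : polyLoop r (T p) l * star (polyLoop r (T p) l) = 1 := (hU p l).2
  rw [h4, one_mul, mul_smul_comm] at h3
  rw [h3, zpow_neg_one]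

namespace ExtCoeffs

variable {d : ℕ} {T : M → ℕ → End n}

lemma eventually_unitary (h : ExtCoeffs d T) (e : OpenPartialHomeomorph M ℂ) (z : ℂ) :
    ∀ᶠ w in 𝓝 z, UnitaryCoeffs d (T (e.symm w)) := Eventually.of_forall fun _ => h.unitary _

lemma holBundle (h : ExtCoeffs d T) (hd : d ≤ r) :
    HolBundle (fun p => (WS d (T p)).comap (UnitonTheory.ext : Jet r n →ₗ[ℂ] Sq n)) :=
  fun e he _ hp => holAt_comap_WS hd (h.eventually_unitary e _)
    (eventually_target hp fun q hq => h.ext e he q hq)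

lemma dClosed (h : ExtCoeffs d T) (hd : d ≤ r) :
    DClosed (shL r n 1) (fun p => (WS d (T p)).comap (UnitonTheory.ext : Jet r n →ₗ[ℂ] Sq n)) :=
  fun e he p hp => by
    obtain ⟨A, hA⟩ := h.ext e he p hp
    exact dcAt_comap_WS hd (h.eventually_unitary e _) hA

lemma star_mul_eq (h : ExtCoeffs d T) {p : M} {l : Circle} {a : ℕ → End n} {A : End n} {c : ℂ}
    (ha : polyLoop d a l = c • (polyLoop d (T p) l * A)) :
    star (polyLoop d (T p) l) * polyLoop d a l = c • A := by
  rw [ha, mul_smul_comm, ← mul_assoc, show star (polyLoop d (T p) l) * polyLoop d (T p) l = 1 from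
    (h.unitary p l).1, one_mul]

lemma isExtendedSolution (h : ExtCoeffs d T) : IsExtendedSolution fun p => polyLoop d (T p) := by
  refine ⟨fun p => ⟨contMDiff_polyLoop d (T p), h.unitary p, h.one p⟩, ?_, fun e he => ?_⟩
  · have h1 : ContDiff ℝ ∞ (fun x : ℂ × (Fin (d + 1) → End n) => ∑ k : Fin (d + 1), x.1 ^ (k : ℕ) • x.2 k) := by
      have : ContDiff ℂ ∞ (fun x : ℂ × (Fin (d + 1) → End n) => ∑ k : Fin (d + 1), x.1 ^ (k : ℕ) • x.2 k) := by
        fun_prop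
      exact this.restrict_scalars ℝ
    have h2 : ContMDiff (𝓘(ℝ, ℂ).prod (𝓡 1)) 𝓘(ℝ, ℂ × (Fin (d + 1) → End n)) ∞
        (fun q : M × Circle => ((q.2 : ℂ), fun k : Fin (d + 1) => T q.1 k)) := by
      refine ContMDiff.prodMk_space (contMDiff_circle_coe.comp contMDiff_snd) ?_
      rw [contMDiff_pi_space]
      exact fun k => ContMDiff.comp (h.smooth k) contMDiff_fst
    have h3 := h1.comp_contMDiff h2
    exact h3.congr fun q => Finset.sum_range fun k => (q.2 : ℂ) ^ k • T q.1 k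
  · classical
    refine ⟨fun p => if hp : p ∈ e.source then (h.ext e he p hp).choose else 0, fun p hp l => ?_⟩
    simp only [dif_pos hp]
    obtain ⟨a, c, hac, ha, -⟩ := (h.ext e he p hp).choose_spec
    have h1 := (hasW_polyLoop (d := d) hac l).dz (f := fun q => polyLoop d (T q) l)
    rw [h1]
    refine h.star_mul_eq ?_
    have h2 : polyLoop d a l =
      (1 - (l : ℂ) ^ (-1 : ℤ)) • (polyLoop d (T (e.symm (e p))) l * _) := ha l
    rw [e.left_inv hp, zpow_neg_one] at h2
    exact h2

end ExtCoeffs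

/-! ### Filtrations by holomorphic bundles -/

/-- A filtration by holomorphic bundles that is closed under `λ ∂/∂z`. -/
structure FiltrBundle (B : ℕ → M → Submodule ℂ (Jet r n)) : Prop where
  hol : ∀ i ≤ r, HolBundle (B i)
  dcl : ∀ i ≤ r, DClosed (shL r n 1) (B i)
  filtr : ∀ p, IsFiltr fun i => B i p

/-- The unitons defined by a filtration. -/
def unitonOf (B : ℕ → M → Submodule ℂ (Jet r n)) (i : ℕ) (p : M) : Submodule ℂ (E n) :=
  unitonSeq (fun j => B j p) i

variable {B : ℕ → M → Submodule ℂ (Jet r n)}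

/-- The coefficients of the partial products. -/
def unitonCoeffs (B : ℕ → M → Submodule ℂ (Jet r n)) (i : ℕ) (p : M) (k : ℕ) : End n :=
  etaCoeffs (unitonSeq fun j => B j p) i k

lemma ext_tr_dl (hr : 0 < r) (v : E n) : ext (tr r (dl v)) = dl v := by
  funext j
  by_cases hj : 0 ≤ j ∧ j < r
  · exact ext_tr_apply j hj.1 hj.2
  · rw [ext_apply, Jet.coeff, dif_neg hj, dl_apply, if_neg]
    rintro rfl
    exact hj ⟨le_rfl, by exact_mod_cast hr⟩

/-- Since `W_{i+1} = Φ_{i+1} H_+`, this is the criterion `mem_WS_etaCoeffs_succ` applied to `Φ_i f`.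
It turns properties of the bundle `W_{i+1}` into properties of `α_{i+1}`. -/
lemma FiltrBundle.tr_mulS_dl_mem_iff (hB : FiltrBundle B) {i : ℕ} (hi : i < r) (p : M) {f : Sq n}
    (hf : f ∈ pos n 0) :
    tr r (mulS i (unitonCoeffs B i p) f) ∈ B (i + 1) p ↔ f 0 ∈ unitonOf B (i + 1) p := by
  have hu := unitaryCoeffs_etaCoeffs (unitonSeq fun j => B j p) i
  have h1 := (hB.filtr p).mem_WS_iff (Nat.succ_le_of_lt hi)
    (f := mulS i (unitonCoeffs B i p) f) (mulS_mem_pos hf)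
  rw [← h1, mem_WS_etaCoeffs_succ]
  have h2 : divS i (unitonCoeffs B i p) (mulS i (unitonCoeffs B i p) f) = f := hu.divS_mulS f
  change _ ∧ divS i (unitonCoeffs B i p) (mulS i (unitonCoeffs B i p) f) 0 ∈ _ ↔ _
  rw [h2]
  exact ⟨fun h => h.2, fun h => ⟨hu.mulS_mem_WS hf, h⟩⟩

lemma FiltrBundle.isSmoothSubbundle (hB : FiltrBundle B) {i : ℕ} (hi : i < r)
    (h : ExtCoeffs i (unitonCoeffs B i)) : IsSmoothSubbundle (unitonOf B (i + 1)) := by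
  have hr : 0 < r := by omega
  change SmoothMap _
  rw [smoothMap_iff_chart]
  intro e he p hp
  obtain ⟨P, hP, hPb⟩ := hB.hol (i + 1) hi e he p hp
  let t : ℂ → ℕ → End n := fun w => unitonCoeffs B i (e.symm w)
  -- With `P` an analytic projection onto `W_{i+1}`, the operator `v ↦ P_0 Φ_i⁻¹ P Φ_i v` is an
  -- idempotent with range `α_{i+1}`, generally not self-adjoint.
  let R : ℂ → End n := fun w => LinearMap.toContinuousLinearMap
    (LinearMap.proj ⟨0, hr⟩ ∘ₗ convJ i (-1) (fun k => star (t w k)) ∘ₗ (P w : Jet r n →ₗ[ℂ] Jet r n) ∘ₗ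
      convJ i 1 (t w) ∘ₗ tr r ∘ₗ dl)
  have hR : ∀ w v, R w v = convJ i (-1) (fun k => star (t w k))
    (P w (convJ i 1 (t w) (tr r (dl v)))) ⟨0, hr⟩ := fun _ _ => rfl
  have ht : ∀ k, ContDiffAt ℝ ∞ (fun w => t w k) (e p) := fun k => (h.smooth k).contDiffAt he hp
  have hstar : ∀ k, ContDiffAt ℝ ∞ (fun w => star (t w k)) (e p) := fun k =>
    contDiff_star_op.contDiffAt.comp (e p) (ht k)
  refine contDiffAt_proj (P := R) (contDiffAt_of_apply fun v => ?_) ?_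
  · have h1 : ContDiffAt ℝ ∞ P (e p) := (hP.contDiffAt (n := ∞)).restrict_scalars ℝ
    have h2 := contDiffAt_convJ (d := i) (ε := -1) hstar (contDiffAt_op_apply h1
      (contDiffAt_convJ (d := i) (ε := 1) ht (contDiffAt_const (c := tr r (dl v)))))
    exact contDiffAt_pi.mp h2 ⟨0, hr⟩
  · filter_upwards [hPb] with w hw
    have hev : ∀ x : Jet r n, convJ i (-1) (fun k => star (t w k)) x ⟨0, hr⟩ =
        evA r (unitonSeq fun j => B j (e.symm w)) i x := by
      intro x
      rw [convJ_neg_one]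
      rfl
    refine ⟨fun v => ?_, fun v hv => ?_⟩
    · rw [hR, hev]
      change _ ∈ unitonSeq _ (i + 1)
      rw [unitonSeq_succ]
      exact ⟨_, hw.1 _, rfl⟩
    · rw [hR, hev, convJ_one, ext_tr_dl hr]
      have hv' := (hB.tr_mulS_dl_mem_iff hi (e.symm w) (dl_mem_pos v)).mpr hv
      rw [hw.2 _ hv', evA_tr hi (mulS_mem_pos (dl_mem_pos v))]
      have := (unitaryCoeffs_etaCoeffs (unitonSeq fun j => B j (e.symm w)) i).divS_mulS (dl v)
      exact congrFun this 0

/-- For a section `σ` of `α_{i+1}`, `Φ_i σ` is a section of `W_{i+1}`. So `∂_z̄(Φ_i σ) = Φ_i (∂_z̄ σ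
- (1 - λ) A⁎ σ)` and `λ ∂_z(Φ_i σ) = Φ_i ((λ - 1) A σ + λ ∂_z σ)` lie in `W_{i+1}`. The constant
terms of the arguments of `Φ_i`, `∂_z̄ σ - A⁎ σ` and `-A σ`, therefore lie in `α_{i+1}`. -/
lemma FiltrBundle.uniton_conditions (hB : FiltrBundle B) {i : ℕ} (hi : i < r)
    {e : OpenPartialHomeomorph M ℂ} (he : e ∈ holCharts M) {p : M} (hp : p ∈ e.source) {A : End n}
    (hA : ExtAt i (fun w => unitonCoeffs B i (e.symm w)) A (e p)) {σ : ℂ → E n} {s₁ s₂ : E n}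
    (hσ : HasW σ s₁ s₂ (e p)) (hσb : ∀ᶠ w in 𝓝 (e p), σ w ∈ unitonOf B (i + 1) (e.symm w)) :
    s₂ - star A (σ (e p)) ∈ unitonOf B (i + 1) p ∧ A (σ (e p)) ∈ unitonOf B (i + 1) p := by
  have hr : 0 < r := by omega
  obtain ⟨a, c, h, ha, hc⟩ := hA
  have ha : ∀ l : Circle, polyLoop i a l =
    (1 - (l : ℂ) ^ (-1 : ℤ)) • (polyLoop i (unitonCoeffs B i (e.symm (e p))) l * A) := ha
  have hc : ∀ l : Circle, polyLoop i c l =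
    (1 - (l : ℂ) ^ (1 : ℤ)) • (polyLoop i (unitonCoeffs B i (e.symm (e p))) l * -star A) := hc
  rw [e.left_inv hp] at ha hc
  let D : E n →L[ℂ] Jet r n := LinearMap.toContinuousLinearMap (tr r ∘ₗ dl)
  have hx := HasW.convJ (d := i) (ε := 1) h (hσ.clm D)
  have hDx : ∀ v, ext (D v) = dl v := fun v => ext_tr_dl hr v
  have hxb : ∀ᶠ w in 𝓝 (e p), convJ i 1 (unitonCoeffs B i (e.symm w)) (D (σ w)) ∈
      B (i + 1) (e.symm w) := by
    filter_upwards [hσb] with w hw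
    rw [convJ_one, hDx]
    exact (hB.tr_mulS_dl_mem_iff hi _ (dl_mem_pos _)).mpr hw
  have e2 := (hB.hol (i + 1) hi e he p hp).dzbar_mem hx hxb
  have e1 := hB.dcl (i + 1) hi e he p hp _ _ _ hx hxb
  simp only [e.left_inv hp] at e1 e2
  set v := σ (e p)
  constructor
  · rw [convJ_one, convJ_one, hDx, hDx, mulS_eq_of_polyLoop hc, ← map_add, ← map_add] at e2
    have hpos : opS (-star A) (dl v) - sh 1 (opS (-star A) (dl v)) + dl s₂ ∈ pos n 0 :=
      Submodule.add_mem _ (Submodule.sub_mem _ (opS_mem_pos (dl_mem_pos _))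
        (sh_mem_pos.mpr (pos_mono (by norm_num) (opS_mem_pos (dl_mem_pos _))))) (dl_mem_pos _)
    have := (hB.tr_mulS_dl_mem_iff hi p hpos).mp e2
    have e3 : (opS (-star A) (dl v) - sh 1 (opS (-star A) (dl v)) + dl s₂) 0 =
        s₂ - star A v := by
      simp [opS_apply, sh_apply, dl_apply]
      abel
    rwa [e3] at this
  · have h0 : mulS i a (dl v) + mulS i (unitonCoeffs B i p) (dl s₁) ∈ pos n 0 :=
      Submodule.add_mem _ (mulS_mem_pos (dl_mem_pos _)) (mulS_mem_pos (dl_mem_pos _))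
    rw [convJ_one, convJ_one, hDx, hDx, ← map_add, shL_apply, shJ_tr h0, mulS_eq_of_polyLoop ha,
      ← map_add, Nat.cast_one, ← mulS_sh, map_add] at e1
    have hpos := Submodule.add_mem _ (ExtAt.sub_sh_mem_pos (A := A) (dl_mem_pos v))
      (sh_mem_pos.mpr (pos_mono (by norm_num : (0 : ℤ) - 1 ≤ 0) (dl_mem_pos s₁)))
    have := (hB.tr_mulS_dl_mem_iff hi p hpos).mp e1
    have e3 : (sh 1 (opS A (dl v) - sh (-1) (opS A (dl v))) + sh 1 (dl s₁)) 0 = -A v := by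
      simp [opS_apply, sh_apply, dl_apply]
    rw [e3] at this
    exact (Submodule.neg_mem_iff _).mp this

/-- At `λ = -1` the factors `1 - λ^{±1}` equal `2` and cancel the `½` in the connection, so the
conditions on `A` and `A⁎` are those for a uniton. -/
lemma FiltrBundle.isUniton (hB : FiltrBundle B) {i : ℕ} (hi : i < r)
    (h : ExtCoeffs i (unitonCoeffs B i)) :
    IsUniton (fun p => polyLoop i (unitonCoeffs B i p)) (unitonOf B (i + 1)) := by
  refine ⟨h.isExtendedSolution, hB.isSmoothSubbundle hi h, fun e he σ hσ hσα p hp => ?_⟩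
  obtain ⟨A, hA⟩ := h.ext e he p hp
  obtain ⟨s₁, s₂, hs⟩ := (hσ.contDiffAt he hp).hasW
  obtain ⟨h1, h2⟩ := hB.uniton_conditions hi he hp hA hs (Eventually.of_forall fun w => hσα _)
  obtain ⟨a, c, hac, ha, hc⟩ := hA
  have ha : polyLoop i a (-1) =
    (1 - ((-1 : Circle) : ℂ) ^ (-1 : ℤ)) • (polyLoop i (unitonCoeffs B i (e.symm (e p))) (-1) * A) :=
    ha (-1)
  have hc : polyLoop i c (-1) = (1 - ((-1 : Circle) : ℂ) ^ (1 : ℤ)) •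
    (polyLoop i (unitonCoeffs B i (e.symm (e p))) (-1) * -star A) := hc (-1)
  rw [e.left_inv hp] at h1 h2 ha hc
  have hP := hasW_polyLoop (d := i) hac (-1)
  have hval : ((-1 : Circle) : ℂ) = -1 := rfl
  constructor
  · rw [hs.dzbar, connZbar, hP.dzbar (f := fun q => polyLoop i (unitonCoeffs B i q) (-1)),
      h.star_mul_eq hc, hval]
    have : (1 / 2 : ℂ) • ((1 - (-1 : ℂ) ^ (1 : ℤ)) • -star A) = -star A := by
      rw [smul_smul]; norm_num
    rw [this]
    simpa [sub_eq_add_neg] using h1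
  · rw [connZ, hP.dz (f := fun q => polyLoop i (unitonCoeffs B i q) (-1)), h.star_mul_eq ha, hval]
    have : (1 / 2 : ℂ) • ((1 - (-1 : ℂ) ^ (-1 : ℤ)) • A) = A := by
      rw [smul_smul]; norm_num
    rw [this]
    exact h2

/-- Here `p` is the projection onto a uniton and `D = ∂_z p`. The hypotheses `hA` and `hH` say that
`A` preserves the uniton and, in adjoint form, that it is holomorphic. With `η = p + l(1 - p)`, the
conclusion is `(1 - l⁻¹) A η + η_z = (1 - l⁻¹) η A'`, so multiplication by `η` again gives an
extended solution, with matrix `A'`. It follows from `p A' = A p` and `(1 - p) A' = A (1 - p) - D`.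
-/
lemma uniton_algebra {R : Type*} [Ring R] [Algebra ℂ R] {p A D : R} (hp : p * p = p)
    (hA : p * A * p = A * p) (hD : D * p + p * D = D) (hH : D * p - p * A * p = D - p * A)
    (l : ℂ) (hl : l ≠ 0) :
    (1 - l⁻¹) • (A * (p + l • (1 - p))) + (D + l • (0 - D)) =
      (1 - l⁻¹) • ((p + l • (1 - p)) *
        (p * A * p + (1 - p) * A * (1 - p) - (1 - p) * D)) := by
  have e0 : D + l • (0 - D) = (1 - l⁻¹) • (-(l • D)) := by
    rw [smul_neg, smul_smul, sub_mul, inv_mul_cancel₀ hl]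
    module
  have e1 : p * (p * A * p + (1 - p) * A * (1 - p) - (1 - p) * D) = A * p := by
    have h : p * (1 - p) = 0 := by rw [mul_sub, mul_one, hp, sub_self]
    rw [mul_sub, mul_add, mul_assoc (1 - p), ← mul_assoc p (1 - p), ← mul_assoc p (1 - p), h,
      zero_mul, zero_mul, sub_zero, add_zero, ← hA, ← mul_assoc, ← mul_assoc, hp]
  have e2 : (1 - p) * (p * A * p + (1 - p) * A * (1 - p) - (1 - p) * D) = A * (1 - p) - D := by
    have h : (1 - p) * p = 0 := by rw [sub_mul, one_mul, hp, sub_self]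
    have h' : (1 - p) * (1 - p) = 1 - p := by rw [mul_sub, mul_one, h, sub_zero]
    have h3 : p * D = p * A - p * A * p := by
      rw [eq_sub_of_add_eq' hD]
      have h4 : D - D * p = (D - p * A) - (D * p - p * A * p) + (p * A - p * A * p) := by abel
      rw [h4, hH, sub_self, zero_add]
    rw [mul_sub, mul_add, ← mul_assoc, ← mul_assoc, ← mul_assoc, ← mul_assoc, ← mul_assoc, h,
      zero_mul, zero_mul, zero_add, h', sub_mul, sub_mul, one_mul, sub_mul, one_mul, h3,
      mul_sub (p * A), mul_one]
    abel
  rw [e0, ← smul_add, add_mul, smul_mul_assoc, e1, e2, mul_add, mul_smul_comm, smul_sub,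
    ← sub_eq_add_neg, add_sub_assoc]

lemma unitonCoeffs_zero (p : M) (k : ℕ) : unitonCoeffs B 0 p k = if k = 0 then 1 else 0 := by
  cases k with
  | zero => exact star_one (End n)
  | succ k => exact op_star_zero

/-- Induction on the number of factors: the conditions on `α_{i+1}` are available once `Φ_i` is an
extended solution, and `uniton_algebra` then gives the equation for `Φ_{i+1}`. -/
lemma FiltrBundle.extCoeffs (hB : FiltrBundle B) {i : ℕ} (hi : i ≤ r) :
    ExtCoeffs i (unitonCoeffs B i) := by
  have hU : ∀ i p, UnitaryCoeffs i (unitonCoeffs B i p) := fun i p => unitaryCoeffs_etaCoeffs _ i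
  have hone : ∀ i p, polyLoop i (unitonCoeffs B i p) 1 = 1 := fun i p => by
    have := etaProd_eq_polyLoop (α := unitonOf B) i p
    change polyLoop i (etaCoeffs (fun j => unitonOf B j p) i) 1 = 1
    rw [← this]
    exact etaProd_one 0 i p
  induction i with
  | zero =>
    refine ⟨hU 0, hone 0, fun k => ?_, fun e he p hp => ⟨0, 0, 0, fun k => ?_, fun l => ?_,
      fun l => ?_⟩⟩
    · simp only [unitonCoeffs_zero]
      exact contMDiff_const
    · simp only [unitonCoeffs_zero]
      exact hasW_const _ _
    · simp [polyLoop]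
    · have h0 : -star (0 : End n) = 0 := by rw [op_star_zero]; exact neg_zero
      rw [h0]
      simp [polyLoop]
  | succ i ih =>
    have h := ih (by omega)
    have hi : i < r := by omega
    have hs := hB.isSmoothSubbundle hi h
    have hsmooth : ∀ k, SmoothMap fun p => unitonCoeffs B (i + 1) p k := by
      intro k
      rw [smoothMap_iff_chart]
      intro e he p hp
      have h1 := SmoothMap.contDiffAt hs he hp
      have h2 : ContDiffAt ℝ ∞ (fun w => proj (unitonOf B (i + 1) (e.symm w))ᗮ) (e p) := by
        simp only [proj_orthogonal]
        exact contDiffAt_const.sub h1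
      have ht : ∀ k, ContDiffAt ℝ ∞ (fun w => unitonCoeffs B i (e.symm w) k) (e p) := fun k =>
        (h.smooth k).contDiffAt he hp
      cases k with
      | zero =>
        refine (contDiffAt_op_mul (ht 0) h1).congr_of_eventuallyEq (Eventually.of_forall fun w => ?_)
        exact etaCoeffs_succ_zero i
      | succ k =>
        refine ((contDiffAt_op_mul (ht (k + 1)) h1).add
          (contDiffAt_op_mul (ht k) h2)).congr_of_eventuallyEq (Eventually.of_forall fun w => ?_)
        exact etaCoeffs_succ_succ i k
    refine ⟨hU _, hone _, hsmooth, fun e he p hp => ?_⟩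
    obtain ⟨A, hA⟩ := h.ext e he p hp
    have hcond := fun σ s₁ s₂ => hB.uniton_conditions hi he hp hA (σ := σ) (s₁ := s₁) (s₂ := s₂)
    obtain ⟨a, c, hac, ha, hc⟩ := hA
    set π : ℂ → End n := fun w => proj (unitonOf B (i + 1) (e.symm w)) with hπ
    obtain ⟨D, D', hD⟩ : ∃ D D', HasW π D D' (e p) := (SmoothMap.contDiffAt hs he hp).hasW
    have hDD : D = star D' := by
      refine (hD.unique (hD.star_op.congr (Eventually.of_forall fun w => ?_))).1
      exact (star_proj _).symm
    set q := π (e p) with hq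
    have hqq : q * q = q := proj_mul_proj _
    have hDq : D * q + q * D = D := by
      refine ((hD.mul hD).unique (hD.congr (Eventually.of_forall fun w => ?_))).1
      exact proj_mul_proj _
    have hpe : unitonOf B (i + 1) (e.symm (e p)) = unitonOf B (i + 1) p := by rw [e.left_inv hp]
    have hcond' : ∀ v, q (D' v - star A (q v)) = D' v - star A (q v) ∧ q (A (q v)) = A (q v) := by
      intro v
      have := hcond (fun w => π w v) _ _ (hD.clm_apply (hasW_const v _))
        (Eventually.of_forall fun w => proj_mem _ v)
      rw [map_zero, add_zero, ← hpe] at this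
      exact ⟨proj_eq_self_iff.mpr this.1, proj_eq_self_iff.mpr this.2⟩
    have hqA : q * A * q = A * q := by
      ext1 v; exact (hcond' v).2
    have hqs : star q = q := star_proj _
    -- This is the adjoint of the holomorphy condition `q (∂_z̄ q - A⁎ q) = ∂_z̄ q - A⁎ q`, since
    -- `∂_z q` is the adjoint of `∂_z̄ q`.
    have hH : D * q - q * A * q = D - q * A := by
      have h1 : q * (D' - star A * q) = D' - star A * q := by
        ext1 v; exact (hcond' v).1
      have h2 := congrArg star h1
      rw [star_mul, op_star_sub, star_mul, star_star, hqs, ← hDD, sub_mul] at h2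
      exact h2
    choose a' c' hac' using fun k => ((hsmooth k).contDiffAt he hp).hasW
    refine ⟨q * A * q + (1 - q) * A * (1 - q) - (1 - q) * D, extAt_of_dz hac'
      (Eventually.of_forall fun w => hU _ _) fun l => ?_⟩
    have hl := Circle.coe_ne_zero l
    have h1 : HasW (fun w => π w + (l : ℂ) • (1 - π w)) (D + (l : ℂ) • (0 - D))
        (D' + (l : ℂ) • (0 - D')) (e p) :=
      hD.add (((hasW_const (1 : End n) _).sub hD).const_smul _)
    have h2 := (hasW_polyLoop (d := i) hac l).mul h1
    have hfac : ∀ w, polyLoop (i + 1) (unitonCoeffs B (i + 1) (e.symm w)) l =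
        polyLoop i (unitonCoeffs B i (e.symm w)) l * (π w + (l : ℂ) • (1 - π w)) := by
      intro w
      have := polyLoop_etaCoeffs_succ (V := unitonSeq fun j => B j (e.symm w)) i l
      rw [linFactor, proj_orthogonal] at this
      exact this
    have h3 := ((hasW_polyLoop (d := i + 1) hac' l).unique
      (h2.congr (Eventually.of_forall hfac))).1
    have h4 := uniton_algebra hqq hqA hDq hH (l : ℂ) hl
    rw [h3, ha l, zpow_neg_one]
    change _ = _ • (polyLoop (i + 1) (unitonCoeffs B (i + 1) (e.symm (e p))) l * _)
    rw [hfac (e p)]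
    have e5 : ∀ (P X Y Z W : End n) (c : ℂ), c • (X * Y) + Z = c • (Y * W) →
        c • (P * X) * Y + P * Z = c • (P * Y * W) := by
      intro P X Y Z W c h
      rw [smul_mul_assoc, mul_assoc, ← mul_smul_comm, ← mul_add, h, mul_smul_comm, ← mul_assoc]
    exact e5 _ _ _ _ _ _ h4

lemma FiltrBundle.isUnitonFactorization (hB : FiltrBundle B) {Φ : M → Circle → End n}
    (hΦ : ∀ p z, Φ p z = polyLoop r (unitonCoeffs B r p) z) :
    IsUnitonFactorization r Φ (unitonOf B) := by
  have h : ∀ i, etaProd (unitonOf B) 0 i = fun p => polyLoop i (unitonCoeffs B i p) := fun i =>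
    funext fun p => etaProd_eq_polyLoop i p
  refine ⟨fun p z => by rw [h, hΦ], fun i hi => ?_⟩
  rw [h]
  exact hB.isUniton hi (hB.extCoeffs hi.le)

end

end UnitonTheory

namespace UnitonTheory

noncomputable section

set_option linter.unusedSectionVars false

variable {r n : ℕ}

/-! ### The alternating filtration at a point -/

lemma numUhl_self (a : FirstStep) (r : ℕ) : numUhl a r r = 0 := by
  cases a <;> simp [numUhl]

/-- The filtration needs only this bound, which gives `W_{i+1} ⊆ W_i`, and `numUhl_le_succ`, which
gives `λ W_i ⊆ W_{i+1}`. -/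
lemma numUhl_succ_le (a : FirstStep) (r i : ℕ) : numUhl a r (i + 1) ≤ numUhl a r i := by
  cases a <;> simp only [numUhl] <;> omega

lemma numUhl_le_succ (a : FirstStep) {r i : ℕ} (hi : i < r) :
    numUhl a r i ≤ numUhl a r (i + 1) + 1 := by
  cases a <;> simp only [numUhl] <;> omega

/-- An even number of alternating steps contains equally many of both kinds, whichever comes first.
This is the degree relation required for Lagrangian reduction. -/
lemma add_two_mul_numUhl (a : FirstStep) {r i : ℕ} (hi : i ≤ r) (h : Even (r - i)) :
    i + 2 * numUhl a r i = r := by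
  obtain ⟨k, hk⟩ := h
  cases a <;> simp only [numUhl] <;> omega

lemma mem_comap_shJ {B : Submodule ℂ (Jet r n)} {u : ℕ} {x : Jet r n} :
    x ∈ B.comap (shJ u) ↔ shJ u x ∈ B := Iff.rfl

lemma shJ_mem_of_le {B : Submodule ℂ (Jet r n)} (hB : ∀ x ∈ B, shJ 1 x ∈ B) {u v : ℕ} (h : u ≤ v)
    {x : Jet r n} (hx : shJ u x ∈ B) : shJ v x ∈ B := by
  induction v, h using Nat.le_induction with
  | base => exact hx
  | succ v _ ih => rw [add_comm, ← shJ_shJ]; exact hB _ ih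

lemma shJ_one_mem_posJ {i : ℕ} {x : Jet r n} (hx : x ∈ posJ r n i) : shJ 1 x ∈ posJ r n (i + 1 : ℕ) := by
  have := shJ_mem_posJ (k := 1) hx
  exact_mod_cast this

lemma altJ_zero (B : Submodule ℂ (Jet r n)) (u : ℕ) : altJ B u 0 = ⊤ := by
  rw [altJ, Nat.cast_zero, posJ_zero, sup_top_eq]

lemma altJ_self (B : Submodule ℂ (Jet r n)) : altJ B 0 r = B := by
  rw [altJ, posJ_self, sup_bot_eq]
  ext x
  rw [mem_comap_shJ, shJ_zero]

lemma altJ_le {B : Submodule ℂ (Jet r n)} (hB : ∀ x ∈ B, shJ 1 x ∈ B) (a : FirstStep) (i : ℕ) :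
    altJ B (numUhl a r (i + 1)) (i + 1) ≤ altJ B (numUhl a r i) i :=
  sup_le_sup (fun _ hx => shJ_mem_of_le hB (numUhl_succ_le a r i) hx)
    (posJ_mono (by push_cast; omega))

lemma shJ_one_mem_altJ {B : Submodule ℂ (Jet r n)} (hB : ∀ x ∈ B, shJ 1 x ∈ B) (a : FirstStep)
    {i : ℕ} (hi : i < r) {x : Jet r n} (hx : x ∈ altJ B (numUhl a r i) i) :
    shJ 1 x ∈ altJ B (numUhl a r (i + 1)) (i + 1) := by
  obtain ⟨y, hy, z, hz, rfl⟩ := Submodule.mem_sup.mp hx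
  rw [map_add]
  refine Submodule.add_mem_sup ?_ (shJ_one_mem_posJ hz)
  rw [mem_comap_shJ, shJ_shJ]
  exact shJ_mem_of_le hB (numUhl_le_succ a hi) hy

lemma comap_WS_shift {d : ℕ} (hd : d ≤ r) {T : ℕ → End n} :
    ∀ x ∈ (WS d T).comap (ext : Jet r n →ₗ[ℂ] Sq n),
      shJ 1 x ∈ (WS d T).comap (ext : Jet r n →ₗ[ℂ] Sq n) := by
  intro x hx
  change ext (tr r (sh _ (ext x))) ∈ WS d T
  rw [mem_iff_ext_tr_mem ((pos_mono (by exact_mod_cast hd)).trans pos_le_WS)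
    (sh_ext_mem_pos (by norm_num) x)]
  exact sh_mem_WS (by norm_num) hx

/-- Spaces of sequences between `H_+` and `λ^r H_+` are determined by their jets. -/
lemma eq_of_comap_ext_eq {W W' : Submodule ℂ (Sq n)} (h1 : pos n r ≤ W) (h2 : W ≤ pos n 0)
    (h1' : pos n r ≤ W') (h2' : W' ≤ pos n 0)
    (h : W.comap (ext : Jet r n →ₗ[ℂ] Sq n) = W'.comap ext) : W = W' := by
  have key : ∀ f ∈ pos n 0, f ∈ W ↔ f ∈ W' := by
    intro f hf
    rw [← mem_iff_ext_tr_mem h1 hf, ← mem_iff_ext_tr_mem h1' hf]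
    change tr r f ∈ W.comap ext ↔ tr r f ∈ W'.comap ext
    rw [h]
  ext f
  exact ⟨fun hf => (key f (h2 hf)).mp hf, fun hf => (key f (h2' hf)).mpr hf⟩

lemma pos_le_WS' {d : ℕ} (hd : d ≤ r) {T : ℕ → End n} : pos n r ≤ WS d T :=
  (pos_mono (by exact_mod_cast hd)).trans pos_le_WS

/-! ### The alternating filtration of an extended solution -/

variable {M : Type*} [TopologicalSpace M] [ChartedSpace ℂ M] [IsManifold 𝓘(ℂ, ℂ) ω M]

lemma MeroBundle.comap {V : Type*} [NormedAddCommGroup V] [NormedSpace ℂ V]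
    [FiniteDimensional ℂ V] {B : M → Submodule ℂ V} (h : MeroBundle B) (A : V →ₗ[ℂ] V) :
    MeroBundle fun p => (B p).comap A := fun e he p hp => (h e he p hp).comap A

lemma MeroBundle.sup {V : Type*} [NormedAddCommGroup V] [NormedSpace ℂ V]
    [FiniteDimensional ℂ V] {B : M → Submodule ℂ V} (h : MeroBundle B) (J : Submodule ℂ V) :
    MeroBundle fun p => B p ⊔ J := fun e he p hp => (h e he p hp).sup J

lemma MeroBundle.inf {V : Type*} [NormedAddCommGroup V] [NormedSpace ℂ V]
    [FiniteDimensional ℂ V] {B : M → Submodule ℂ V} (h : MeroBundle B) (J : Submodule ℂ V) :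
    MeroBundle fun p => B p ⊓ J := fun e he p hp => (h e he p hp).inf J

/-- At all points off a discrete set, a meromorphic bundle is holomorphic. -/
lemma MeroBundle.eventually_holAt [T1Space M] {V : Type*} [NormedAddCommGroup V] [NormedSpace ℂ V]
    [CompleteSpace V] {B : M → Submodule ℂ V} (h : MeroBundle B) :
    ∀ᶠ p in codiscrete M, ∀ e ∈ holCharts M, p ∈ e.source →
      HolAt (fun z => B (e.symm z)) (e p) := by
  obtain ⟨B', hB', hBB'⟩ := exists_fill h
  filter_upwards [eventually_codiscrete_nhds hBB'] with p hp e he hpe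
  exact (hB' e he p hpe).congr (eventuallyEq_chart (hp.mono fun q hq => hq.symm) hpe)

/-- The terms of the alternating filtration may jump on a discrete set, so they are replaced by
their holomorphic continuations. The relations between them hold off a discrete set and persist
everywhere. -/
lemma exists_filtrBundle [T1Space M] {T : M → ℕ → End n} (h : ExtCoeffs r T) (a : FirstStep) :
    ∃ B : ℕ → M → Submodule ℂ (Jet r n), FiltrBundle B ∧
      (∀ i ≤ r, ∀ᶠ p in codiscrete M,
        B i p = altJ ((WS r (T p)).comap ext) (numUhl a r i) i) ∧
      ∀ p, B r p = (WS r (T p)).comap ext := by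
  set B₀ : M → Submodule ℂ (Jet r n) := fun p => (WS r (T p)).comap ext with hB₀
  have hol₀ : HolBundle B₀ := h.holBundle le_rfl
  have hN₀ : ∀ p, ∀ x ∈ B₀ p, shJ 1 x ∈ B₀ p := fun p => comap_WS_shift le_rfl
  have hm : ∀ i, MeroBundle fun p => altJ (B₀ p) (numUhl a r i) i := fun i =>
    (hol₀.meroBundle.comap (shJ (numUhl a r i))).sup _
  choose B hB hBe using fun i => exists_fill (hm i)
  have hfil : ∀ p, IsFiltr fun i => B i p := by
    intro p
    refine ⟨?_, fun i hi => ?_, fun i hi => ?_⟩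
    · have : B 0 = fun _ => ⊤ := (hB 0).eq (HolBundle.const ⊤)
        ((hBe 0).mono fun q hq => by rw [hq, altJ_zero])
      exact congrFun this p
    · refine (hB (i + 1)).le (hB i) ?_ p
      filter_upwards [hBe i, hBe (i + 1)] with q h1 h2
      rw [h1, h2]
      exact altJ_le (hN₀ q) a i
    · refine (hB i).map_mem (hB (i + 1)) (shL r n 1) ?_ p
      filter_upwards [hBe i, hBe (i + 1)] with q h1 h2 x hx
      rw [h2]
      rw [h1] at hx
      exact shJ_one_mem_altJ (hN₀ q) a hi hx
  -- The last term needs no modification, because `W` itself is holomorphic at every point.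
  have hlast : B r = B₀ := (hB r).eq hol₀ ((hBe r).mono fun q hq => by
    rw [hq, numUhl_self, altJ_self])
  refine ⟨B, ⟨fun i _ => hB i, fun i hi => ?_, hfil⟩, fun i _ => hBe i, congrFun hlast⟩
  have hNi : ∀ p, ∀ x ∈ B i p, shL r n 1 x ∈ B i p := by
    intro p x hx
    rcases hi.lt_or_eq with hi | rfl
    · exact (hfil p).le i hi ((hfil p).shift i hi x hx)
    · rw [hlast] at hx ⊢
      exact hN₀ p x hx
  refine (hB i).dClosed hNi ?_
  have hc := (hol₀.meroBundle.comap (shJ (numUhl a r i)))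
  filter_upwards [eventually_codiscrete_nhds (hBe i), hc.eventually_holAt,
    (hm i).eventually_holAt] with p h1 h2 h3 e he hp
  have hcomm : ∀ x : Jet r n, shL r n (numUhl a r i) (shL r n 1 x) =
      shL r n 1 (shL r n (numUhl a r i) x) := fun x => by
    simp only [shL_apply, shJ_shJ, add_comm]
  -- Multiplication by `λ^u` is constant in `z` and commutes with `λ`, so the preimage of `W` under
  -- it stays closed under `λ ∂_z`. Adding the constant space `λ^i H_+` preserves this.
  have hd := DCAt.comap (A := shL r n (numUhl a r i)) hcomm (h.dClosed le_rfl e he p hp)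
  refine DCAt.congr (hd.sup (h2 e he hp) (h3 e he hp) (fun x hx => ?_) fun x hx => ?_)
    (eventuallyEq_chart h1 hp)
  · change shL r n (numUhl a r i) (shL r n 1 x) ∈ B₀ (e.symm (e p))
    rw [hcomm]
    exact hN₀ _ _ hx
  · exact posJ_mono (by push_cast; omega) (shJ_one_mem_posJ hx)

lemma polyLoop_unitonCoeffs {T : ℕ → End n} (hU : UnitaryCoeffs r T) (h1 : polyLoop r T 1 = 1)
    {B : ℕ → M → Submodule ℂ (Jet r n)} (hB : FiltrBundle B) {p : M}
    (hp : B r p = (WS r T).comap ext) : polyLoop r T = polyLoop r (unitonCoeffs B r p) := by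
  have hU' : UnitaryCoeffs r (unitonCoeffs B r p) := unitaryCoeffs_etaCoeffs _ r
  refine polyLoop_eq_of_WS_eq_of_one hU hU' ?_ h1 ((hB.extCoeffs le_rfl).one p)
  refine eq_of_comap_ext_eq (r := r) pos_le_WS hU.WS_le_pos pos_le_WS hU'.WS_le_pos ?_
  rw [← hp]
  exact ((hB.filtr p).comap_ext_WS le_rfl).symm

lemma WS_unitonCoeffs {B : ℕ → M → Submodule ℂ (Jet r n)} (hB : FiltrBundle B) {p : M} {i : ℕ}
    (hi : i ≤ r) {W : Submodule ℂ (Sq n)} (hW : pos n r ≤ W) {u : ℕ}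
    (hp : B i p = altJ (W.comap ext) u i) : WS i (unitonCoeffs B i p) = altS W u i := by
  have hU' : UnitaryCoeffs i (unitonCoeffs B i p) := unitaryCoeffs_etaCoeffs _ i
  refine eq_of_comap_ext_eq (r := r) (pos_le_WS' hi) hU'.WS_le_pos (pos_le_altS hi) altS_le_pos ?_
  rw [comap_ext_altS hW, ← hp]
  exact (hB.filtr p).comap_ext_WS hi

/-! ### Reality and invariance -/

lemma continuous_polyLoop {d : ℕ} {T : M → ℕ → End n} (h : ExtCoeffs d T) (z : Circle) :
    Continuous fun p => polyLoop d (T p) z := by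
  refine continuous_finsetSum _ fun k _ => ?_
  exact (ContMDiff.continuous (h.smooth k)).const_smul ((z : ℂ) ^ k)

lemma eq_of_eventually_codiscrete {F : Type*} [TopologicalSpace F] [T2Space F] {f g : M → F}
    (hf : Continuous f) (hg : Continuous g) (h : ∀ᶠ p in codiscrete M, f p = g p) (p : M) :
    f p = g p := by
  have := nhdsNE_neBot p
  exact eq_of_eventuallyEq_nhdsNE hf.continuousAt hg.continuousAt
    (eventually_codiscrete_iff.mp h p)

lemma continuous_conjOp : Continuous (conjOp : End n → End n) := by
  let L : End n →ₗ[ℝ] End n :=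
    { toFun := conjOp
      map_add' := conjOp_add
      map_smul' := fun c A => by
        have h := conjOp_smul (c : ℂ) A
        rw [Complex.conj_ofReal] at h
        exact h }
  have : FiniteDimensional ℝ (End n) := FiniteDimensional.complexToReal (End n)
  exact L.continuous_of_finiteDimensional

/-- The reality condition for a loop of degree `d`. -/
def IsReal (d : ℕ) (γ : Circle → End n) : Prop :=
  ∀ z : Circle, conjOp (γ z) = ((z : ℂ) ^ d)⁻¹ • γ z

/-- Off a discrete set the model of `Φ_i` is a Lagrangian reduction of `W`; at the remaining points
reality follows by continuity. -/
lemma isReal_unitonCoeffs {T : M → ℕ → End n} (h : ExtCoeffs r T) {a : FirstStep}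
    {B : ℕ → M → Submodule ℂ (Jet r n)} (hB : FiltrBundle B)
    (hBe : ∀ i ≤ r, ∀ᶠ p in codiscrete M,
        B i p = altJ ((WS r (T p)).comap ext) (numUhl a r i) i)
    (hreal : ∀ p, IsReal r (polyLoop r (T p))) {i : ℕ} (hi : i ≤ r) (he : Even (r - i)) (p : M) :
    IsReal i (polyLoop i (unitonCoeffs B i p)) := by
  intro z
  have hE := hB.extCoeffs hi
  refine eq_of_eventually_codiscrete (f := fun p => conjOp (polyLoop i (unitonCoeffs B i p) z))
    (g := fun p => ((z : ℂ) ^ i)⁻¹ • polyLoop i (unitonCoeffs B i p) z)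
    (continuous_conjOp.comp (continuous_polyLoop hE z))
    ((continuous_polyLoop hE z).const_smul (((z : ℂ) ^ i)⁻¹)) ?_ p
  filter_upwards [hBe i hi] with q hq
  refine real_of_isLagr (hE.unitary q) (hE.one q) ?_ z
  rw [WS_unitonCoeffs hB hi pos_le_WS hq]
  exact (isLagr_of_real (h.unitary q) (hreal q)).altS pos_le_WS (h.unitary q).WS_le_pos
    (add_two_mul_numUhl a hi he)

lemma nuInv_unitonCoeffs {T : M → ℕ → End n} (h : ExtCoeffs r T) {a : FirstStep}
    {B : ℕ → M → Submodule ℂ (Jet r n)} (hB : FiltrBundle B)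
    (hBe : ∀ i ≤ r, ∀ᶠ p in codiscrete M,
        B i p = altJ ((WS r (T p)).comap ext) (numUhl a r i) i)
    (hnu : ∀ p, nuInv (polyLoop r (T p)) = polyLoop r (T p)) {i : ℕ} (hi : i ≤ r) (p : M) :
    nuInv (polyLoop i (unitonCoeffs B i p)) = polyLoop i (unitonCoeffs B i p) := by
  funext z
  have hE := hB.extCoeffs hi
  refine eq_of_eventually_codiscrete (f := fun p => nuInv (polyLoop i (unitonCoeffs B i p)) z)
    (g := fun p => polyLoop i (unitonCoeffs B i p) z) ?_ (continuous_polyLoop hE z) ?_ p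
  · exact (continuous_polyLoop hE (-z)).mul
      (contDiff_star_op.continuous.comp (continuous_polyLoop hE (-1)))
  · filter_upwards [hBe i hi] with q hq
    refine congrFun (nu_of_isTau (hE.unitary q) (hE.one q) ?_) z
    rw [WS_unitonCoeffs hB hi pos_le_WS hq]
    exact (isTau_of_nu (h.unitary q) (hnu q)).altS _ _

lemma isReal_etaProd {α : ℕ → M → Submodule ℂ (E n)} {a k : ℕ} {p : M}
    (h1 : IsReal a (etaProd α 0 a p)) (h2 : IsReal (a + k) (etaProd α 0 (a + k) p)) :
    IsReal k (etaProd α a k p) := by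
  intro z
  have h3 := h2 z
  rw [etaProd_add, conjOp_mul, h1 z] at h3
  have hz := Circle.coe_ne_zero z
  set X := etaProd α 0 a p z
  have hX : star X * X = 1 := (etaProd_mem_unitary (α := α) 0 a p z).1
  have h4 := congrArg (fun Y => (z : ℂ) ^ a • (star X * Y)) h3
  have e : ∀ (c d f : ℂ) (Y Z : End n), c • (star X * (d • X * Y)) = c • (star X * (f • (X * Z))) →
      (c * d) • Y = (c * f) • Z := by
    intro c d f Y Z h
    rw [smul_mul_assoc, mul_smul_comm, mul_smul_comm, ← mul_assoc, ← mul_assoc, hX, one_mul,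
      one_mul, smul_smul, smul_smul] at h
    exact h
  have h5 := e _ _ _ _ _ h4
  rw [mul_inv_cancel₀ (pow_ne_zero a hz), pow_add, mul_inv, ← mul_assoc,
    mul_inv_cancel₀ (pow_ne_zero a hz), one_mul] at h5
  have h6 : ∀ Y : End n, (1 : ℂ) • Y = Y := one_smul ℂ
  rw [h6] at h5
  exact h5

/-! ### The filtration formula -/

lemma coe_toH (l : ℕ) (x : Jet r n) :
    ((Jet.toH l x : H n) : ∀ _ : ℤ, E n) = sh l (ext x) := by
  funext j
  rw [Jet.toH, sh_apply, ext_apply]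
  have h1 : (((∑ i : Fin r, lp.single 2 ((i : ℤ) + (l : ℤ)) (x i) : H n) : ∀ _ : ℤ, E n)) j =
      ∑ i : Fin r, (lp.single (E := fun _ : ℤ => E n) 2 ((i : ℤ) + (l : ℤ)) (x i)) j := by
    rw [lp.coeFn_sum, Finset.sum_apply]
  rw [h1]
  by_cases hj : 0 ≤ j - l ∧ j - l < r
  · rw [Jet.coeff, dif_pos hj, Finset.sum_eq_single_of_mem ⟨(j - l).toNat, by omega⟩
      (Finset.mem_univ _)]
    · rw [lp.single_apply, Pi.single_apply, if_pos]
      simp only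
      omega
    · intro i _ hi
      rw [lp.single_apply, Pi.single_eq_of_ne]
      rintro h
      apply hi
      ext
      simp
      omega
  · rw [Jet.coeff, dif_neg hj]
    refine Finset.sum_eq_zero fun i _ => ?_
    rw [lp.single_apply, Pi.single_eq_of_ne]
    rintro h
    have := i.2
    omega

lemma exists_of_mem_altS {W : Submodule ℂ (Sq n)} {u i : ℕ} (hi : i ≤ r) (hW : pos n r ≤ W)
    {f : Sq n} (hf : f ∈ altS W u i) :
    ∃ y : Jet r n, sh u (ext y) ∈ W ∧ f - ext y ∈ pos n i := by
  obtain ⟨g, hg, k, hk, hgk⟩ := Submodule.mem_sup.mp hf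
  obtain ⟨h1, h2⟩ := Submodule.mem_inf.mp hg
  have hd : g - ext (tr r g) ∈ pos n r := sub_ext_tr_mem_pos h2
  refine ⟨tr r g, ?_, ?_⟩
  · have h3 : sh u (ext (tr r g)) = sh u g - sh u (g - ext (tr r g)) := by
      rw [map_sub, sub_sub_cancel]
    rw [h3]
    exact Submodule.sub_mem _ h1 (hW (sh_mem_pos.mpr (pos_mono (by omega) hd)))
  · have h3 : f - ext (tr r g) = (g - ext (tr r g)) + k := by rw [← hgk]; abel
    rw [h3]
    exact Submodule.add_mem _ (pos_mono (by omega) hd) hk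

lemma mem_altStep_iff {γ : Circle → End n} {T : ℕ → End n} (hγ : ∀ z, γ z = polyLoop r T z)
    (hU : UnitaryCoeffs r T) (a : FirstStep) {i : ℕ} (hi : i ≤ r) (w : H n) :
    w ∈ altStep a r i (grassModel γ) ↔
      (w : ∀ _ : ℤ, E n) ∈ altS (WS r T) (numUhl a r i) i := by
  set u := numUhl a r i
  have hlam : ∀ f : H n, f ∈ lamMul (-(u : ℤ)) (grassModel γ) ↔
      (f : ∀ _ : ℤ, E n) ∈ (WS r T).comap (sh (u : ℤ)) := by
    intro f
    constructor
    · rintro ⟨g, hg, h⟩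
      have hgW := (mem_grassModel_iff hγ hU g).mp hg
      have hfg : sh (u : ℤ) (f : ∀ _ : ℤ, E n) = (g : ∀ _ : ℤ, E n) := by
        funext j
        rw [sh_apply, h, show j - u - -(u : ℤ) = j by ring]
      change sh (u : ℤ) (f : ∀ _ : ℤ, E n) ∈ WS r T
      rwa [hfg]
    · intro hf
      have hm : Memℓp (fun j : ℤ => (f : ∀ _ : ℤ, E n) (j - u)) 2 :=
        memℓp_comp_shift 1 (-(u : ℤ)) f
      refine ⟨⟨_, hm⟩, (mem_grassModel_iff hγ hU _).mpr hf, fun j => ?_⟩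
      change f j = f (j - -(u : ℤ) - u)
      rw [show j - -(u : ℤ) - u = j by ring]
  constructor
  · intro h
    obtain ⟨f, ⟨hf, hf0⟩, g, hg, rfl⟩ := Submodule.mem_sup.mp h
    exact Submodule.add_mem_sup (S := (WS r T).comap (sh (u : ℤ)) ⊓ pos n 0)
      (T := pos n i) ⟨(hlam f).mp hf, hf0⟩ hg
  · intro h
    -- The summands of a formal decomposition need not be square-summable, so the first is replaced
    -- by its truncation, a polynomial.
    obtain ⟨y, hy, hwy⟩ := exists_of_mem_altS hi pos_le_WS h
    obtain ⟨A, hA⟩ : ∃ A : H n, (A : ∀ _ : ℤ, E n) = ext y :=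
      ⟨Jet.toH 0 y, by rw [coe_toH, Nat.cast_zero, sh_zero]⟩
    have hA1 : A ∈ lamMul (-(u : ℤ)) (grassModel γ) ⊓ hPlus n 0 := by
      refine Submodule.mem_inf.mpr ⟨(hlam A).mpr (by rw [hA]; exact hy), fun j hj => ?_⟩
      rw [hA]
      exact ext_mem_pos _ j hj
    have hA2 : w - A ∈ hPlus n i := by
      intro j hj
      have h1 : (w - A) j = ((w : ∀ _ : ℤ, E n) - ext y) j := by
        rw [← hA]; rfl
      rw [h1]
      exact hwy j hj
    have := Submodule.add_mem_sup hA1 hA2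
    rwa [add_sub_cancel] at this

lemma givenByFiltration {T : M → ℕ → End n} (h : ExtCoeffs r T) {Φ : M → Circle → End n}
    (hΦ : ∀ p z, Φ p z = polyLoop r (T p) z) {a : FirstStep}
    {B : ℕ → M → Submodule ℂ (Jet r n)}
    (hBe : ∀ i ≤ r, ∀ᶠ p in codiscrete M,
        B i p = altJ ((WS r (T p)).comap ext) (numUhl a r i) i) :
    GivenByFiltration a r (fun p => grassModel (Φ p)) (unitonOf B) := by
  intro i hi
  obtain ⟨i, rfl⟩ : ∃ j, i = j + 1 := ⟨i - 1, by have := (Finset.mem_Icc.mp hi).1; omega⟩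
  have hir : i + 1 ≤ r := (Finset.mem_Icc.mp hi).2
  filter_upwards [hBe (i + 1) hir] with p hp
  have hmem : ∀ w : H n, w ∈ altStep a r (i + 1) (grassModel (Φ p)) ↔
      (w : ∀ _ : ℤ, E n) ∈ pos n 0 ∧ tr r (w : ∀ _ : ℤ, E n) ∈ B (i + 1) p := by
    intro w
    rw [mem_altStep_iff (hΦ p) (h.unitary p) a hir, hp, ← comap_ext_altS pos_le_WS]
    constructor
    · intro hw
      exact ⟨altS_le_pos hw, (mem_iff_ext_tr_mem (pos_le_altS hir) (altS_le_pos hw)).mpr hw⟩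
    · rintro ⟨h1, h2⟩
      exact (mem_iff_ext_tr_mem (pos_le_altS hir) h1).mp h2
  have hval : ∀ w : H n, (w : ∀ _ : ℤ, E n) ∈ pos n 0 →
      evA r (unitonSeq fun j => B j p) i (tr r (w : ∀ _ : ℤ, E n)) =
      ∑ s ∈ Finset.range (i + 1), invCoeff (fun j => unitonOf B j p) i s (w (s : ℤ)) := by
    intro w hw
    rw [evA_tr hir hw, divS_etaCoeffs_apply]
    simp only [zero_add]
    rfl
  ext x
  change x ∈ unitonSeq _ (i + 1) ↔ _
  rw [unitonSeq_succ]
  constructor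
  · rintro ⟨y, hy, rfl⟩
    have hco : ((Jet.toH 0 y : H n) : ∀ _ : ℤ, E n) = ext y := by
      rw [coe_toH, Nat.cast_zero, sh_zero]
    have hpos : ((Jet.toH 0 y : H n) : ∀ _ : ℤ, E n) ∈ pos n 0 := by
      rw [hco]; exact ext_mem_pos y
    refine ⟨Jet.toH 0 y, (hmem _).mpr ⟨hpos, ?_⟩, ?_⟩
    · rw [hco, tr_ext]; exact hy
    · rw [add_tsub_cancel_right, ← hval _ hpos, hco, tr_ext]
  · rintro ⟨w, hw, rfl⟩
    obtain ⟨h1, h2⟩ := (hmem w).mp hw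
    exact ⟨_, h2, hval w h1⟩

end

end UnitonTheory

namespace UnitonTheory

noncomputable section

set_option linter.unusedSectionVars false

variable {n : ℕ}

/-! ### Maximal isotropic subspaces -/

/-- At `λ = -1` the linear factor is `2π - 1`, and reality of degree one says that conjugation
changes its sign. -/
lemma conjOp_proj_of_isReal {U : Submodule ℂ (E n)} (h : IsReal 1 (linFactor U)) :
    conjOp (proj U) = 1 - proj U := by
  have h1 := h (-1)
  have hval : ((-1 : Circle) : ℂ) = -1 := rfl
  have h2 : linFactor U (-1) = proj U - (1 - proj U) := by
    rw [linFactor, hval, proj_orthogonal]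
    module
  have h3 : ∀ X : End n, ((-1 : ℂ) ^ 1)⁻¹ • X = -X := by
    intro X
    rw [show ((-1 : ℂ) ^ 1)⁻¹ = -1 by norm_num]
    exact neg_one_smul ℂ X
  rw [hval, h3, h2] at h1
  have h4 : conjOp (proj U - (1 - proj U)) = conjOp (proj U) + conjOp (proj U) - 1 := by
    have e : (proj U - (1 - proj U)) + 1 = proj U + proj U := by abel
    have := congrArg conjOp e
    rw [conjOp_add, conjOp_add, conjOp_one] at this
    rw [← this, add_sub_cancel_right]
  rw [h4] at h1
  have h5 : (2 : ℂ) • conjOp (proj U) = (2 : ℂ) • (1 - proj U) := by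
    have e2 : ∀ X : End n, (2 : ℂ) • X = X + X := fun X => two_smul ℂ X
    rw [e2, e2, eq_add_of_sub_eq h1]
    abel
  exact smul_right_injective _ (two_ne_zero (α := ℂ)) h5

lemma conjV_mem_orthogonal {U : Submodule ℂ (E n)} (h : conjOp (proj U) = 1 - proj U) {v : E n}
    (hv : v ∈ U) : proj U (conjV v) = 0 := by
  have h1 := DFunLike.congr_fun h (conjV v)
  rw [conjOp_apply, conjV_conjV, proj_eq_self_iff.mpr hv, sub_apply] at h1
  have h2 : conjV v = conjV v - proj U (conjV v) := h1
  exact sub_eq_self.mp h2.symm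

/-- Conjugation exchanges `U` and `U^⊥`, so `U` is isotropic. If `v` lies in an isotropic `V ⊇ U`
and `w = v - π v`, then `conj w ∈ U`, so `|w|² = conj w ⬝ w = 0` and `v ∈ U`. -/
lemma maximal_isIsotropic {U : Submodule ℂ (E n)} (h : conjOp (proj U) = 1 - proj U) :
    Maximal IsIsotropic U := by
  refine ⟨fun v hv w hw => ?_, fun V hV hUV v hv => ?_⟩
  · change dotp v w = 0
    rw [dotp_eq_inner]
    have h1 : inner ℂ (proj U (conjV v)) w = inner ℂ (conjV v) (proj U w) := by
      rw [← ContinuousLinearMap.adjoint_inner_right, ← ContinuousLinearMap.star_eq_adjoint,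
        star_proj]
    rw [proj_eq_self_iff.mpr hw, conjV_mem_orthogonal h hv, inner_zero_left] at h1
    exact h1.symm
  · set w := v - proj U v with hw
    have hwU : proj U (conjV w) = conjV w := by
      have h1 := DFunLike.congr_fun h (conjV w)
      have h2 : proj U w = 0 := by
        rw [hw, map_sub, proj_eq_self_iff.mpr (proj_mem U v), sub_self]
      rw [conjOp_apply, conjV_conjV, h2] at h1
      have h3 : conjV (0 : E n) = conjV w - proj U (conjV w) := h1
      have h4 : conjV (0 : E n) = 0 := by
        have := conjV_smul (0 : ℂ) (0 : E n)
        simpa using this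
      rw [h4] at h3
      exact (sub_eq_zero.mp h3.symm).symm
    have hcw : conjV w ∈ U := proj_eq_self_iff.mp hwU
    have h1 : dotp (conjV w) v = 0 := hV _ (hUV hcw) v hv
    have h2 : dotp (conjV w) (proj U v) = 0 := hV _ (hUV hcw) _ (hUV (proj_mem U v))
    have h3 : dotp (conjV w) w = 0 := by rw [hw, map_sub, ← hw, h1, h2, sub_zero]
    rw [dotp_eq_inner, conjV_conjV, inner_self_eq_zero] at h3
    rw [h3] at hw
    rw [sub_eq_zero.mp hw.symm]
    exact proj_mem U v

/-! ### The orthogonal complex structure of a maximal isotropic subspace -/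

/-- The matrix of an operator. -/
abbrev opMatrix (A : End n) : Matrix (Fin n) (Fin n) ℂ :=
  (Matrix.toEuclideanCLM (n := Fin n) (𝕜 := ℂ)).symm A

lemma opMatrix_apply (A : End n) (i j : Fin n) :
    opMatrix A i j = A (EuclideanSpace.single j 1) i := by
  have hA : A = Matrix.toEuclideanCLM (n := Fin n) (𝕜 := ℂ) (opMatrix A) :=
    ((Matrix.toEuclideanCLM (n := Fin n) (𝕜 := ℂ)).apply_symm_apply A).symm
  have h1 := Matrix.toEuclideanCLM_toLp (opMatrix A) (Pi.single j 1)
  rw [← hA] at h1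
  change _ = (A (WithLp.toLp 2 (Pi.single j 1))) i
  rw [h1]
  simp

lemma opMatrix_star (A : End n) : opMatrix (star A) = star (opMatrix A) := by
  apply (Matrix.toEuclideanCLM (n := Fin n) (𝕜 := ℂ)).injective
  have h1 := (Matrix.toEuclideanCLM (n := Fin n) (𝕜 := ℂ)).map_star' (opMatrix A)
  refine Eq.trans ?_ h1.symm
  refine ((Matrix.toEuclideanCLM (n := Fin n) (𝕜 := ℂ)).apply_symm_apply (star A)).trans ?_
  exact congrArg star ((Matrix.toEuclideanCLM (n := Fin n) (𝕜 := ℂ)).apply_symm_apply A).symm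

lemma opMatrix_conjOp (A : End n) : opMatrix (conjOp A) = (opMatrix A).map conj := by
  ext i j
  rw [Matrix.map_apply, opMatrix_apply, opMatrix_apply, conjOp_apply, conjV_apply]
  have h : conjV (EuclideanSpace.single j (1 : ℂ)) = EuclideanSpace.single j 1 := by
    ext k
    rw [conjV_apply]
    by_cases hk : k = j
    · subst hk; simp
    · simp [hk]
  rw [h]

/-- The real matrix `-i π + i π̄`. -/
def ocsMatrix (U : Submodule ℂ (E n)) : Matrix (Fin n) (Fin n) ℝ :=
  (opMatrix (proj U)).map fun x => 2 * x.im

lemma ocsMatrix_map {U : Submodule ℂ (E n)} (h : conjOp (proj U) = 1 - proj U) :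
    (ocsMatrix U).map (fun x : ℝ => (x : ℂ)) =
      opMatrix (Complex.I • (1 - proj U) - Complex.I • proj U) := by
  have h1 : opMatrix (Complex.I • (1 - proj U) - Complex.I • proj U) =
      Complex.I • (opMatrix (proj U)).map conj - Complex.I • opMatrix (proj U) := by
    rw [← opMatrix_conjOp, h, opMatrix, map_sub, map_smul, map_smul]
  rw [h1]
  ext i j
  simp only [ocsMatrix, Matrix.map_apply, Matrix.sub_apply, Matrix.smul_apply, smul_eq_mul]
  apply Complex.ext <;> simp
  ring

/-- The complexification is `K = i(1 - 2π)`, which satisfies `K² = -1` and `K⁎ = -K`. The real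
matrix is therefore skew with square `-1`, hence orthogonal. -/
lemma ocsMatrix_spec {U : Submodule ℂ (E n)} (h : conjOp (proj U) = 1 - proj U) :
    ocsMatrix U ∈ Matrix.orthogonalGroup (Fin n) ℝ ∧ ocsMatrix U * ocsMatrix U = -1 := by
  set K : End n := Complex.I • (1 - proj U) - Complex.I • proj U with hK
  have hp : proj U * proj U = proj U := proj_mul_proj U
  have hKK : K * K = -1 := by
    have e : ∀ (R : Type) [Ring R] [Algebra ℂ R] (p : R), p * p = p →
        (Complex.I • (1 - p) - Complex.I • p) * (Complex.I • (1 - p) - Complex.I • p) = -1 := by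
      intro R _ _ p hp
      rw [← smul_sub, smul_mul_smul_comm, Complex.I_mul_I]
      have : (1 - p - p) * (1 - p - p) = 1 := by
        have : (1 - p - p) * (1 - p - p) = 1 - p - p - p - p + (p * p + p * p + p * p + p * p) := by
          noncomm_ring
        rw [this, hp]; abel
      rw [this, neg_one_smul]
    exact e (End n) (proj U) hp
  have hKs : star K = -K := by
    have e1 : ∀ (u : ℂ) (X : End n), star (u • X) = conj u • star X := fun u X => star_smul u X
    rw [hK, op_star_sub, e1, e1, op_star_sub, star_proj, star_one, Complex.conj_I]
    module
  have hinj : Function.Injective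
      (fun X : Matrix (Fin n) (Fin n) ℝ => X.map (fun x : ℝ => (x : ℂ))) :=
    Matrix.map_injective Complex.ofReal_injective
  have hmul : ∀ X Y : Matrix (Fin n) (Fin n) ℝ, (X * Y).map (fun x : ℝ => (x : ℂ)) =
      X.map (fun x : ℝ => (x : ℂ)) * Y.map (fun x : ℝ => (x : ℂ)) := fun X Y =>
    Matrix.map_mul (f := Complex.ofRealHom)
  have hone : (1 : Matrix (Fin n) (Fin n) ℝ).map (fun x : ℝ => (x : ℂ)) = 1 :=
    Matrix.map_one _ Complex.ofReal_zero Complex.ofReal_one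
  have hneg : ∀ X : Matrix (Fin n) (Fin n) ℝ, (-X).map (fun x : ℝ => (x : ℂ)) =
      -X.map (fun x : ℝ => (x : ℂ)) := fun X => by ext i j; simp
  have hsq : ocsMatrix U * ocsMatrix U = -1 := by
    apply hinj
    simp only
    rw [hmul, hneg, hone, ocsMatrix_map h, ← hK, opMatrix, ← map_mul, hKK, map_neg, map_one]
  have htr : (ocsMatrix U).transpose = -ocsMatrix U := by
    apply hinj
    simp only
    have h1 : (ocsMatrix U).transpose.map (fun x : ℝ => (x : ℂ)) =
        star ((ocsMatrix U).map (fun x : ℝ => (x : ℂ))) := by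
      ext i j
      simp [Matrix.star_apply]
    rw [h1, hneg, ocsMatrix_map h, ← hK, ← opMatrix_star, hKs, opMatrix, map_neg]
  refine ⟨?_, hsq⟩
  rw [Matrix.mem_orthogonalGroup_iff]
  change ocsMatrix U * (ocsMatrix U).transpose = 1
  rw [htr, mul_neg, hsq, neg_neg]

/-- The orthogonal complex structure with `(0,1)`-space `U`. -/
def ocs (U : Submodule ℂ (E n)) (h : conjOp (proj U) = 1 - proj U) : OrthCplxStr n :=
  ⟨ocsMatrix U, ocsMatrix_spec h⟩

lemma zeroOneSpace_ocs {U : Submodule ℂ (E n)} (h : conjOp (proj U) = 1 - proj U) :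
    zeroOneSpace (ocs U h) = U := by
  ext v
  rw [zeroOneSpace, Module.End.mem_eigenspace_iff]
  change Matrix.toEuclideanLin ((ocsMatrix U).map (fun x : ℝ => (x : ℂ))) v = _ ↔ _
  rw [ocsMatrix_map h]
  have h1 : Matrix.toEuclideanLin
      (opMatrix (Complex.I • (1 - proj U) - Complex.I • proj U)) v =
      (Complex.I • (1 - proj U) - Complex.I • proj U) v := by
    rw [← Matrix.coe_toEuclideanCLM_eq_toEuclideanLin, opMatrix, StarAlgEquiv.apply_symm_apply]
    rfl
  rw [h1]
  have h2 : (Complex.I • (1 - proj U) - Complex.I • proj U) v =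
      Complex.I • (v - proj U v) - Complex.I • proj U v := rfl
  rw [h2]
  constructor
  · intro h3
    have h4 : (2 * Complex.I) • (v - proj U v) = 0 := by
      have h5 : (2 * Complex.I) • (v - proj U v) =
        (Complex.I • (v - proj U v) - Complex.I • proj U v) - -Complex.I • v := by module
      rw [h5, h3, sub_self]
    have h6 := (smul_eq_zero.mp h4).resolve_left (by simp)
    exact proj_eq_self_iff.mp (sub_eq_zero.mp h6).symm
  · intro hv
    rw [proj_eq_self_iff.mpr hv]
    module

/-- Taking determinants in `J² = -1` gives `(det J)² = (-1)^n`, with `det J` real. -/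
lemma even_of_orthCplxStr (J : OrthCplxStr n) : ∃ m, n = 2 * m := by
  have h := congrArg Matrix.det J.2.2
  rw [Matrix.det_mul, Matrix.det_neg, Matrix.det_one, mul_one, Fintype.card_fin] at h
  rcases Nat.even_or_odd n with he | ho
  · obtain ⟨m, hm⟩ := he
    exact ⟨m, by omega⟩
  · rw [ho.neg_one_pow] at h
    nlinarith [mul_self_nonneg (Matrix.det J.1)]

/-! ### Holomorphic frames -/

variable {M : Type*} [TopologicalSpace M] [ChartedSpace ℂ M] [IsManifold 𝓘(ℂ, ℂ) ω M]

lemma HolBundle.isHolomorphicSubbundle {α : M → Submodule ℂ (E n)} (h : HolBundle α) :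
    IsHolomorphicSubbundle α := by
  intro p
  set e := chartAt ℂ p with he
  have hp : p ∈ e.source := mem_chart_source ℂ p
  obtain ⟨P, hP, hb⟩ := h e (chartAt_mem_holCharts p) p hp
  have hb : ∀ᶠ z in 𝓝 (e p), ProjOnto (P z) (α (e.symm z)) := hb
  set Q₀ := P (e p) with hQ₀
  have hQQ : Q₀ * Q₀ = Q₀ := hb.self_of_nhds.mul_self
  -- `G` is invertible near `e p` and maps the fibre at `p` onto nearby fibres. It agrees with `P`
  -- on a basis of the fibre at `p`, so the vectors `P β_a` form a holomorphic frame.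
  let G : ℂ → End n := fun w => P w * Q₀ + (1 - P w) * (1 - Q₀)
  have hG0 : G (e p) = 1 := by
    simp only [G]; rw [← hQ₀, sub_mul, one_mul, mul_sub, mul_one, hQQ]; abel
  have hGc : ContinuousAt G (e p) := (hP.continuousAt.mul continuousAt_const).add
    ((continuousAt_const.sub hP.continuousAt).mul continuousAt_const)
  have hGu : ∀ᶠ w in 𝓝 (e p), IsUnit (G w) :=
    hGc.eventually (Units.isOpen.mem_nhds (by rw [hG0]; exact isUnit_one))
  have hall := hP.eventually_analyticAt.and (hb.and hGu)
  rw [eventually_nhds_iff] at hall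
  obtain ⟨O, hO, hOo, hpO⟩ := hall
  let β := Module.finBasis ℂ (α p)
  have hβ : ∀ a, Q₀ (β a : E n) = β a := fun a => hb.self_of_nhds.2 _ (by
    rw [e.left_inv hp]; exact (β a).2)
  refine ⟨e.source ∩ e ⁻¹' O, e.isOpen_inter_preimage hOo, ⟨hp, hpO⟩, _,
    fun a q => P (e q) (β a), fun a q hq => ?_, fun q hq => ?_⟩
  · have h1 : MDifferentiableAt 𝓘(ℂ, ℂ) 𝓘(ℂ, E n) (fun w => P w (β a : E n)) (e q) :=
      (AnalyticAt.op_apply (hO _ hq.2).1 analyticAt_const).differentiableAt.mdifferentiableAt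
    have h2 : MDifferentiableAt 𝓘(ℂ, ℂ) 𝓘(ℂ, ℂ) e q :=
      (contMDiffAt_of_mem_maximalAtlas (chartAt_mem_holCharts p) hq.1).mdifferentiableAt (by simp)
    exact (h1.comp q h2).mdifferentiableWithinAt
  · obtain ⟨-, hpr, hu⟩ := hO _ hq.2
    rw [e.left_inv hq.1] at hpr
    have hGβ : ∀ a, G (e q) (β a : E n) = P (e q) (β a) := by
      intro a
      have : G (e q) (β a : E n) =
        P (e q) (Q₀ (β a)) + (1 - P (e q)) ((β a : E n) - Q₀ (β a)) := rfl
      rw [this, hβ, sub_self, map_zero, add_zero]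
    have hinj := ((ContinuousLinearMap.isUnit_iff_bijective).mp hu).1
    constructor
    · have h1 : LinearIndependent ℂ (fun a => (β a : E n)) :=
        β.linearIndependent.map' (α p).subtype (Submodule.ker_subtype _)
      have h2 := h1.map' (G (e q) : E n →ₗ[ℂ] E n) (LinearMap.ker_eq_bot.mpr hinj)
      have h3 : (fun a => P (e q) (β a : E n)) =
          (G (e q) : E n →ₗ[ℂ] E n) ∘ fun a => (β a : E n) := funext fun a => (hGβ a).symm
      change LinearIndependent ℂ (fun a => P (e q) (β a : E n))
      rw [h3]
      exact h2
    · apply le_antisymm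
      · rw [Submodule.span_le]
        rintro _ ⟨a, rfl⟩
        exact hpr.1 _
      · intro x hx
        obtain ⟨y, hy⟩ := ((ContinuousLinearMap.isUnit_iff_bijective).mp hu).2 x
        have hPG : P (e q) * G (e q) = G (e q) * Q₀ := by
          have hPP := hpr.mul_self
          have e1 : P (e q) * (1 - P (e q)) = 0 := by rw [mul_sub, mul_one, hPP, sub_self]
          have e2 : (1 - Q₀) * Q₀ = 0 := by rw [sub_mul, one_mul, hQQ, sub_self]
          simp only [G]
          rw [mul_add, add_mul, ← mul_assoc, ← mul_assoc, hPP, e1, zero_mul, add_zero,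
            mul_assoc, hQQ, mul_assoc, e2, mul_zero, add_zero]
        have hx2 : x = G (e q) (Q₀ y) := by
          have := DFunLike.congr_fun hPG y
          rw [mul_apply_eq_comp, mul_apply_eq_comp, hy, hpr.2 x hx] at this
          exact this
        have hQy : Q₀ y ∈ α p := by
          have := hb.self_of_nhds.1 y
          rwa [e.left_inv hp] at this
        have hrep := β.sum_repr ⟨Q₀ y, hQy⟩
        have hrep2 : Q₀ y = ∑ a, β.repr ⟨Q₀ y, hQy⟩ a • (β a : E n) := by
          have := congrArg (Submodule.subtype _) hrep
          rw [map_sum] at this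
          exact this.symm
        rw [hx2, hrep2, map_sum]
        refine Submodule.sum_mem _ fun a _ => ?_
        rw [map_smul, hGβ]
        exact Submodule.smul_mem _ _ (Submodule.subset_span ⟨a, rfl⟩)

variable {r : ℕ} {B : ℕ → M → Submodule ℂ (Jet r n)}

/-- The first uniton is holomorphic. -/
lemma FiltrBundle.holBundle_unitonOf_one (hB : FiltrBundle B) (hr : 0 < r) :
    HolBundle (unitonOf B 1) := by
  have hs := hB.isSmoothSubbundle hr (hB.extCoeffs (Nat.zero_le r))
  -- The empty product is constant, so its matrix `A` is zero and the uniton condition becomes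
  -- closure of sections under `∂_z̄`.
  have hA : ∀ z, ∀ e : OpenPartialHomeomorph M ℂ,
      ExtAt 0 (fun w => unitonCoeffs B 0 (e.symm w)) (0 : End n) z := by
    intro z e
    refine ⟨0, 0, fun k => ?_, fun l => ?_, fun l => ?_⟩
    · simp only [unitonCoeffs_zero]
      exact hasW_const _ _
    · simp [polyLoop]
    · have h0 : -star (0 : End n) = 0 := by rw [op_star_zero]; exact neg_zero
      rw [h0]
      simp [polyLoop]
  intro e he p hp
  refine holAt_of_smooth (Q := fun w => proj (unitonOf B 1 (e.symm w)))
    (eventually_target hp fun q hq => (SmoothMap.contDiffAt hs he hq).hasW)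
    (Eventually.of_forall fun w => ⟨proj_mem _, fun x hx => proj_eq_self_iff.mpr hx⟩)
    (eventually_target hp fun q hq v hv => ?_)
  obtain ⟨D, D', hD⟩ := (SmoothMap.contDiffAt hs he hq).hasW
  have hσ := hD.clm_apply (hasW_const v _)
  refine ⟨fun w => proj (unitonOf B 1 (e.symm w)) v, _, _, hσ,
    Eventually.of_forall fun w => proj_mem _ v, proj_eq_self_iff.mpr hv, ?_⟩
  have := (hB.uniton_conditions hr he hq (hA _ e) hσ (Eventually.of_forall fun w => proj_mem _ v)).1
  rw [op_star_zero, zero_apply, sub_zero] at this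
  have h2 : unitonOf B 1 (e.symm (e q)) = unitonOf B 1 q := by rw [e.left_inv hq]
  exact (congrArg (fun S : Submodule ℂ (E n) => _ ∈ S) h2).mpr this

end

end UnitonTheory

namespace UnitonTheory

noncomputable section

set_option linter.unusedSectionVars false

variable {V : Type*} [NormedAddCommGroup V] [NormedSpace ℂ V] [FiniteDimensional ℂ V]
  {M : Type*} [TopologicalSpace M] [ChartedSpace ℂ M]

/-! ### Complements of meromorphic bundles -/

/-- If `P` is close to zero, `1 - P` is invertible, and `P (1 - P) = 0` forces `P = 0`. -/
lemma eventually_eq_zero_of_idempotent {P : ℂ → V →L[ℂ] V} {z₀ : ℂ} (hc : ContinuousAt P z₀)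
    (h : ∀ᶠ z in 𝓝 z₀, P z * P z = P z) (h0 : P z₀ = 0) : ∀ᶠ z in 𝓝 z₀, P z = 0 := by
  have hV : CompleteSpace V := FiniteDimensional.complete ℂ V
  have h1 : ContinuousAt (fun z => 1 - P z) z₀ := continuousAt_const.sub hc
  have h2 : ∀ᶠ z in 𝓝 z₀, IsUnit (1 - P z) :=
    h1.eventually (Units.isOpen.mem_nhds (by
      change IsUnit (1 - P z₀)
      rw [h0, sub_zero]; exact isUnit_one))
  filter_upwards [h, h2] with z h3 h4
  have h5 : P z * (1 - P z) = 0 := by rw [mul_sub, mul_one, h3, sub_self]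
  exact h4.mul_left_eq_zero.mp h5

lemma ProjOnto.eq_bot_iff {P : V →L[ℂ] V} {b : Submodule ℂ V} (h : ProjOnto P b) :
    b = ⊥ ↔ P = 0 := by
  constructor
  · rintro rfl
    ext1 x
    exact (Submodule.mem_bot ℂ).mp (h.1 x)
  · rintro rfl
    rw [Submodule.eq_bot_iff]
    intro x hx
    exact (h.2 x hx).symm

lemma ProjOnto.eq_top_iff {P : V →L[ℂ] V} {b : Submodule ℂ V} (h : ProjOnto P b) :
    b = ⊤ ↔ 1 - P = 0 := by
  constructor
  · rintro rfl
    ext1 x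
    exact sub_eq_zero.mpr (h.2 x trivial).symm
  · intro hP
    rw [_root_.eq_top_iff]
    intro x _
    rw [h.mem_iff, ← sub_eq_zero.mp hP]
    rfl

lemma HolAt.eventually_eq_bot_iff {b : ℂ → Submodule ℂ V} {z₀ : ℂ} (h : HolAt b z₀) :
    ∀ᶠ z in 𝓝 z₀, (b z = ⊥ ↔ b z₀ = ⊥) := by
  obtain ⟨P, hP, hb⟩ := h
  by_cases h0 : P z₀ = 0
  · filter_upwards [eventually_eq_zero_of_idempotent hP.continuousAt
      (hb.mono fun z hz => hz.mul_self) h0, hb] with z h1 h2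
    rw [h2.eq_bot_iff, hb.self_of_nhds.eq_bot_iff, h0, h1]
  · filter_upwards [hP.continuousAt.eventually_ne h0, hb] with z h1 h2
    rw [h2.eq_bot_iff, hb.self_of_nhds.eq_bot_iff]
    exact iff_of_false h1 h0

lemma HolAt.eventually_eq_top_iff {b : ℂ → Submodule ℂ V} {z₀ : ℂ} (h : HolAt b z₀) :
    ∀ᶠ z in 𝓝 z₀, (b z = ⊤ ↔ b z₀ = ⊤) := by
  obtain ⟨P, hP, hb⟩ := h
  have hc : ContinuousAt (fun z => 1 - P z) z₀ := continuousAt_const.sub hP.continuousAt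
  by_cases h0 : 1 - P z₀ = 0
  · filter_upwards [eventually_eq_zero_of_idempotent hc
      (hb.mono fun z hz => by rw [mul_sub, sub_mul, sub_mul, hz.mul_self]; simp) h0, hb]
      with z h1 h2
    rw [h2.eq_top_iff, hb.self_of_nhds.eq_top_iff, h0, h1]
  · filter_upwards [hc.eventually_ne h0, hb] with z h1 h2
    rw [h2.eq_top_iff, hb.self_of_nhds.eq_top_iff]
    exact iff_of_false h1 h0

variable [IsManifold 𝓘(ℂ, ℂ) ω M]

lemma forall_of_eventually_iff [ConnectedSpace M] {Q : M → Prop}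
    (h : ∀ p, ∀ᶠ q in 𝓝 p, (Q q ↔ Q p)) {p₀ : M} (h₀ : Q p₀) (p : M) : Q p := by
  have hclopen : IsClopen {p | Q p} := by
    constructor
    · rw [← isOpen_compl_iff, isOpen_iff_mem_nhds]
      intro q hq
      filter_upwards [h q] with q' hq' hq2
      exact hq (hq'.mp hq2)
    · rw [isOpen_iff_mem_nhds]
      intro q hq
      filter_upwards [h q] with q' hq'
      exact hq'.mpr hq
  have h1 := hclopen.eq_univ ⟨p₀, h₀⟩
  have h2 : p ∈ {p | Q p} := by rw [h1]; trivial
  exact h2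

lemma HolBundle.eventually_iff {B : M → Submodule ℂ V} {R : Submodule ℂ V → Prop}
    (h : ∀ e ∈ holCharts M, ∀ p ∈ e.source,
      ∀ᶠ z in 𝓝 (e p), (R (B (e.symm z)) ↔ R (B (e.symm (e p))))) (p : M) :
    ∀ᶠ q in 𝓝 p, (R (B q) ↔ R (B p)) := by
  have hp := mem_chart_source ℂ p
  have h1 := h _ (chartAt_mem_holCharts p) p hp
  rw [(chartAt ℂ p).left_inv hp] at h1
  exact ((chartAt ℂ p).eventually_nhds' (fun q => R (B q) ↔ R (B p)) hp).mp h1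

/-- A complement `C` at one point works off a discrete set. The holomorphic continuations of `B ∩ C`
and `B + C` are `0` and the whole space at that point. For holomorphic bundles these are open and
closed conditions, so they hold on all of the connected surface. -/
lemma MeroBundle.exists_isCompl [T1Space M] [ConnectedSpace M] {B : M → Submodule ℂ V}
    (h : MeroBundle B) : ∃ C : Submodule ℂ V, ∀ᶠ p in codiscrete M, IsCompl (B p) C := by
  obtain ⟨B', hB', hBB'⟩ := exists_fill h
  obtain ⟨p₀⟩ : Nonempty M := inferInstance
  obtain ⟨C, hC⟩ := Submodule.exists_isCompl (B' p₀)
  refine ⟨C, ?_⟩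
  obtain ⟨F, hF, hFe⟩ := exists_fill (hB'.meroBundle.inf C)
  obtain ⟨G, hG, hGe⟩ := exists_fill (hB'.meroBundle.sup C)
  have hF₀ : F p₀ = ⊥ := by
    rw [eq_bot_iff, ← hC.inf_eq_bot]
    exact le_inf (hF.le hB' (hFe.mono fun q hq => hq.le.trans inf_le_left) p₀)
      (hF.le (HolBundle.const C) (hFe.mono fun q hq => hq.le.trans inf_le_right) p₀)
  have hG₀ : G p₀ = ⊤ := by
    rw [eq_top_iff, ← hC.sup_eq_top]
    exact sup_le (hB'.le hG (hGe.mono fun q hq => le_sup_left.trans hq.ge) p₀)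
      ((HolBundle.const C).le hG (hGe.mono fun q hq => le_sup_right.trans hq.ge) p₀)
  have hFall := forall_of_eventually_iff (Q := fun p => F p = ⊥) (HolBundle.eventually_iff
    (R := fun b => b = ⊥) fun e he p hp => (hF e he p hp).eventually_eq_bot_iff) hF₀
  have hGall := forall_of_eventually_iff (Q := fun p => G p = ⊤) (HolBundle.eventually_iff
    (R := fun b => b = ⊤) fun e he p hp => (hG e he p hp).eventually_eq_top_iff) hG₀
  filter_upwards [hBB', hFe, hGe] with p h1 h2 h3
  rw [← h1]
  exact ⟨disjoint_iff.mpr (h2 ▸ hFall p), codisjoint_iff.mpr (h3 ▸ hGall p)⟩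

/-- The component along `C` of a constant section is meromorphic. -/
lemma MeroAt.meromorphicAt_component {b : ℂ → Submodule ℂ V} {z₀ : ℂ} (h : MeroAt b z₀)
    {C : Submodule ℂ V} (hC : ∀ᶠ z in 𝓝[≠] z₀, b z ⊓ C = ⊥) {v : V} {L : ℂ → V}
    (hL : ∀ᶠ z in 𝓝[≠] z₀, L z ∈ b z ∧ v - L z ∈ C) : MeromorphicAt L z₀ := by
  by_cases hv : v ∈ C
  · refine (MeromorphicAt.const (0 : V) z₀).congr ?_
    filter_upwards [hC, hL] with z h1 h2
    have h3 : L z ∈ b z ⊓ C := ⟨h2.1, by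
      have := Submodule.sub_mem _ hv h2.2
      rwa [sub_sub_cancel] at this⟩
    rw [h1] at h3
    exact ((Submodule.mem_bot ℂ).mp h3).symm
  -- Near `z₀`, `L z` spans the line `b z ∩ (C + ℂ v)` and is normalised by `φ (L z) = φ v`, where
  -- `φ` vanishes on `C` but not at `v`. It can thus be recovered from any analytic section of this
  -- line that does not vanish.
  · obtain ⟨φ₀, hφ₀, hφC⟩ := Submodule.exists_le_ker_of_notMem hv
    let φ : V →L[ℂ] ℂ := LinearMap.toContinuousLinearMap φ₀
    have hφv : φ v ≠ 0 := hφ₀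
    have hφC' : ∀ c ∈ C, φ c = 0 := fun c hc => hφC hc
    obtain ⟨P, hP, hPb⟩ := h.inf (C ⊔ Submodule.span ℂ {v})
    have key : ∀ᶠ z in 𝓝[≠] z₀, L z ∈ b z ⊓ (C ⊔ Submodule.span ℂ {v}) ∧ φ (L z) = φ v ∧
        ∀ x ∈ b z ⊓ (C ⊔ Submodule.span ℂ {v}), ∃ t : ℂ, x = t • L z := by
      filter_upwards [hC, hL] with z h1 h2
      refine ⟨⟨h2.1, ?_⟩, ?_, ?_⟩
      · have := Submodule.sub_mem _ (Submodule.mem_sup_right (S := C)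
          (Submodule.mem_span_singleton_self v)) (Submodule.mem_sup_left h2.2)
        rwa [sub_sub_cancel] at this
      · have := hφC' _ h2.2
        rw [map_sub, sub_eq_zero] at this
        exact this.symm
      · rintro x ⟨hx, hx'⟩
        obtain ⟨c, hc, y, hy, rfl⟩ := Submodule.mem_sup.mp hx'
        obtain ⟨t, rfl⟩ := Submodule.mem_span_singleton.mp hy
        refine ⟨t, ?_⟩
        have h3 : c + t • v - t • L z ∈ b z ⊓ C := by
          refine ⟨Submodule.sub_mem _ hx (Submodule.smul_mem _ _ h2.1), ?_⟩
          have e : c + t • v - t • L z = c + t • (v - L z) := by module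
          rw [e]
          exact Submodule.add_mem _ hc (Submodule.smul_mem _ _ h2.2)
        rw [h1, Submodule.mem_bot] at h3
        exact sub_eq_zero.mp h3
    -- If `P z₀` were zero, `P` would vanish near `z₀`, but its range contains the non-zero vector
    -- `L z`.
    have hPv : ∃ w, P z₀ w ≠ 0 := by
      by_contra hcon
      push Not at hcon
      have hid : ∀ᶠ z in 𝓝 z₀, P z * P z = P z := by
        have h1 : ∀ᶠ z in 𝓝[≠] z₀, P z * P z = P z := hPb.mono fun z hz => hz.mul_self
        have h2 : P z₀ * P z₀ = P z₀ := eq_of_eventuallyEq_nhdsNE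
          (f := fun z => P z * P z) (hP.continuousAt.mul hP.continuousAt) hP.continuousAt h1
        rw [eventually_nhdsWithin_iff] at h1
        filter_upwards [h1] with z hz
        by_cases hzz : z = z₀
        · rw [hzz]; exact h2
        · exact hz hzz
      have h0 := (eventually_eq_zero_of_idempotent hP.continuousAt hid
        (ContinuousLinearMap.ext hcon)).filter_mono (nhdsWithin_le_nhds (s := {z₀}ᶜ))
      obtain ⟨z, h1, h2, h3⟩ := (h0.and (hPb.and key)).exists
      have h4 := h2.2 _ h3.1
      rw [h1] at h4
      have h5 := h3.2.1
      rw [← h4] at h5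
      exact hφv (by rw [← h5]; simp)
    obtain ⟨w, hw⟩ := hPv
    have hPw : AnalyticAt ℂ (fun z => P z w) z₀ := AnalyticAt.op_apply hP analyticAt_const
    have hφP : MeromorphicAt (fun z => φ (P z w)) z₀ :=
      (AnalyticAt.op_apply (f := fun _ => φ) analyticAt_const hPw).meromorphicAt
    refine (((MeromorphicAt.const (φ v) z₀).mul hφP.inv).smul hPw.meromorphicAt).congr ?_
    filter_upwards [hPb, key, (hPw.continuousAt.eventually_ne hw).filter_mono nhdsWithin_le_nhds]
      with z h1 h2 h3
    obtain ⟨t, ht⟩ := h2.2.2 _ (h1.1 w)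
    have ht0 : t ≠ 0 := by
      rintro rfl
      rw [zero_smul] at ht
      exact h3 ht
    change (φ v * (φ (P z w))⁻¹) • P z w = L z
    rw [ht, map_smul, h2.2.1, smul_smul, smul_eq_mul]
    have : φ v * (t * φ v)⁻¹ * t = 1 := by field_simp
    rw [this, one_smul]

/-- The sections are the projections of a constant basis onto `B` along a constant complement `C`.
For `x ∈ B`, the combination of them with the coordinates of `x` differs from `x` by an element of
`B ∩ C = 0`. -/
lemma MeroBundle.exists_sections [T1Space M] [ConnectedSpace M] {B : M → Submodule ℂ V}
    (h : MeroBundle B) : ∃ (N : ℕ) (L : Fin N → M → V),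
      (∀ j, ∀ e ∈ holCharts M, ∀ p ∈ e.source, MeromorphicAt (L j ∘ e.symm) (e p)) ∧
      ∀ᶠ p in codiscrete M, Submodule.span ℂ (range fun j => L j p) = B p := by
  classical
  obtain ⟨C, hC⟩ := h.exists_isCompl
  let β := Module.finBasis ℂ V
  have hex : ∀ p, IsCompl (B p) C → ∀ v : V, ∃ x ∈ B p, v - x ∈ C := by
    intro p hp v
    have hv : v ∈ B p ⊔ C := by rw [hp.sup_eq_top]; trivial
    obtain ⟨x, hx, c, hc, rfl⟩ := Submodule.mem_sup.mp hv
    exact ⟨x, hx, by rwa [add_sub_cancel_left]⟩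
  let L : Fin (Module.finrank ℂ V) → M → V := fun j p =>
    if hp : IsCompl (B p) C then (hex p hp (β j)).choose else 0
  have hL : ∀ p, IsCompl (B p) C → ∀ j, L j p ∈ B p ∧ β j - L j p ∈ C := by
    intro p hp j
    simp only [L, dif_pos hp]
    exact (hex p hp (β j)).choose_spec
  refine ⟨_, L, fun j e he p hp => ?_, ?_⟩
  · have hCe := (eventually_nhdsNE_chart hp _).mpr (eventually_codiscrete_iff.mp hC p)
    exact (h e he p hp).meromorphicAt_component (hCe.mono fun z hz => hz.inf_eq_bot)
      (v := β j) (hCe.mono fun z hz => hL _ hz j)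
  · filter_upwards [hC] with p hp
    apply le_antisymm
    · rw [Submodule.span_le]
      rintro _ ⟨j, rfl⟩
      exact (hL p hp j).1
    · intro x hx
      have hmem : ∑ j, β.repr x j • L j p ∈ Submodule.span ℂ (range fun j => L j p) :=
        Submodule.sum_mem _ fun j _ => Submodule.smul_mem _ _ (Submodule.subset_span ⟨j, rfl⟩)
      have h1 : x - ∑ j, β.repr x j • L j p ∈ B p ⊓ C := by
        refine ⟨Submodule.sub_mem _ hx (Submodule.sum_mem _ fun j _ =>
          Submodule.smul_mem _ _ (hL p hp j).1), ?_⟩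
        have e : x - ∑ j, β.repr x j • L j p = ∑ j, β.repr x j • (β j - L j p) := by
          conv_lhs => rw [← β.sum_repr x]
          simp only [smul_sub, Finset.sum_sub_distrib, β.sum_repr]
        rw [e]
        exact Submodule.sum_mem _ fun j _ => Submodule.smul_mem _ _ (hL p hp j).2
      rw [hp.inf_eq_bot, Submodule.mem_bot] at h1
      rw [sub_eq_zero.mp h1]
      exact hmem

/-! ### Derivatives of sections -/

/-- The operator `N` is constant, so `N^k ∂^k` is the `k`-th iterate of `N ∂`, which preserves the
sections of `b`. -/
lemma iteratedDeriv_mem {N : V →L[ℂ] V} {b : ℂ → Submodule ℂ V} {z₀ : ℂ}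
    (h : ∀ᶠ z in 𝓝 z₀, DCAt N b z) {g : ℂ → V} (hg : AnalyticAt ℂ g z₀)
    (hgb : ∀ᶠ z in 𝓝 z₀, g z ∈ b z) (k : ℕ) :
    ∀ᶠ z in 𝓝 z₀, (N ^ k) (iteratedDeriv k g z) ∈ b z := by
  have hV : CompleteSpace V := FiniteDimensional.complete ℂ V
  induction k with
  | zero => simpa using hgb
  | succ k ih =>
    filter_upwards [ih.eventually_nhds, h, hg.eventually_analyticAt] with z h1 h2 h3
    have h4 : AnalyticAt ℂ (iteratedDeriv k g) z := by
      rw [iteratedDeriv_eq_iterate]; exact AnalyticAt.iterated_deriv h3 k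
    have h5 := (hasW_of_hasDerivAt h4.differentiableAt.hasDerivAt).clm (N ^ k)
    have h6 := h2 _ _ _ h5 h1
    rw [iteratedDeriv_succ, pow_succ']
    exact h6

lemma dcAt_const (J : Submodule ℂ V) (z : ℂ) : DCAt (1 : V →L[ℂ] V) (fun _ => J) z := by
  intro σ a c hσ hσb
  obtain ⟨P, hP⟩ := exists_projOnto J
  have h1 := (hσ.clm P).unique (hσ.congr (hσb.mono fun w hw => hP.2 _ hw))
  rw [one_apply_eq_self, hP.mem_iff]
  exact h1.1

end

end UnitonTheory

namespace UnitonTheory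

noncomputable section

set_option linter.unusedSectionVars false

variable {r n : ℕ}

/-! ### The explicit formula at a point -/

lemma mem_posJ_of_shJ_eq_zero {u : ℕ} {x : Jet r n} (h : shJ u x = 0) :
    x ∈ posJ r n ((r : ℤ) - u) := by
  intro i hi
  rcases lt_or_ge i 0 with h0 | h0
  · exact ext_mem_pos x i h0
  · have h1 : ext (shJ u x) (i + u) = sh u (ext x) (i + u) :=
      ext_tr_apply (f := sh u (ext x)) (i + u) (by omega) (by omega)
    rw [h, map_zero, sh_apply, add_sub_cancel_right] at h1
    exact h1.symm

lemma evA_eq_sum (V : ℕ → Submodule ℂ (E n)) (i : ℕ) (x : Jet r n) :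
    evA r V i x = ∑ s ∈ Finset.range (i + 1), invCoeff V i s (ext x s) := by
  rw [evA_apply, divS_etaCoeffs_apply]
  simp only [zero_add]

lemma evA_eq_zero_of_mem_posJ {V : ℕ → Submodule ℂ (E n)} {i : ℕ} {x : Jet r n}
    (hx : x ∈ posJ r n (i + 1 : ℕ)) : evA r V i x = 0 := by
  rw [evA_eq_sum]
  refine Finset.sum_eq_zero fun s hs => ?_
  rw [hx s (by have := Finset.mem_range.mp hs; omega), map_zero]

/-- The constant term of `Φ_i⁻¹(λ x)` is the coefficient of `λ⁻¹` in `Φ_i⁻¹ x`, which vanishes for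
`x ∈ W_i = Φ_i H_+`. -/
lemma IsFiltr.evA_shJ_one {B : ℕ → Submodule ℂ (Jet r n)} (h : IsFiltr B) {i : ℕ} (hi : i < r)
    {x : Jet r n} (hx : x ∈ B i) : evA r (unitonSeq B) i (shJ 1 x) = 0 := by
  rw [← h.comap_ext_WS hi.le] at hx
  have h1 := hx (-1) (by norm_num)
  rw [divS_etaCoeffs_apply] at h1
  rw [shJ_apply, evA_tr hi (sh_ext_mem_pos (by norm_num) x), divS_etaCoeffs_apply, ← h1]
  refine Finset.sum_congr rfl fun k _ => ?_
  rw [sh_apply, show (0 + (k : ℤ)) - (1 : ℕ) = -1 + k by push_cast; ring]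

/-- The jet `λ^d x`, for `x` of order at least `-d`. -/
def shZ (d : ℤ) (x : Jet r n) : Jet r n := tr r (sh d (ext x))

lemma shJ_shZ {o : ℤ} {l u : ℕ} {x : Jet r n} (hx : x ∈ posJ r n o) (h : (u : ℤ) ≤ o + l) :
    shJ u (shZ ((l : ℤ) - u) x) = shJ l x := by
  rw [shZ, shJ_tr (sh_mem_pos.mpr (pos_mono (by omega) (mem_posJ.mp hx))), sh_sh, shJ_apply,
    add_sub_cancel]

lemma evA_shZ {V : ℕ → Submodule ℂ (E n)} {i : ℕ} (hi : i < r) {o d : ℤ} {x : Jet r n}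
    (hx : x ∈ posJ r n o) (h : 0 ≤ o + d) :
    evA r V i (shZ d x) = ∑ s ∈ Finset.range (i + 1), invCoeff V i s (x.coeff (s - d)) := by
  rw [shZ, evA_tr hi (sh_mem_pos.mpr (pos_mono (by omega) (mem_posJ.mp hx))),
    divS_etaCoeffs_apply]
  refine Finset.sum_congr rfl fun k _ => ?_
  rw [sh_apply, zero_add, ext_apply]

/-- The vectors `D j k` play the part of `(L^j)^{(k)}`, with `u = u_{i+1}` and `u' = u_i`. Modulo
the kernel of `P_0 Φ_i⁻¹`, `W_{i+1}` is spanned by the `λ^{l-u} D j k` with `k ≤ l` and `u ≤ o_j +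
l`. If `k < l` and `u < o_j + l`, such a vector is `λ` times another of them, which lies in `W_i`,
so it is annihilated. The case `l = k` gives the first family, unless the order reaches `i + 1`; the
case `o_j + l = u`, `k < l` gives the second. -/
lemma span_formula {N : ℕ} {D : Fin N → ℕ → Jet r n} {o : Fin N → ℕ}
    (hD : ∀ j k, D j k ∈ posJ r n (o j)) {B₀ : Submodule ℂ (Jet r n)}
    (hmem : ∀ j k l, k ≤ l → shJ l (D j k) ∈ B₀) {u : ℕ}
    (hspan : B₀ ⊓ posJ r n u =
      Submodule.span ℂ {x | ∃ j k l, k ≤ l ∧ u ≤ o j + l ∧ x = shJ l (D j k)})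
    {B : ℕ → Submodule ℂ (Jet r n)} (hB : IsFiltr B) {i u' : ℕ} (hi : i < r)
    (h1 : B₀.comap (shJ u') ≤ B i)
    (h2 : B (i + 1) = altJ B₀ u (i + 1)) (hu : B₀.comap (shJ u) ≤ B₀.comap (shJ u'))
    (hui : u + (i + 1) ≤ r) :
    unitonSeq B (i + 1) =
      Submodule.span ℂ {x | ∃ (j : Fin N) (k : ℕ), 0 ≤ (o j : ℤ) + k - u ∧ (o j : ℤ) + k - u ≤ ((i + 1 : ℕ) : ℤ) - 1 ∧
        x = ∑ s ∈ Finset.range (i + 1),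
          invCoeff (unitonSeq B) i s ((D j k).coeff ((s : ℤ) - k + u))} ⊔
      Submodule.span ℂ {x | ∃ (j : Fin N) (k : ℕ), (o j : ℤ) + k - u < 0 ∧
        x = ∑ s ∈ Finset.range (i + 1),
          invCoeff (unitonSeq B) i s ((D j k).coeff ((s : ℤ) + o j))} := by
  set X := Submodule.span ℂ {x | ∃ (j : Fin N) (k : ℕ), 0 ≤ (o j : ℤ) + k - u ∧
    (o j : ℤ) + k - u ≤ ((i + 1 : ℕ) : ℤ) - 1 ∧ x = ∑ s ∈ Finset.range (i + 1),
      invCoeff (unitonSeq B) i s ((D j k).coeff ((s : ℤ) - k + u))} with hX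
  set Y := Submodule.span ℂ {x | ∃ (j : Fin N) (k : ℕ), (o j : ℤ) + k - u < 0 ∧ x = ∑ s ∈ Finset.range (i + 1),
    invCoeff (unitonSeq B) i s ((D j k).coeff ((s : ℤ) + o j))} with hY
  have hval : ∀ j k l, u ≤ o j + l → evA r (unitonSeq B) i (shZ ((l : ℤ) - u) (D j k)) =
      ∑ s ∈ Finset.range (i + 1),
        invCoeff (unitonSeq B) i s ((D j k).coeff ((s : ℤ) - ((l : ℤ) - u))) :=
    fun j k l h => evA_shZ hi (hD j k) (by omega)
  have hin : ∀ j k l, k ≤ l → u ≤ o j + l → shZ ((l : ℤ) - u) (D j k) ∈ B₀.comap (shJ u) := by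
    intro j k l hkl h
    rw [mem_comap_shJ, shJ_shZ (hD j k) (by exact_mod_cast h)]
    exact hmem j k l hkl
  rw [unitonSeq_succ]
  apply le_antisymm
  · rw [Submodule.map_le_iff_le_comap, h2]
    refine sup_le ?_ fun x hx => ?_
    · have hker : ∀ x ∈ posJ r n (i + 1 : ℕ), evA r (unitonSeq B) i x ∈ X ⊔ Y := fun x hx => by
        rw [evA_eq_zero_of_mem_posJ hx]; exact Submodule.zero_mem _
      have hgen : ∀ j k l, k ≤ l → u ≤ o j + l →
          evA r (unitonSeq B) i (shZ ((l : ℤ) - u) (D j k)) ∈ X ⊔ Y := by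
        intro j k l hkl hl
        rcases hkl.eq_or_lt with rfl | hkl
        · rcases lt_or_ge ((o j : ℤ) + k - u) ((i + 1 : ℕ) : ℤ) with h | h
          · refine Submodule.mem_sup_left (Submodule.subset_span ⟨j, k, by omega, by omega, ?_⟩)
            rw [hval j k k hl]
            simp only [sub_add]
          · refine hker _ (tr_mem_posJ (sh_mem_pos.mpr ?_))
            exact pos_mono (by omega) (mem_posJ.mp (hD j k))
        · rcases hl.eq_or_lt with h | h
          · refine Submodule.mem_sup_right (Submodule.subset_span ⟨j, k, by omega, ?_⟩)
            rw [hval j k l hl]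
            refine Finset.sum_congr rfl fun s _ => ?_
            rw [show (s : ℤ) - ((l : ℤ) - u) = s + o j by omega]
          · obtain ⟨m, rfl⟩ : ∃ m, l = m + 1 := ⟨l - 1, by omega⟩
            have h3 : shZ (((m + 1 : ℕ) : ℤ) - u) (D j k) = shJ 1 (shZ ((m : ℤ) - u) (D j k)) := by
              rw [shZ, shZ, shJ_tr (sh_mem_pos.mpr (pos_mono (by omega) (mem_posJ.mp (hD j k)))),
                sh_sh]
              rw [show (((m + 1 : ℕ) : ℤ) - u) = (1 : ℕ) + ((m : ℤ) - u) by push_cast; ring]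
            rw [h3, hB.evA_shJ_one hi (h1 (hu (hin j k m (by omega) (by omega))))]
            exact Submodule.zero_mem _
      intro x hx
      have hx2 : shJ u x ∈ B₀ ⊓ posJ r n u :=
        Submodule.mem_inf.mpr ⟨hx, by
          have := shJ_mem_posJ (k := u) (show x ∈ posJ r n 0 by rw [posJ_zero]; trivial)
          rwa [zero_add] at this⟩
      have hle : B₀ ⊓ posJ r n u ≤ ((X ⊔ Y).comap (evA r (unitonSeq B) i)).map (shJ u) := by
        rw [hspan, Submodule.span_le]
        rintro _ ⟨j, k, l, hkl, hl, rfl⟩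
        exact ⟨_, hgen j k l hkl hl, shJ_shZ (hD j k) (by exact_mod_cast hl)⟩
      obtain ⟨y, hy, hyx⟩ := hle hx2
      -- Division by `λ^u` is determined on jets only up to terms of order at least `r - u`. These
      -- are annihilated because `i + 1 ≤ r - u`.
      have h3 : x - y ∈ posJ r n (i + 1 : ℕ) :=
        posJ_mono (by omega) (mem_posJ_of_shJ_eq_zero (u := u) (by rw [map_sub, hyx, sub_self]))
      have h4 := Submodule.add_mem _ hy (hker _ h3)
      rwa [add_sub_cancel] at h4
    · rw [Submodule.mem_comap, evA_eq_zero_of_mem_posJ hx]; exact Submodule.zero_mem _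
  · have hmap : ∀ j k l, k ≤ l → u ≤ o j + l →
        evA r (unitonSeq B) i (shZ ((l : ℤ) - u) (D j k)) ∈ (B (i + 1)).map (evA r (unitonSeq B) i) :=
      fun j k l hkl hl => Submodule.mem_map_of_mem (by
        rw [h2]; exact Submodule.mem_sup_left (hin j k l hkl hl))
    refine sup_le (Submodule.span_le.mpr ?_) (Submodule.span_le.mpr ?_)
    · rintro _ ⟨j, k, hk1, -, rfl⟩
      have := hmap j k k le_rfl (by omega)
      rw [hval j k k (by omega)] at this
      simp only [sub_add]
      exact this
    · rintro _ ⟨j, k, hk, rfl⟩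
      have := hmap j k (u - o j) (by omega) (by omega)
      rw [hval j k _ (by omega)] at this
      have e : ∀ s : ℕ, (s : ℤ) - (((u - o j : ℕ) : ℤ) - u) = s + o j := fun s => by omega
      simp only [e] at this
      exact this

/-! ### Adaptedness in terms of jets -/

lemma toH_mem_hPlus (l : ℕ) (x : Jet r n) : Jet.toH l x ∈ hPlus n 0 := by
  intro i hi
  rw [coe_toH]
  exact sh_ext_mem_pos (by omega) x i hi

/-- Both subspaces of `H` lie between `λ^r H_+` and `H_+`, so they may be compared modulo `λ^r H_+`.
-/
lemma adapted_iff {γ : Circle → End n} {T : ℕ → End n} (hγ : ∀ z, γ z = polyLoop r T z)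
    (hU : UnitaryCoeffs r T) {u : ℕ} (hur : u ≤ r) {ι : Type*} (l : ι → ℕ) (x : ι → Jet r n) :
    grassModel γ ⊓ hPlus n u =
        Submodule.span ℂ (range fun j => Jet.toH (l j) (x j)) ⊔ hPlus n r ↔
      (WS r T).comap ext ⊓ posJ r n u = Submodule.span ℂ (range fun j => shJ (l j) (x j)) := by
  let Tr : H n →ₗ[ℂ] Jet r n :=
    { toFun := fun f => tr r (f : ∀ _ : ℤ, E n)
      map_add' := fun _ _ => rfl
      map_smul' := fun _ _ => rfl }
  have hTr : ∀ f : H n, Tr f = tr r (f : ∀ _ : ℤ, E n) := fun _ => rfl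
  have hker : ∀ f ∈ hPlus n 0, Tr f = 0 → f ∈ hPlus n r := by
    intro f hf h i hi
    rcases lt_or_ge i 0 with h0 | h0
    · exact hf i h0
    · have := congrArg (fun y => ext y i) h
      simp only [hTr, map_zero] at this
      rwa [ext_tr_apply i h0 hi] at this
  have hker' : ∀ f ∈ hPlus n r, Tr f = 0 := fun f hf => tr_eq_zero (r := r) hf
  have hmapeq : ∀ X Y : Submodule ℂ (H n), X ≤ hPlus n 0 → hPlus n r ≤ Y →  Y ≤ hPlus n 0 →
      X.map Tr ≤ Y.map Tr → X ≤ Y := by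
    intro X Y hX hY hY0 h f hf
    obtain ⟨g, hg, hgf⟩ := h (Submodule.mem_map_of_mem hf)
    have h1 : f - g ∈ hPlus n r :=
      hker _ (Submodule.sub_mem _ (hX hf) (hY0 hg)) (by rw [map_sub, hgf, sub_self])
    have := Y.add_mem hg (hY h1)
    rwa [add_sub_cancel] at this
  have hiff : ∀ X Y : Submodule ℂ (H n), X ≤ hPlus n 0 → hPlus n r ≤ X → Y ≤ hPlus n 0 →
      hPlus n r ≤ Y → (X = Y ↔ X.map Tr = Y.map Tr) := by
    intro X Y h1 h2 h3 h4
    refine ⟨fun h => by rw [h], fun h => le_antisymm ?_ ?_⟩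
    · exact hmapeq X Y h1 h4 h3 h.le
    · exact hmapeq Y X h3 h2 h1 h.ge
  have hu0 : hPlus n u ≤ hPlus n 0 := fun f hf i hi => hf i (by omega)
  have hru : hPlus n r ≤ hPlus n u := fun f hf i hi => hf i (by omega)
  have hrW : hPlus n r ≤ grassModel γ := fun f hf =>
    (mem_grassModel_iff hγ hU f).mpr (pos_le_WS hf)
  rw [hiff _ _ (inf_le_right.trans hu0) (le_inf hrW hru)
    (sup_le (Submodule.span_le.mpr (by rintro _ ⟨j, rfl⟩; exact toH_mem_hPlus _ _))
      (hru.trans hu0)) le_sup_right]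
  have hL : (grassModel γ ⊓ hPlus n u).map Tr = (WS r T).comap ext ⊓ posJ r n u := by
    ext y
    constructor
    · rintro ⟨f, hf, rfl⟩
      obtain ⟨h1, h2⟩ := Submodule.mem_inf.mp hf
      refine Submodule.mem_inf.mpr ⟨?_, tr_mem_posJ h2⟩
      exact (mem_iff_ext_tr_mem pos_le_WS (hu0 h2)).mpr ((mem_grassModel_iff hγ hU f).mp h1)
    · intro hy
      obtain ⟨h1, h2⟩ := Submodule.mem_inf.mp hy
      have hco : ((Jet.toH 0 y : H n) : ∀ _ : ℤ, E n) = ext y := by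
        rw [coe_toH, Nat.cast_zero, sh_zero]
      refine ⟨Jet.toH 0 y, Submodule.mem_inf.mpr ⟨(mem_grassModel_iff hγ hU _).mpr ?_, ?_⟩, ?_⟩
      · rw [hco]; exact h1
      · intro i hi
        rw [hco]; exact h2 i hi
      · rw [hTr, hco, tr_ext]
  have hR : (Submodule.span ℂ (range fun j => Jet.toH (l j) (x j)) ⊔ hPlus n r).map Tr =
      Submodule.span ℂ (range fun j => shJ (l j) (x j)) := by
    rw [Submodule.map_sup, LinearMap.le_ker_iff_map.mp fun f hf => hker' f hf,
      sup_bot_eq, Submodule.map_span, ← range_comp]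
    congr 2
    funext j
    change Tr _ = _
    rw [hTr, coe_toH, shJ_apply]
  rw [hL, hR]

end

end UnitonTheory

namespace UnitonTheory

noncomputable section

set_option linter.unusedSectionVars false

variable {r n : ℕ} {M : Type*} [TopologicalSpace M] [ChartedSpace ℂ M] [IsManifold 𝓘(ℂ, ℂ) ω M]

/-! ### Meromorphic sections and their derivatives -/

/-- The exceptional set must not depend on the chart. It is found in the preferred chart at each
point and serves for all charts because transition maps are analytic. -/
lemma IsMeromorphicSection.eventually_analyticAt {L : M → Jet r n} (h : IsMeromorphicSection L) :
    ∀ᶠ p in codiscrete M, ∀ e ∈ holCharts M, p ∈ e.source → AnalyticAt ℂ (L ∘ e.symm) (e p) := by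
  rw [eventually_codiscrete_iff]
  intro p
  set c := chartAt ℂ p with hc
  have hpc : p ∈ c.source := mem_chart_source ℂ p
  have h1 : ∀ᶠ z in 𝓝[≠] (c p), AnalyticAt ℂ (L ∘ c.symm) z :=
    MeromorphicAt.eventually_analyticAt (h c (chartAt_mem_holCharts p) p hpc)
  have ht : ∀ᶠ z in 𝓝 (c p), z ∈ c.target := c.open_target.mem_nhds (c.map_source hpc)
  have h2 : ∀ᶠ q in 𝓝[≠] p, AnalyticAt ℂ (L ∘ c.symm) (c q) := by
    rw [← eventually_nhdsNE_chart hpc]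
    filter_upwards [h1, ht.filter_mono nhdsWithin_le_nhds] with z hz hzt
    rwa [c.right_inv hzt]
  filter_upwards [h2, (eventually_mem_source hpc).filter_mono nhdsWithin_le_nhds]
    with q hq hqc e he hqe
  have h3 : AnalyticAt ℂ (fun z => (L ∘ c.symm) ((c ∘ e.symm) z)) (e q) := by
    have h4 := analyticAt_transition (chartAt_mem_holCharts p) he hqc hqe
    refine AnalyticAt.fun_comp ?_ h4
    simpa [e.left_inv hqe] using hq
  refine h3.congr ?_
  have h5 : ∀ᶠ z in 𝓝 (e q), e.symm z ∈ c.source :=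
    (e.eventually_nhds' (fun q => q ∈ c.source) hqe).mpr (eventually_mem_source hqc)
  filter_upwards [h5] with z hz
  simp [c.left_inv hz]

/-- Derivatives of a section of `B` satisfy the differential relations that define `B`. -/
lemma IsMeromorphicSection.eventually_derivK_mem [T1Space M] {L : M → Jet r n}
    (h : IsMeromorphicSection L) {N : Jet r n →L[ℂ] Jet r n} {B : M → Submodule ℂ (Jet r n)}
    (hB : DClosed N B) (hL : ∀ᶠ p in codiscrete M, L p ∈ B p) :
    ∀ᶠ p in codiscrete M, ∀ e ∈ holCharts M, p ∈ e.source →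
      ∀ k, (N ^ k) (derivK e k L p) ∈ B p := by
  filter_upwards [h.eventually_analyticAt, eventually_codiscrete_nhds hL] with p h1 h2 e he hp k
  have h3 : ∀ᶠ z in 𝓝 (e p), DCAt N (fun z => B (e.symm z)) z :=
    eventually_target hp fun q hq => hB e he q hq
  have h4 := iteratedDeriv_mem h3 (h1 e he hp)
    ((e.eventually_nhds' (fun q => L q ∈ B q) hp).mpr h2) k
  have h5 := h4.self_of_nhds
  simp only [e.left_inv hp] at h5
  exact h5

lemma eventually_mem_posJ_order (L : M → Jet r n) :
    ∀ᶠ p in codiscrete M, L p ∈ posJ r n (order L) := by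
  have h1 : ∀ᶠ p in codiscrete M, ∀ i ∈ Finset.range (order L), (L p).coeff (i : ℤ) = 0 := by
    rw [Filter.eventually_all_finset]
    intro i hi
    have := Nat.notMem_of_lt_sInf (Finset.mem_range.mp hi)
    exact not_not.mp this
  filter_upwards [h1] with p hp i hi
  rcases lt_or_ge i 0 with h0 | h0
  · exact ext_mem_pos _ i h0
  · lift i to ℕ using h0
    exact hp i (Finset.mem_range.mpr (by exact_mod_cast hi))

lemma IsMeromorphicSection.eventually_derivK_mem_posJ [T1Space M] {L : M → Jet r n}
    (h : IsMeromorphicSection L) :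
    ∀ᶠ p in codiscrete M, ∀ e ∈ holCharts M, p ∈ e.source →
      ∀ k, derivK e k L p ∈ posJ r n (order L) := by
  filter_upwards [h.eventually_derivK_mem (N := 1) (fun _ _ _ _ => dcAt_const _ _)
    (eventually_mem_posJ_order L)] with p hp e he hpe k
  simpa using hp e he hpe k

/-- The section that vanishes off a discrete set is excluded because its order is `0` by convention,
which need not be at least `u`. -/
lemma le_order {L : M → Jet r n} {u : ℕ} (h : ∀ᶠ p in codiscrete M, L p ∈ posJ r n u)
    (h0 : ¬ ∀ᶠ p in codiscrete M, L p = 0) : u ≤ order L := by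
  refine le_csInf ?_ fun i hi => ?_
  · by_contra hne
    apply h0
    have hall : ∀ i : ℕ, ∀ᶠ p in codiscrete M, (L p).coeff i = 0 := fun i =>
      not_not.mp fun hi => hne ⟨i, hi⟩
    have h1 : ∀ᶠ p in codiscrete M, ∀ i ∈ Finset.range r, (L p).coeff (i : ℤ) = 0 := by
      rw [Filter.eventually_all_finset]
      exact fun i _ => hall i
    filter_upwards [h1] with p hp
    ext1 i
    exact ((L p).coeff_fin i).symm.trans (hp i (Finset.mem_range.mpr i.2))
  · by_contra hlt
    apply hi
    filter_upwards [h] with p hp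
    exact hp i (by omega)

lemma shL_one_pow_apply (k : ℕ) (x : Jet r n) : (shL r n 1 ^ k) x = shJ k x := by
  induction k with
  | zero => rw [shJ_zero]; rfl
  | succ k ih =>
    rw [pow_succ', mul_apply_eq_comp, ih, shL_apply, shJ_shJ, add_comm]

/-! ### Adapted families -/

variable {T : M → ℕ → End n} {Φ : M → Circle → End n}

lemma isAdapted_iff (h : ExtCoeffs r T) (hΦ : ∀ p z, Φ p z = polyLoop r (T p) z) {N : ℕ}
    {L : Fin N → M → Jet r n} :
    IsAdapted (fun p => grassModel (Φ p)) L ↔ (∀ j, IsMeromorphicSection (L j)) ∧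
      ∀ u ≤ r, ∀ᶠ p in codiscrete M, ∀ e ∈ holCharts M, p ∈ e.source →
        (WS r (T p)).comap ext ⊓ posJ r n u = Submodule.span ℂ {x | ∃ (j : Fin N) (k l : ℕ),
          k ≤ l ∧ u ≤ order (L j) + l ∧ x = shJ l (derivK e k (L j) p)} := by
  have key : ∀ u ≤ r, ∀ p, ∀ e : OpenPartialHomeomorph M ℂ,
      (grassModel (Φ p) ⊓ hPlus n u =
        Submodule.span ℂ {f | ∃ (j : Fin N) (k l : ℕ), k ≤ l ∧ u ≤ order (L j) + l ∧
          f = Jet.toH l (derivK e k (L j) p)} ⊔ hPlus n r ↔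
      (WS r (T p)).comap ext ⊓ posJ r n u = Submodule.span ℂ {x | ∃ (j : Fin N) (k l : ℕ),
          k ≤ l ∧ u ≤ order (L j) + l ∧ x = shJ l (derivK e k (L j) p)}) := by
    intro u hu p e
    have hset : ∀ {X : Type _} (F : ℕ → Jet r n → X),
        {f | ∃ (j : Fin N) (k l : ℕ), k ≤ l ∧ u ≤ order (L j) + l ∧
          f = F l (derivK e k (L j) p)} =
        range fun t : {t : Fin N × ℕ × ℕ // t.2.1 ≤ t.2.2 ∧ u ≤ order (L t.1) + t.2.2} =>
          F t.1.2.2 (derivK e t.1.2.1 (L t.1.1) p) := by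
      intro X F
      ext f
      constructor
      · rintro ⟨j, k, l, h1, h2, rfl⟩
        exact ⟨⟨(j, k, l), h1, h2⟩, rfl⟩
      · rintro ⟨⟨⟨j, k, l⟩, h1, h2⟩, rfl⟩
        exact ⟨j, k, l, h1, h2, rfl⟩
    rw [hset fun l x => Jet.toH l x, hset fun l x => shJ l x]
    exact adapted_iff (hΦ p) (h.unitary p) hu _ _
  refine and_congr_right fun _ => forall₂_congr fun u hu => ?_
  refine Iff.of_eq (congrArg (fun Q : M → Prop => ∀ᶠ p in codiscrete M, Q p) ?_)
  funext p
  exact propext (forall₃_congr fun e _ _ => key u hu p e)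

/-- The family is the union over `u ≤ r` of meromorphic families spanning `W ∩ λ^u H_+`. A member
for `u` has order at least `u` unless it vanishes, so the terms with `k = l = 0` already span. The
other terms stay in `W ∩ λ^u H_+` because `λ^k ∂^k` preserves sections of `W` and derivatives do not
lower the order. -/
lemma exists_isAdapted [T1Space M] [ConnectedSpace M] (h : ExtCoeffs r T)
    (hΦ : ∀ p z, Φ p z = polyLoop r (T p) z) :
    ∃ (N : ℕ) (L : Fin N → M → Jet r n), IsAdapted (fun p => grassModel (Φ p)) L := by
  set B₀ : M → Submodule ℂ (Jet r n) := fun p => (WS r (T p)).comap ext with hB₀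
  have hhol : HolBundle B₀ := h.holBundle le_rfl
  have hdcl : DClosed (shL r n 1) B₀ := h.dClosed le_rfl
  choose N L hL hspan using fun u : Fin (r + 1) =>
    (hhol.meroBundle.inf (posJ r n (u : ℕ))).exists_sections
  let φ := Fintype.equivFin (Σ u : Fin (r + 1), Fin (N u))
  let L' : Fin (Fintype.card (Σ u : Fin (r + 1), Fin (N u))) → M → Jet r n :=
    fun j => L (φ.symm j).1 (φ.symm j).2
  have hL' : ∀ j, IsMeromorphicSection (L' j) := fun j e he p hp => hL _ _ e he p hp
  have hmem : ∀ j, ∀ᶠ p in codiscrete M, L' j p ∈ B₀ p ⊓ posJ r n ((φ.symm j).1 : ℕ) := by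
    intro j
    filter_upwards [hspan (φ.symm j).1] with p hp
    rw [← hp]
    exact Submodule.subset_span ⟨(φ.symm j).2, rfl⟩
  refine ⟨_, L', (isAdapted_iff h hΦ).mpr ⟨hL', fun u hu => ?_⟩⟩
  have h1 : ∀ᶠ p in codiscrete M, ∀ j, ∀ e ∈ holCharts M, p ∈ e.source →
      ∀ k, shJ k (derivK e k (L' j) p) ∈ B₀ p := by
    rw [Filter.eventually_all]
    intro j
    filter_upwards [(hL' j).eventually_derivK_mem hdcl
      ((hmem j).mono fun p hp => (Submodule.mem_inf.mp hp).1)] with p hp e he hpe k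
    have := hp e he hpe k
    rwa [shL_one_pow_apply] at this
  have h2 : ∀ᶠ p in codiscrete M, ∀ j, ∀ e ∈ holCharts M, p ∈ e.source →
      ∀ k, derivK e k (L' j) p ∈ posJ r n (order (L' j)) := by
    rw [Filter.eventually_all]
    exact fun j => (hL' j).eventually_derivK_mem_posJ
  have h3 : ∀ᶠ p in codiscrete M, ∀ j, ((φ.symm j).1 : ℕ) = u → ¬ u ≤ order (L' j) →
      L' j p = 0 := by
    rw [Filter.eventually_all]
    intro j
    by_cases hj : ((φ.symm j).1 : ℕ) = u ∧ ¬ u ≤ order (L' j)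
    · have : ∀ᶠ p in codiscrete M, L' j p = 0 := by
        by_contra h0
        refine hj.2 (le_order ?_ h0)
        filter_upwards [hmem j] with p hp
        rw [← hj.1]
        exact (Submodule.mem_inf.mp hp).2
      exact this.mono fun p hp _ _ => hp
    · exact Eventually.of_forall fun p h4 h5 => absurd ⟨h4, h5⟩ hj
  filter_upwards [h1, h2, h3, hspan ⟨u, by omega⟩] with p h1 h2 h3 h4 e he hp
  apply le_antisymm
  · change B₀ p ⊓ posJ r n u ≤ _
    rw [← h4, Submodule.span_le]
    rintro _ ⟨m, rfl⟩
    obtain ⟨j, hj⟩ := φ.symm.surjective ⟨⟨u, by omega⟩, m⟩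
    have hLj : L' j = L ⟨u, by omega⟩ m :=
      congrArg (fun t : Σ u : Fin (r + 1), Fin (N u) => L t.1 t.2) hj
    have hju : ((φ.symm j).1 : ℕ) = u := by rw [hj]
    change L ⟨u, _⟩ m p ∈ _
    rw [← hLj]
    by_cases ho : u ≤ order (L' j)
    · refine Submodule.subset_span ⟨j, 0, 0, le_rfl, ho, ?_⟩
      rw [shJ_zero, derivK, iteratedDeriv_zero, Function.comp_apply, e.left_inv hp]
    · rw [h3 j hju ho]
      exact Submodule.zero_mem _
  · rw [Submodule.span_le]
    rintro _ ⟨j, k, l, hkl, hul, rfl⟩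
    refine Submodule.mem_inf.mpr ⟨shJ_mem_of_le (comap_WS_shift le_rfl) hkl (h1 j e he hp k), ?_⟩
    exact posJ_mono (by exact_mod_cast hul) (shJ_mem_posJ (h2 j e he hp k))

lemma numUhl_add_le (a : FirstStep) {r i : ℕ} (hi : i ≤ r) : numUhl a r i + i ≤ r := by
  cases a <;> simp only [numUhl] <;> omega

lemma givenBySections [T1Space M] (h : ExtCoeffs r T) (hΦ : ∀ p z, Φ p z = polyLoop r (T p) z)
    {a : FirstStep} {B : ℕ → M → Submodule ℂ (Jet r n)} (hB : FiltrBundle B)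
    (hBe : ∀ i ≤ r, ∀ᶠ p in codiscrete M,
        B i p = altJ ((WS r (T p)).comap ext) (numUhl a r i) i)
    {N : ℕ} {L : Fin N → M → Jet r n} (hL : IsAdapted (fun p => grassModel (Φ p)) L) :
    GivenBySections a L (unitonOf B) := by
  intro i hi
  obtain ⟨i, rfl⟩ : ∃ j, i = j + 1 := ⟨i - 1, by have := (Finset.mem_Icc.mp hi).1; omega⟩
  have hir : i + 1 ≤ r := (Finset.mem_Icc.mp hi).2
  obtain ⟨hmer, hspan⟩ := (isAdapted_iff h hΦ).mp hL
  have hu := numUhl_add_le a hir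
  have h2 : ∀ᶠ p in codiscrete M, ∀ j, ∀ e ∈ holCharts M, p ∈ e.source →
      ∀ k, derivK e k (L j) p ∈ posJ r n (order (L j)) := by
    rw [Filter.eventually_all]
    exact fun j => (hmer j).eventually_derivK_mem_posJ
  filter_upwards [h2, hspan 0 (by omega), hspan (numUhl a r (i + 1)) (by omega), hBe i (by omega),
    hBe (i + 1) hir] with p h2 h3 h4 h5 h6 e he hp
  refine span_formula (D := fun j k => derivK e k (L j) p) (fun j k => h2 j e he hp k)
    (fun j k l hkl => ?_) (h4 e he hp) (hB.filtr p) (u' := numUhl a r i) (by omega) ?_ h6 ?_ hu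
  · have h7 : shJ l (derivK e k (L j) p) ∈ (WS r (T p)).comap ext ⊓ posJ r n (0 : ℕ) := by
      rw [h3 e he hp]
      exact Submodule.subset_span ⟨j, k, l, hkl, Nat.zero_le _, rfl⟩
    exact (Submodule.mem_inf.mp h7).1
  · rw [h5, altJ]
    exact le_sup_left
  · intro x hx
    rw [mem_comap_shJ] at hx ⊢
    exact shJ_mem_of_le (B := (WS r (T p)).comap ext) (comap_WS_shift le_rfl)
      (numUhl_succ_le a r i) hx

end

end UnitonTheory

/-! ### The main theorem -/

theorem mainTheorem2 {M : Type*} [TopologicalSpace M] [T2Space M] [ConnectedSpace M]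
    [ChartedSpace ℂ M] [IsManifold 𝓘(ℂ, ℂ) ω M]
    (n r s : ℕ) (hr : r = 2 * s + 1) (Φ : M → Circle → UnitonTheory.End n)
    (hext : IsExtendedSolution Φ) (hreal : ∀ p, Φ p ∈ realLoops n r) :
    (∃ m : ℕ, n = 2 * m) ∧
    (∃ (N : ℕ) (L : Fin N → M → Jet r n), IsAdapted (fun p => grassModel (Φ p)) L) ∧
    ∀ a : FirstStep, ∃ α : ℕ → M → Submodule ℂ (UnitonTheory.E n),
      IsUnitonFactorization r Φ α ∧
      ((∀ p, Maximal IsIsotropic (α 1 p)) ∧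
        ∃ J : M → OrthCplxStr n, IsHolomorphicOCS J ∧ ∀ p, zeroOneSpace (J p) = α 1 p) ∧
      (∀ l, 1 ≤ l → l ≤ s → ∀ p, etaProd α (2 * l - 1) 2 p ∈ realLoops n 2) ∧
      (∀ j, 1 ≤ j → j ≤ s → ∀ p, etaProd α 1 (2 * j) p ∈ realLoops n (2 * j)) ∧
      GivenByFiltration a r (fun p => grassModel (Φ p)) α ∧
      (∀ (N : ℕ) (L : Fin N → M → Jet r n),
        IsAdapted (fun p => grassModel (Φ p)) L → GivenBySections a L α) ∧
      ((∀ p, Φ p ∈ nuLoops n r) →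
        ∀ i < r, ∀ p, etaProd α 0 (i + 1) p ∈ nuLoops n (i + 1)) := by
  have hpoly : ∀ p, Φ p ∈ polyLoops n r := fun p => (hreal p).1
  obtain ⟨T, hT, hΦ⟩ := exists_extCoeffs hext hpoly
  have hΦT : ∀ p, Φ p = polyLoop r (T p) := fun p => funext (hΦ p)
  have hrealT : ∀ p, IsReal r (polyLoop r (T p)) := fun p => by
    rw [← hΦT]
    exact (hreal p).2
  have key : ∀ a : FirstStep, ∃ B : ℕ → M → Submodule ℂ (Jet r n), FiltrBundle B ∧
      (∀ i ≤ r, ∀ᶠ p in codiscrete M,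
        B i p = altJ ((WS r (T p)).comap ext) (numUhl a r i) i) ∧
      (∀ p, B r p = (WS r (T p)).comap ext) ∧
      (∀ i ≤ r, Even (r - i) → ∀ p, IsReal i (etaProd (unitonOf B) 0 i p)) ∧
      ∀ p, conjOp (proj (unitonOf B 1 p)) = 1 - proj (unitonOf B 1 p) := by
    intro a
    obtain ⟨B, hB, hBe, hBr⟩ := exists_filtrBundle hT a
    have hreal' : ∀ i ≤ r, Even (r - i) → ∀ p, IsReal i (etaProd (unitonOf B) 0 i p) := by
      intro i hi he p
      rw [etaProd_eq_polyLoop]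
      exact isReal_unitonCoeffs hT hB hBe hrealT hi he p
    refine ⟨B, hB, hBe, hBr, hreal', fun p => conjOp_proj_of_isReal fun z => ?_⟩
    -- The parity of `r` enters here: `r - 1 = s + s` is even, so the first partial product is real
    -- of degree one.
    have h1 := hreal' 1 (by omega) ⟨s, by omega⟩ p z
    have h2 : etaProd (unitonOf B) 0 1 p z = linFactor (unitonOf B 1 p) z := one_mul _
    rwa [h2] at h1
  refine ⟨?_, exists_isAdapted hT hΦ, fun a => ?_⟩
  · obtain ⟨B, -, -, -, -, hJ⟩ := key .uhlenbeck
    obtain ⟨p⟩ : Nonempty M := inferInstance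
    exact even_of_orthCplxStr (ocs _ (hJ p))
  obtain ⟨B, hB, hBe, hBr, hreal', hJ⟩ := key a
  refine ⟨unitonOf B, hB.isUnitonFactorization fun p z => ?_,
    ⟨fun p => maximal_isIsotropic (hJ p), fun p => ocs _ (hJ p), ?_,
      fun p => zeroOneSpace_ocs (hJ p)⟩, fun l hl hls p => ?_, fun j hj hjs p => ?_,
    givenByFiltration hT hΦ hBe, fun N L hL => givenBySections hT hΦ hB hBe hL,
    fun hnu i hi p => ?_⟩
  · rw [hΦ, polyLoop_unitonCoeffs (hT.unitary p) (hT.one p) hB (hBr p)]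
  · have h1 : (fun p => zeroOneSpace (ocs _ (hJ p))) = unitonOf B 1 :=
      funext fun p => zeroOneSpace_ocs (hJ p)
    unfold IsHolomorphicOCS
    rw [h1]
    exact (hB.holBundle_unitonOf_one (by omega)).isHolomorphicSubbundle
  -- The quadratic factor is the quotient of the real loops `Φ_{2l-1}` and `Φ_{2l+1}`. The even
  -- partial product below is likewise the quotient of `Φ_1` and `Φ_{2j+1}`.
  · exact ⟨etaProd_mem_polyLoops _ _ _, isReal_etaProd
      (hreal' (2 * l - 1) (by omega) ⟨s - l + 1, by omega⟩ p)
      (hreal' (2 * l - 1 + 2) (by omega) ⟨s - l, by omega⟩ p)⟩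
  · exact ⟨etaProd_mem_polyLoops _ _ _, isReal_etaProd
      (hreal' 1 (by omega) ⟨s, by omega⟩ p)
      (hreal' (1 + 2 * j) (by omega) ⟨s - j, by omega⟩ p)⟩
  · refine ⟨etaProd_mem_polyLoops _ _ _, ?_⟩
    rw [etaProd_eq_polyLoop]
    exact nuInv_unitonCoeffs hT hB hBe (fun q => by rw [← hΦT]; exact (hnu q).2) (by omega) p
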